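/- **Game.** A learner plays $T\ge 1$ rounds of a Colonel Blotto game on $n$ battlefields with weights $b_i>0$, $\sum_i b_i=1$. In round $t$ the adversary draws $v_t\in\mathbb Z_{\ge0}^n$ independently from a fixed distribution $D$, unknown to the learner, and the learner chooses $u_t\in\mathbb Z_{\ge 0}^n$; the reward is $r_t(u_t)=\sum_i b_i(\mathbf 1_{u_{t,i}>v_{t,i}}+\kappa\mathbf 1_{u_{t,i}=v_{t,i}})$, where $\kappa\in[0,1]$ is the share in a tie (e.g. $\kappa=\tfrac12$ or $\kappa=0$). The total budget is an integer $B$, and the learner allocates at most $m$ troops per round, where $m\ge1$ is an integer with $m\le cB/T$ (e.g. $m=cB/T$), $c>0$. Let $w(u)=\sum_i u_i$, $\mathcal S=\{u\in\mathbb Z_{\ge0}^n: w(u)\le m\}$ and $S=|\mathcal S|$. Let $\mathrm{OPT}_{DP}$ be the supremum of the expected cumulative reward over all (randomized, history-dependent) policies that choose $u_t\in\mathcal S$ with $\sum_{t\le T}w(u_t)\le B$. **Graph.** The revised layered graph $G_{m,n+1}$ has the source $(0,0)$, nodes $(i,j)$ for $1\le i\le n$, $0\le j\le m$, a destination $d$,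 the edges $(i-1,j)\to(i,j')$ for $j\le j'$, and auxiliary edges $(n,j)\to d$; it has $E$ edges in total. An allocation $u\in\mathcal S$ is identified with the path through the nodes $(i,u_1+\dots+u_i)$, and with the vector in $\{0,1\}^E$ whose ones are the $n$ non-auxiliary edges of this path. Let $\mu$ be an exploration distribution on $\mathcal S$ whose support spans the same linear space as $\mathcal S$, and let $\lambda^*$ be the smallest nonzero eigenvalue of $\mathbb E_{u\sim\mu}[uu^\top]$. Put $$\gamma=\frac n{\lambda^*}\sqrt{\frac{\ln S}{(\frac n{E\lambda^*}+1)E\,T^{2/3}}},\qquad \eta=\frac{\gamma\lambda^*}{(1+c)n},$$ and suppose $\gamma\le1$. **Algorithm (LagrangeBwK-Edge).** All edge weights and the Hedge weights of the two resources (troops, time) start at $1$. In round $t$: (1) with probability $\gamma$ sample $u_t$ from $\mu$, otherwise sample $u_t\in\mathcal S$ with probability proportional to the product of the weights of the edges of its path; let $p_t$ be the resulting law of $u_t$. (2) If $w(u_t)$ exceeds the remaining budget $x$, replace $u_t$ by an allocation with $w(u_t)=x$, sampled in the same way among these allocations (with the current weights, and with any exploration distribution on these allocations instead of $\mu$), collect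 its reward, and terminate. (3) Otherwise collect $r_t(u_t)$, set $\mathcal L_t^{\rm troop}=r_t(u_t)+1-\frac TB w(u_t)$ and $\mathcal L_t^{\rm time}=r_t(u_t)$; Hedge draws a resource with probability proportional to its weight, and the payoff $\rho_t$ of that resource is passed to Edge. With $C_t=\mathbb E_{u\sim p_t}[uu^\top]$ and $C_t^{-1}$ its Moore–Penrose inverse, multiply the weight of every non-auxiliary edge $e$ by $\exp(\eta\,\rho_t(C_t^{-1}u_t)_e)$, and multiply the Hedge weight of each resource by $\exp(-\varepsilon\mathcal L_t)$ with its own payoff $\mathcal L_t$. The Hedge rate satisfies $a_1/\sqrt T\le\varepsilon\le a_2/\sqrt T$ for constants $a_1,a_2>0$. **Theorem.** For all constants $c,a_1,a_2>0$ there is a constant $C>0$, depending only on them, such that in every such situation and for every $\delta\in(0,1)$, with probability at least $1-C\delta T$ the realized regret satisfies $$\mathrm{OPT}_{DP}-\sum_t r_t(u_t)\ \le\ C\,T^{1/6}\sqrt{\frac{nB}{\lambda^*}\ln\frac T\delta},$$ where the sum runs over the rounds played until termination. -/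

import Mathlib

open scoped ENNReal

namespace Blotto

noncomputable section

/-! ### The one-shot game -/

/-- The fixed action set: integer allocations to `n` battlefields of at most `m` troops in total. -/
abbrev Action (n m : ℕ) : Type :=
  {u : Fin n → Fin (m + 1) // ∑ i, (u i : ℕ) ≤ m}

/-- The number of troops consumed by an allocation. -/
def cost {n m : ℕ} (u : Action n m) : ℕ := ∑ i, (u.1 i : ℕ)

/-- The allocations that use exactly `x` troops. -/
abbrev ReducedAction (n m x : ℕ) : Type := {u : Action n m // cost u = x}

/-- The learner's reward for the allocation `u` against `v`, with battlefield weights `b`: a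
battlefield that is won gives its whole weight, a tied one gives the fraction `κ` of it. -/
def reward {n m : ℕ} (b : Fin n → ℝ) (κ : ℝ) (u : Action n m) (v : Fin n → ℕ) : ℝ :=
  ∑ i, b i * (if v i < (u.1 i : ℕ) then 1 else if (u.1 i : ℕ) = v i then κ else 0)

/-! ### The best dynamic policy -/

/-- Past rounds (the learner's allocation and the adversary's allocation), latest first. -/
abbrev History (n m : ℕ) : Type := List (Action n m × (Fin n → ℕ))

/-- The troops used along a history. -/
def spent {n m : ℕ} (h : History n m) : ℕ := (h.map fun p => cost p.1).sum

/-- The reward collected along a history. -/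
def collected {n m : ℕ} (b : Fin n → ℝ) (κ : ℝ) (h : History n m) : ℝ :=
  (h.map fun p => reward b κ p.1 p.2).sum

/-- Dynamic policies: randomized and dependent on the whole past. -/
abbrev Policy (n m : ℕ) : Type := History n m → PMF (Action n m)

/-- The policy never allocates more than what is left of the budget `B`. -/
def Policy.Feasible {n m : ℕ} (B : ℕ) (π : Policy n m) : Prop :=
  ∀ h : History n m, spent h ≤ B → ∀ u ∈ (π h).support, spent h + cost u ≤ B

/-- The law of the history after `t` rounds under the policy `π`, when the adversary draws its
allocation independently from `D` in every round. -/
def historyLaw {n m : ℕ} (D : PMF (Fin n → ℕ)) (π : Policy n m) : ℕ → PMF (History n m)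
  | 0 => PMF.pure []
  | t + 1 => (historyLaw D π t).bind fun h =>
      (π h).bind fun u => D.bind fun v => PMF.pure ((u, v) :: h)

/-- The expected cumulative reward of a policy over `T` rounds. -/
def policyValue {n m : ℕ} (b : Fin n → ℝ) (κ : ℝ) (D : PMF (Fin n → ℕ)) (T : ℕ)
    (π : Policy n m) : ℝ :=
  ∑' h : History n m, (historyLaw D π T h).toReal * collected b κ h

/-- The optimal expected cumulative reward over all dynamic policies that spend at most `m` troops
per round and at most `B` troops in `T` rounds, the law `D` of the adversary being known. -/
def optDP {n : ℕ} (m B T : ℕ) (b : Fin n → ℝ) (κ : ℝ) (D : PMF (Fin n → ℕ)) : ℝ :=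
  sSup {x : ℝ | ∃ π : Policy n m, π.Feasible B ∧ policyValue b κ D T π = x}

/-! ### The revised layered graph -/

/-- Edges `(i, j) → (i + 1, j')` with `j ≤ j'` between the layers `0, …, n`, written `(i, j, j')`;
layer `0` has the single node `(0, 0)`. Such an edge assigns `j' - j` troops to battlefield `i`. -/
abbrev BattleEdge (n m : ℕ) : Type :=
  {e : Fin n × Fin (m + 1) × Fin (m + 1) //
    e.2.1 ≤ e.2.2 ∧ ((e.1 : ℕ) = 0 → (e.2.1 : ℕ) = 0)}

/-- All edges of the revised layered graph: the battlefield edges, and for every node `(n, j)` of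
layer `n` an auxiliary edge to the destination. -/
abbrev GraphEdge (n m : ℕ) : Type := BattleEdge n m ⊕ Fin (m + 1)

/-- The troops that `u` assigns to the first `k` battlefields. -/
def troopsBefore {n m : ℕ} (u : Action n m) (k : ℕ) : ℕ :=
  ∑ i : Fin n, if (i : ℕ) < k then (u.1 i : ℕ) else 0

/-- The edge lies on the source-destination path of the allocation `u`. -/
def OnPath {n m : ℕ} (u : Action n m) : GraphEdge n m → Prop
  | Sum.inl e => troopsBefore u e.1.1 = e.1.2.1 ∧ troopsBefore u (e.1.1 + 1) = e.1.2.2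
  | Sum.inr j => troopsBefore u n = j

open Classical in
/-- The `0`-`1` vector of a strategy. Its ones are the `n` battlefield edges of the path; auxiliary
edges are no part of a strategy and have entry `0`. -/
def strategyVec {n m : ℕ} (u : Action n m) : GraphEdge n m → ℝ
  | Sum.inl e => if OnPath u (Sum.inl e) then 1 else 0
  | Sum.inr _ => 0

/-- The co-occurrence matrix `𝔼[u uᵀ]` of a law on strategies. -/
def cooccurrence {n m : ℕ} (p : PMF (Action n m)) : Matrix (GraphEdge n m) (GraphEdge n m) ℝ :=
  ∑ u, (p u).toReal • Matrix.vecMulVec (strategyVec u) (strategyVec u)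

theorem cooccurrence_isHermitian {n m : ℕ} (p : PMF (Action n m)) :
    (cooccurrence p).IsHermitian := by
  ext i j
  simp [cooccurrence, Matrix.sum_apply, Matrix.vecMulVec_apply, mul_comm]

/-- The Moore-Penrose inverse of the co-occurrence matrix: same eigenvectors, nonzero eigenvalues
inverted, eigenvalue `0` kept (in Lean `0⁻¹ = 0`). -/
def cooccurrenceInv {n m : ℕ} (p : PMF (Action n m)) :
    Matrix (GraphEdge n m) (GraphEdge n m) ℝ :=
  (cooccurrence_isHermitian p).cfc fun x => x⁻¹

/-- The exploration law `μ` explores every direction: the strategies in its support span the same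
linear space as all strategies. -/
def Spanning {n m : ℕ} (μ : PMF (Action n m)) : Prop :=
  ∀ u : Action n m, strategyVec u ∈ Submodule.span ℝ (strategyVec '' μ.support)

/-! ### Sampling -/

/-- The law on a finite type that is proportional to a positive function. -/
def proportional {α : Type*} [Fintype α] [Nonempty α] (f : α → ℝ) (hf : ∀ a, 0 < f a) : PMF α :=
  PMF.normalize (fun a => ENNReal.ofReal (f a))
    (by
      rw [tsum_fintype]
      intro h
      have := (Finset.sum_eq_zero_iff.1 h) (Classical.arbitrary α) (Finset.mem_univ _)
      exact absurd (ENNReal.ofReal_eq_zero.1 this) (not_le.2 (hf _)))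
    (by
      rw [tsum_fintype]
      exact (ENNReal.sum_lt_top.2 fun a _ => ENNReal.ofReal_lt_top).ne)

/-- A coin that shows `true` with probability `γ`. -/
def coin (γ : unitInterval) : PMF Bool :=
  PMF.ofFintype (fun β => ENNReal.ofReal (if β then (γ : ℝ) else 1 - γ)) (by
    have h0 := γ.2.1
    have h1 : (0 : ℝ) ≤ 1 - γ := sub_nonneg.2 γ.2.2
    rw [Fintype.sum_bool, ← ENNReal.ofReal_add (by simpa using h0) (by simpa using h1)]
    simp)

/-- The two resources of the Lagrangian game. -/
inductive Resource : Type
  | troops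
  | time
  deriving DecidableEq

instance : Fintype Resource where
  elems := {Resource.troops, Resource.time}
  complete := fun i => by cases i <;> simp

instance : Nonempty Resource := ⟨Resource.time⟩

instance {n m : ℕ} : Nonempty (Action n m) := ⟨⟨fun _ => 0, by simp⟩⟩

open Classical in
/-- The weight of the path of `u`: the product of the weights of its edges. -/
def pathWeight {n m : ℕ} (w : GraphEdge n m → ℝ) (u : Action n m) : ℝ :=
  ∏ e, if OnPath u e then w e else 1

theorem pathWeight_pos {n m : ℕ} {w : GraphEdge n m → ℝ} (hw : ∀ e, 0 < w e) (u : Action n m) :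
    0 < pathWeight w u := by
  unfold pathWeight
  refine Finset.prod_pos fun e _ => ?_
  split_ifs
  · exact hw e
  · exact one_pos

/-- Path sampling on the revised graph: with probability `γ` from the exploration law `μ`,
otherwise a path with probability proportional to its weight. -/
def samplePath {n m : ℕ} (γ : unitInterval) (μ : PMF (Action n m)) (w : GraphEdge n m → ℝ)
    (hw : ∀ e, 0 < w e) : PMF (Action n m) :=
  (coin γ).bind fun β => if β then μ else proportional (pathWeight w) (pathWeight_pos hw)

theorem nonempty_of_pmf {α : Type*} (p : PMF α) : Nonempty α :=
  p.support_nonempty.to_type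

/-- Path sampling with the current weights on the reduced graph, on which only the paths that
use exactly `x` troops remain; `ν` is the exploration law there. -/
def sampleReduced {n m x : ℕ} (γ : unitInterval) (ν : PMF (ReducedAction n m x))
    (w : GraphEdge n m → ℝ) (hw : ∀ e, 0 < w e) : PMF (ReducedAction n m x) :=
  haveI : Nonempty (ReducedAction n m x) := nonempty_of_pmf ν
  (coin γ).bind fun β =>
    if β then ν else proportional (fun u => pathWeight w u.1) fun u => pathWeight_pos hw u.1

/-! ### The hybrid algorithm -/

/-- The data of a game and of a run of the algorithm. -/
structure Setup (n m : ℕ) where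
  /-- total budget -/
  B : ℕ
  /-- number of rounds -/
  T : ℕ
  /-- battlefield weights -/
  b : Fin n → ℝ
  /-- share of the weight of a battlefield in a tie -/
  κ : ℝ
  /-- law of the adversary's allocation in a round -/
  D : PMF (Fin n → ℕ)
  /-- exploration law on the revised graph -/
  μ : PMF (Action n m)
  /-- exploration laws on the reduced graphs -/
  ν : ∀ x : ℕ, x < m → PMF (ReducedAction n m x)
  /-- exploration probability of the primal algorithm -/
  γ : unitInterval
  /-- learning rate of the primal algorithm -/
  η : ℝ
  /-- learning rate of the dual algorithm -/
  ε : ℝ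

/-- The state of the algorithm between two rounds. -/
structure State (n m : ℕ) where
  /-- the edge weights of the primal algorithm -/
  w : GraphEdge n m → ℝ
  w_pos : ∀ e, 0 < w e
  /-- the weights of the dual algorithm -/
  h : Resource → ℝ
  h_pos : ∀ i, 0 < h i
  /-- the remaining budget -/
  x : ℕ
  /-- the reward collected so far -/
  total : ℝ
  /-- whether the algorithm has terminated -/
  stopped : Bool

namespace Setup

variable {n m : ℕ} (P : Setup n m)

/-- The state before the first round: all weights are `1` and the budget is `B`. -/
def init : State n m where
  w := fun _ => 1
  w_pos := fun _ => one_pos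
  h := fun _ => 1
  h_pos := fun _ => one_pos
  x := P.B
  total := 0
  stopped := false

/-- The payoff of the Lagrangian game for the allocation `u`, a resource, and the adversary's
allocation `v`. -/
def lagrangian (u : Action n m) (v : Fin n → ℕ) : Resource → ℝ
  | Resource.troops => reward P.b P.κ u v + 1 - (P.T : ℝ) / (P.B : ℝ) * (cost u : ℝ)
  | Resource.time => reward P.b P.κ u v

/-- The estimated edge rewards `ρ C⁻¹ u`, where `ρ` is the payoff passed to the primal algorithm
and `C` the co-occurrence matrix of the law from which `u` was sampled. -/
def estimate (s : State n m) (u : Action n m) (ρ : ℝ) : GraphEdge n m → ℝ :=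
  ρ • (cooccurrenceInv (samplePath P.γ P.μ s.w s.w_pos)).mulVec (strategyVec u)

/-- The updated edge weights; auxiliary edges keep theirs. -/
def newWeight (s : State n m) (u : Action n m) (ρ : ℝ) : GraphEdge n m → ℝ
  | Sum.inl e => s.w (Sum.inl e) * Real.exp (P.η * P.estimate s u ρ (Sum.inl e))
  | Sum.inr j => s.w (Sum.inr j)

theorem newWeight_pos (s : State n m) (u : Action n m) (ρ : ℝ) (e : GraphEdge n m) :
    0 < P.newWeight s u ρ e := by
  cases e with
  | inl e => exact mul_pos (s.w_pos _) (Real.exp_pos _)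
  | inr j => exact s.w_pos _

/-- The state after a successful round in which the learner played `u`, the adversary played `v`
and the dual algorithm chose the resource `i`. -/
def update (s : State n m) (u : Action n m) (v : Fin n → ℕ) (i : Resource) : State n m where
  w := P.newWeight s u (P.lagrangian u v i)
  w_pos := P.newWeight_pos s u _
  h := fun k => s.h k * Real.exp (-P.ε * P.lagrangian u v k)
  h_pos := fun k => mul_pos (s.h_pos k) (Real.exp_pos _)
  x := s.x - cost u
  total := s.total + reward P.b P.κ u v
  stopped := false

/-- The state after the last round, in which the learner played `u` from a reduced action set. -/
def finish (s : State n m) (u : Action n m) (v : Fin n → ℕ) : State n m :=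
  { s with
    x := s.x - cost u
    total := s.total + reward P.b P.κ u v
    stopped := true }

/-- One round. The adversary draws `v`, the primal algorithm samples `u`. If the remaining budget
does not suffice for `u`, an allocation of all remaining troops is sampled instead and the
algorithm terminates. Otherwise the dual algorithm draws a resource with probability proportional
to its weights, and all weights are updated. -/
def step (s : State n m) : PMF (State n m) :=
  if s.stopped then PMF.pure s
  else
    P.D.bind fun v =>
      (samplePath P.γ P.μ s.w s.w_pos).bind fun u =>
        if hx : s.x < cost u then
          (sampleReduced P.γ (P.ν s.x (hx.trans_le u.2)) s.w s.w_pos).bind fun u' =>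
            PMF.pure (P.finish s u'.1 v)
        else
          (proportional s.h s.h_pos).bind fun i => PMF.pure (P.update s u v i)

/-- The law of the state after `t` rounds. -/
def run : ℕ → PMF (State n m)
  | 0 => PMF.pure P.init
  | t + 1 => (run t).bind P.step

/-- The probability that the realized regret after `T` rounds, i.e. the optimal expected reward of
a dynamic policy minus the collected reward, is at most `r`. -/
def probRegretLE (r : ℝ) : ℝ :=
  ((P.run P.T).toOuterMeasure
    {s | optDP m P.B P.T P.b P.κ P.D - s.total ≤ r}).toReal

end Setup

end

end Blotto

/-! The dynamic optimum is first replaced by a fixed comparator. The expected visit frequencies of a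
feasible policy form a mixture `X` of allocations that keeps the budget on average and earns the
value of the policy (`exists_mixture`). For a policy within `1` of the supremum it remains to bound
the regret against `T * opt`, where `opt` is the mean reward of `X` per round.

Both learners are analysed with one potential, `logPotential`: `t * opt`, plus `1/ε` times the
logarithm of the total Hedge weight, plus `1/η` times the logarithm of the total path weight minus
its `X`-average over single paths. The Edge part is nonnegative, and the Hedge part dominates minus
the cumulative payoff of either resource. If all rounds are played, the time resource shows that the
potential dominates the regret (`regret_le_of_not_stopped`). If the troops run out, the troops
resource does, up to `c`, because the rounds not played are worth at most `1` each
(`regret_le_of_exhausted`).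

The potential has almost no drift. Given the adversary's draw `v`, Hedge subtracts its mean payoff
and Edge adds the drawn payoff; these cancel in expectation up to `O(γ)`. The comparator term
subtracts an unbiased estimate of the payoff of `X`, which is at least the reward of `X` against `v`
since `X` keeps the budget; averaging over `v` gives `opt`. The second-order term of Edge is `η`
times the trace of the projection `C C⁺`. That trace is the same for every spanning law and at most
`n/λ`, so this term is `O(γ)` too.

Fluctuations are handled by exponentiating the whole potential. All random terms are expressed by
the kernel `K(u,u') = uᵀ C⁺ u'`. It is bounded by `Λ = n/(γλ)`, and since `C⁺ C C⁺ = C⁺`, its rows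
have second moment at most `Λ` instead of `Λ²`. Hence `exp(θ · potential)` grows in expectation by a
factor of at most `exp(growth)` per round as long as `θΛ` stays bounded (`expect_exp_stepBound_le`,
`expect_step_potential_le`), and Markov's inequality finishes.

With `L = log(T/δ)` and `Q = T^(2/3) √(n m L/λ)`, the choice `θ = L/Q` makes every exponent `O(L)`
(`parameter_bounds`, `Regime.exponent_le`). This needs `E = O(n/λ)`, obtained by counting
independent paths, and `log S = O(m L)`, obtained from `γ ≤ 1`. Since `m ≤ cB/T`, `Q` is at most
`√c` times the claimed rate. If `γ > 1/2` or `L > T^(2/3)`, then `Q` is at least `T/6` and the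
trivial bound `T` on the regret is enough. -/

namespace Blotto

noncomputable section

/-! ### Expectations of extended nonnegative functions -/

/-- The expectation of an extended nonnegative function. -/
def expect {α : Type*} (p : PMF α) (f : α → ℝ≥0∞) : ℝ≥0∞ := ∑' a, p a * f a

theorem expect_pure {α : Type*} (a : α) (f : α → ℝ≥0∞) : expect (PMF.pure a) f = f a := by
  unfold expect
  rw [tsum_eq_single a]
  · simp
  · intro b hb
    simp [PMF.pure_apply, hb]

theorem expect_bind {α β : Type*} (p : PMF α) (q : α → PMF β) (f : β → ℝ≥0∞) :
    expect (p.bind q) f = expect p fun a => expect (q a) f := by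
  unfold expect
  simp only [PMF.bind_apply, ← ENNReal.tsum_mul_right, ← ENNReal.tsum_mul_left]
  rw [ENNReal.tsum_comm]
  simp only [mul_assoc]

theorem expect_mono {α : Type*} (p : PMF α) {f g : α → ℝ≥0∞} (h : ∀ a, f a ≤ g a) :
    expect p f ≤ expect p g :=
  ENNReal.tsum_le_tsum fun a => mul_le_mul_right (h a) _

theorem expect_mono_support {α : Type*} (p : PMF α) {f g : α → ℝ≥0∞}
    (h : ∀ a ∈ p.support, f a ≤ g a) : expect p f ≤ expect p g := by
  refine ENNReal.tsum_le_tsum fun a => ?_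
  by_cases ha : a ∈ p.support
  · exact mul_le_mul_right (h a ha) _
  · simp [(PMF.apply_eq_zero_iff p a).2 ha]

theorem expect_congr_support {α : Type*} (p : PMF α) {f g : α → ℝ≥0∞}
    (h : ∀ a ∈ p.support, f a = g a) : expect p f = expect p g :=
  le_antisymm (expect_mono_support p fun a ha => (h a ha).le)
    (expect_mono_support p fun a ha => (h a ha).ge)

theorem expect_const {α : Type*} (p : PMF α) (c : ℝ≥0∞) : expect p (fun _ => c) = c := by
  unfold expect
  rw [ENNReal.tsum_mul_right, p.tsum_coe, one_mul]

theorem expect_add {α : Type*} (p : PMF α) (f g : α → ℝ≥0∞) :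
    expect p (fun a => f a + g a) = expect p f + expect p g := by
  unfold expect
  simp only [mul_add, ENNReal.tsum_add]

theorem expect_mul_left {α : Type*} (p : PMF α) (c : ℝ≥0∞) (f : α → ℝ≥0∞) :
    expect p (fun a => c * f a) = c * expect p f := by
  unfold expect
  rw [← ENNReal.tsum_mul_left]
  exact tsum_congr fun a => mul_left_comm _ _ _

theorem expect_mul_right {α : Type*} (p : PMF α) (c : ℝ≥0∞) (f : α → ℝ≥0∞) :
    expect p (fun a => f a * c) = expect p f * c := by
  simp only [mul_comm _ c, expect_mul_left]

theorem expect_finsetSum {α ι : Type*} (p : PMF α) (s : Finset ι) (f : ι → α → ℝ≥0∞) :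
    expect p (fun a => ∑ i ∈ s, f i a) = ∑ i ∈ s, expect p (f i) := by
  unfold expect
  simp only [Finset.mul_sum]
  exact Summable.tsum_finsetSum fun i _ => ENNReal.summable

theorem expect_fintype {α : Type*} [Fintype α] (p : PMF α) {f : α → ℝ} (hf : ∀ a, 0 ≤ f a) :
    expect p (fun a => ENNReal.ofReal (f a)) = ENNReal.ofReal (∑ a, (p a).toReal * f a) := by
  unfold expect
  rw [tsum_fintype, ENNReal.ofReal_sum_of_nonneg fun a _ =>
    mul_nonneg ENNReal.toReal_nonneg (hf a)]
  refine Finset.sum_congr rfl fun a _ => ?_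
  rw [ENNReal.ofReal_mul ENNReal.toReal_nonneg, ENNReal.ofReal_toReal (p.apply_ne_top a)]

theorem sum_toReal_pmf {α : Type*} [Fintype α] (p : PMF α) : ∑ a, (p a).toReal = 1 := by
  have h := p.tsum_coe
  rw [tsum_fintype] at h
  rw [← ENNReal.toReal_sum fun a _ => p.apply_ne_top a, h, ENNReal.toReal_one]

theorem summable_toReal_pmf {α : Type*} (p : PMF α) : Summable fun a => (p a).toReal :=
  ENNReal.summable_toReal (by rw [p.tsum_coe]; exact ENNReal.one_ne_top)

theorem tsum_toReal_pmf {α : Type*} (p : PMF α) : ∑' a, (p a).toReal = 1 := by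
  rw [← ENNReal.tsum_toReal_eq p.apply_ne_top, p.tsum_coe, ENNReal.toReal_one]

theorem summable_toReal_mul_of_bounded {α : Type*} (p : PMF α) {f : α → ℝ} {K : ℝ}
    (hf : ∀ a, |f a| ≤ K) : Summable fun a => (p a).toReal * f a := by
  refine Summable.of_norm_bounded ((summable_toReal_pmf p).mul_right K) fun a => ?_
  rw [norm_mul, Real.norm_eq_abs, Real.norm_eq_abs, abs_of_nonneg ENNReal.toReal_nonneg]
  exact mul_le_mul_of_nonneg_left (hf a) ENNReal.toReal_nonneg

theorem expect_ofReal {α : Type*} (p : PMF α) {f : α → ℝ} (hf : ∀ a, 0 ≤ f a) {K : ℝ}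
    (hK : ∀ a, f a ≤ K) :
    expect p (fun a => ENNReal.ofReal (f a)) = ENNReal.ofReal (∑' a, (p a).toReal * f a) := by
  unfold expect
  rw [ENNReal.ofReal_tsum_of_nonneg fun a => mul_nonneg ENNReal.toReal_nonneg (hf a)]
  · refine tsum_congr fun a => ?_
    rw [ENNReal.ofReal_mul ENNReal.toReal_nonneg, ENNReal.ofReal_toReal (p.apply_ne_top a)]
  · exact summable_toReal_mul_of_bounded p fun a => by rw [abs_of_nonneg (hf a)]; exact hK a

theorem tsum_toReal_mul_eq {α : Type*} (p : PMF α) {f : α → ℝ} (hf : ∀ a, 0 ≤ f a) :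
    ∑' a, (p a).toReal * f a = (expect p fun a => ENNReal.ofReal (f a)).toReal := by
  unfold expect
  rw [ENNReal.tsum_toReal_eq fun a => ENNReal.mul_ne_top (p.apply_ne_top a) ENNReal.ofReal_ne_top]
  refine tsum_congr fun a => ?_
  rw [ENNReal.toReal_mul, ENNReal.toReal_ofReal (hf a)]

/-- Markov's inequality, as a lower bound for the probability of the complementary event. -/
theorem one_sub_le_toOuterMeasure {α : Type*} (p : PMF α) (A : Set α) (f : α → ℝ≥0∞) {r : ℝ}
    (hr : 0 ≤ r) (hf : ∀ a ∉ A, 1 ≤ f a) (hE : expect p f ≤ ENNReal.ofReal r) :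
    1 - r ≤ (p.toOuterMeasure A).toReal := by
  have h1 : (1 : ℝ≥0∞) ≤ p.toOuterMeasure A + ENNReal.ofReal r := by
    refine le_trans ?_ (add_le_add le_rfl hE)
    rw [PMF.toOuterMeasure_apply, expect, ← ENNReal.tsum_add, ← p.tsum_coe]
    refine ENNReal.tsum_le_tsum fun a => ?_
    by_cases ha : a ∈ A
    · simp [ha]
    · simp only [Set.indicator_of_notMem ha, zero_add]
      exact le_mul_of_one_le_right' (hf a ha)
  have htop : p.toOuterMeasure A ≠ ∞ := by
    refine ne_top_of_le_ne_top ENNReal.one_ne_top ?_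
    rw [PMF.toOuterMeasure_apply, ← p.tsum_coe]
    exact ENNReal.tsum_le_tsum fun a => Set.indicator_le_self _ _ _
  have h2 := ENNReal.toReal_mono (ENNReal.add_ne_top.2 ⟨htop, ENNReal.ofReal_ne_top⟩) h1
  rw [ENNReal.toReal_add htop ENNReal.ofReal_ne_top, ENNReal.toReal_ofReal hr,
    ENNReal.toReal_one] at h2
  linarith

/-! ### The sampling laws -/

theorem proportional_toReal {α : Type*} [Fintype α] [Nonempty α] (f : α → ℝ) (hf : ∀ a, 0 < f a)
    (a : α) : (proportional f hf a).toReal = f a / ∑ b, f b := by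
  unfold proportional
  rw [PMF.normalize_apply, tsum_fintype, ← ENNReal.ofReal_sum_of_nonneg fun b _ => (hf b).le,
    ENNReal.toReal_mul, ENNReal.toReal_inv, ENNReal.toReal_ofReal (hf a).le,
    ENNReal.toReal_ofReal (Finset.sum_nonneg fun b _ => (hf b).le), div_eq_mul_inv]

theorem samplePath_toReal {n m : ℕ} (γ : unitInterval) (μ : PMF (Action n m))
    (w : GraphEdge n m → ℝ) (hw : ∀ e, 0 < w e) (u : Action n m) :
    (samplePath γ μ w hw u).toReal =
      γ * (μ u).toReal + (1 - γ) * (pathWeight w u / ∑ u', pathWeight w u') := by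
  have h0 := γ.2.1
  have h1 : (0 : ℝ) ≤ 1 - γ := sub_nonneg.2 γ.2.2
  unfold samplePath
  rw [PMF.bind_apply, tsum_fintype, Fintype.sum_bool]
  simp only [coin, PMF.ofFintype_apply, if_true, Bool.false_eq_true, if_false]
  rw [ENNReal.toReal_add
    (ENNReal.mul_ne_top ENNReal.ofReal_ne_top (PMF.apply_ne_top _ _))
    (ENNReal.mul_ne_top ENNReal.ofReal_ne_top (PMF.apply_ne_top _ _)),
    ENNReal.toReal_mul, ENNReal.toReal_mul, proportional_toReal,
    ENNReal.toReal_ofReal h0, ENNReal.toReal_ofReal h1]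

/-! ### Exponential inequalities -/

/-- The factor `exp |x|` extends the quadratic bound beyond `|x| ≤ 1`: for `x > 1` the last term
alone exceeds `exp x`, and for `x < -1` it compensates the negative linear term. -/
theorem exp_le_one_add_add_sq_mul (x : ℝ) :
    Real.exp x ≤ 1 + x + x ^ 2 * Real.exp |x| := by
  rcases le_or_gt |x| 1 with hx | hx
  · have h1 := (abs_le.1 (Real.abs_exp_sub_one_sub_id_le hx)).2
    have h2 : 1 ≤ Real.exp |x| := Real.one_le_exp (abs_nonneg x)
    nlinarith [mul_le_mul_of_nonneg_left h2 (sq_nonneg x)]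
  · rcases le_or_gt 0 x with h0 | h0
    · rw [abs_of_nonneg h0] at hx ⊢
      have h3 : 1 ≤ x ^ 2 := by nlinarith
      nlinarith [mul_le_mul_of_nonneg_right h3 (Real.exp_pos x).le]
    · have h2 : 1 ≤ Real.exp |x| := Real.one_le_exp (abs_nonneg x)
      have h3 : Real.exp x ≤ 1 := Real.exp_le_one_iff.2 h0.le
      rw [abs_of_neg h0] at hx
      nlinarith [mul_le_mul_of_nonneg_left h2 (sq_nonneg x)]

theorem exp_le_of_abs_le {x K : ℝ} (hx : |x| ≤ K) :
    Real.exp x ≤ 1 + x + Real.exp K * x ^ 2 := by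
  have h1 := exp_le_one_add_add_sq_mul x
  have h2 := mul_le_mul_of_nonneg_left (Real.exp_le_exp.2 hx) (sq_nonneg x)
  linarith

/-- A bound for the moment generating function of a bounded variable. -/
theorem sum_mul_exp_le {ι : Type*} [Fintype ι] {q f : ι → ℝ} (hq : ∀ i, 0 ≤ q i)
    (hq1 : ∑ i, q i = 1) {K : ℝ} (hf : ∀ i, |f i| ≤ K) :
    ∑ i, q i * Real.exp (f i) ≤ 1 + ∑ i, q i * f i + Real.exp K * ∑ i, q i * f i ^ 2 := by
  calc ∑ i, q i * Real.exp (f i)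
      ≤ ∑ i, q i * (1 + f i + Real.exp K * f i ^ 2) :=
        Finset.sum_le_sum fun i _ => mul_le_mul_of_nonneg_left (exp_le_of_abs_le (hf i)) (hq i)
    _ = 1 + ∑ i, q i * f i + Real.exp K * ∑ i, q i * f i ^ 2 := by
        conv_rhs => rw [← hq1]
        rw [Finset.mul_sum, ← Finset.sum_add_distrib, ← Finset.sum_add_distrib]
        exact Finset.sum_congr rfl fun i _ => by ring

/-! ### Paths and strategy vectors -/

theorem troopsBefore_le {n m : ℕ} (u : Action n m) (k : ℕ) : troopsBefore u k ≤ m := by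
  refine le_trans (Finset.sum_le_sum fun i _ => ?_) u.2
  split_ifs
  · exact le_rfl
  · exact Nat.zero_le _

theorem troopsBefore_zero {n m : ℕ} (u : Action n m) : troopsBefore u 0 = 0 := by
  simp [troopsBefore]

theorem troopsBefore_succ {n m : ℕ} (u : Action n m) (i : Fin n) :
    troopsBefore u (i + 1) = troopsBefore u i + u.1 i := by
  unfold troopsBefore
  have h : ∀ j : Fin n, (if (j : ℕ) < i + 1 then (u.1 j : ℕ) else 0) =
      (if (j : ℕ) < i then (u.1 j : ℕ) else 0) + if j = i then (u.1 j : ℕ) else 0 := by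
    intro j
    rcases lt_trichotomy (j : ℕ) i with hj | hj | hj
    · have : j ≠ i := fun h => by simp [h] at hj
      simp [hj, this, Nat.lt_succ_of_lt hj]
    · have : j = i := Fin.ext hj
      simp [this]
    · have h1 : j ≠ i := fun h => by simp [h] at hj
      have h2 : ¬ (j : ℕ) < i + 1 := by omega
      have h3 : ¬ (j : ℕ) < i := by omega
      simp [h1, h2, h3]
  simp only [h, Finset.sum_add_distrib]
  simp

/-- The edge of the path of `u` that belongs to the battlefield `i`. -/
def edgeOf {n m : ℕ} (u : Action n m) (i : Fin n) : BattleEdge n m :=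
  ⟨(i, ⟨troopsBefore u i, Nat.lt_succ_of_le (troopsBefore_le u i)⟩,
    ⟨troopsBefore u (i + 1), Nat.lt_succ_of_le (troopsBefore_le u (i + 1))⟩),
    by
      refine ⟨?_, fun h => ?_⟩
      · change troopsBefore u i ≤ troopsBefore u (i + 1)
        rw [troopsBefore_succ]
        exact Nat.le_add_right _ _
      · change troopsBefore u i = 0
        change (i : ℕ) = 0 at h
        rw [h, troopsBefore_zero]⟩

theorem onPath_inl_iff {n m : ℕ} (u : Action n m) (e : BattleEdge n m) :
    OnPath u (Sum.inl e) ↔ edgeOf u e.1.1 = e := by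
  simp only [OnPath, edgeOf, Subtype.ext_iff, Prod.ext_iff, Fin.ext_iff, true_and]

theorem onPath_edgeOf {n m : ℕ} (u : Action n m) (i : Fin n) : OnPath u (Sum.inl (edgeOf u i)) :=
  (onPath_inl_iff u _).2 rfl

/-- A path uses exactly one edge per battlefield, so its edges can be indexed by the battlefields.
-/
theorem sum_strategyVec_mul {n m : ℕ} (u : Action n m) (f : GraphEdge n m → ℝ) :
    ∑ e, strategyVec u e * f e = ∑ i, f (Sum.inl (edgeOf u i)) := by
  classical
  rw [Fintype.sum_sum_type]
  simp only [strategyVec, zero_mul, Finset.sum_const_zero, add_zero, ite_mul, one_mul]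
  rw [← Finset.sum_filter]
  refine (Finset.sum_nbij' (fun i => edgeOf u i) (fun e => e.1.1) ?_ ?_ ?_ ?_ ?_).symm
  · intro i _
    simpa using onPath_edgeOf u i
  · intro e _
    exact Finset.mem_univ _
  · intro i _
    rfl
  · intro e he
    exact (onPath_inl_iff u e).1 (Finset.mem_filter.1 he).2
  · intro i _
    rfl

/-- A payoff that is a sum over the battlefields, as a function of the edges. -/
def edgePayoff {n m : ℕ} (φ : Fin n → ℕ → ℝ) : GraphEdge n m → ℝ
  | Sum.inl e => φ e.1.1 (e.1.2.2 - e.1.2.1)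
  | Sum.inr _ => 0

theorem strategyVec_dotProduct_edgePayoff {n m : ℕ} (u : Action n m) (φ : Fin n → ℕ → ℝ) :
    strategyVec u ⬝ᵥ edgePayoff φ = ∑ i, φ i (u.1 i) := by
  rw [dotProduct, sum_strategyVec_mul]
  refine Finset.sum_congr rfl fun i _ => ?_
  simp only [edgePayoff, edgeOf]
  rw [troopsBefore_succ, Nat.add_sub_cancel_left]

theorem strategyVec_dotProduct_self {n m : ℕ} (u : Action n m) :
    strategyVec u ⬝ᵥ strategyVec u = n := by
  rw [dotProduct, sum_strategyVec_mul]
  simp [strategyVec, onPath_edgeOf]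

theorem pathWeight_one {n m : ℕ} (u : Action n m) : pathWeight (fun _ => 1) u = 1 := by
  simp [pathWeight]

/-- Edgewise multiplicative updates are exponential weights on whole paths with linear estimates.
Auxiliary edges do not interfere: they keep their weights and have entry `0` in strategy vectors. -/
theorem pathWeight_newWeight {n m : ℕ} (P : Setup n m) (s : State n m) (u : Action n m) (ρ : ℝ)
    (u' : Action n m) :
    pathWeight (P.newWeight s u ρ) u' =
      pathWeight s.w u' * Real.exp (P.η * (strategyVec u' ⬝ᵥ P.estimate s u ρ)) := by
  classical
  have h : P.η * (strategyVec u' ⬝ᵥ P.estimate s u ρ) =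
      ∑ e, strategyVec u' e * (P.η * P.estimate s u ρ e) := by
    rw [dotProduct, Finset.mul_sum]
    exact Finset.sum_congr rfl fun e _ => by ring
  rw [h, Real.exp_sum]
  unfold pathWeight
  rw [← Finset.prod_mul_distrib]
  refine Finset.prod_congr rfl fun e _ => ?_
  cases e with
  | inl e =>
    by_cases he : OnPath u' (Sum.inl e)
    · simp [he, strategyVec, Setup.newWeight]
    · simp [he, strategyVec]
  | inr j => simp [strategyVec, Setup.newWeight]

/-! ### Payoffs -/

theorem reward_nonneg {n m : ℕ} {b : Fin n → ℝ} {κ : ℝ} (hb : ∀ i, 0 < b i) (hκ : 0 ≤ κ)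
    (u : Action n m) (v : Fin n → ℕ) : 0 ≤ reward b κ u v := by
  refine Finset.sum_nonneg fun i _ => mul_nonneg (hb i).le ?_
  split_ifs <;> first | exact zero_le_one | exact hκ | exact le_rfl

theorem reward_le_one {n m : ℕ} {b : Fin n → ℝ} {κ : ℝ} (hb : ∀ i, 0 < b i) (hb1 : ∑ i, b i = 1)
    (hκ : κ ≤ 1) (u : Action n m) (v : Fin n → ℕ) : reward b κ u v ≤ 1 := by
  rw [← hb1]
  refine Finset.sum_le_sum fun i _ => mul_le_of_le_one_right (hb i).le ?_
  split_ifs <;> first | exact zero_le_one | exact hκ | exact le_rfl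

/-- The payoffs of the Lagrangian game are linear in the strategy vector. -/
theorem exists_lagrangian_eq_dotProduct {n m : ℕ} (P : Setup n m) (hn : n ≠ 0) (v : Fin n → ℕ)
    (i : Resource) :
    ∃ ℓ : GraphEdge n m → ℝ, ∀ u, P.lagrangian u v i = strategyVec u ⬝ᵥ ℓ := by
  have hn' : (n : ℝ) ≠ 0 := Nat.cast_ne_zero.2 hn
  cases i with
  | troops =>
    -- The constant `1` of the payoff is distributed evenly over the `n` edges of the path.
    refine ⟨edgePayoff fun i x => P.b i * (if v i < x then 1 else if x = v i then P.κ else 0) +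
      1 / n - (P.T : ℝ) / P.B * x, fun u => ?_⟩
    rw [strategyVec_dotProduct_edgePayoff, Finset.sum_sub_distrib, Finset.sum_add_distrib,
      ← Finset.mul_sum]
    simp [Setup.lagrangian, reward, cost, hn']
  | time =>
    refine ⟨edgePayoff fun i x => P.b i * (if v i < x then 1 else if x = v i then P.κ else 0),
      fun u => ?_⟩
    rw [strategyVec_dotProduct_edgePayoff]
    rfl

/-- Unbiasedness applied to this payoff shows that every row of the kernel has mean `1` under the
sampling law. -/
theorem exists_one_eq_dotProduct {n m : ℕ} (hn : n ≠ 0) :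
    ∃ ℓ : GraphEdge n m → ℝ, ∀ u, 1 = strategyVec u ⬝ᵥ ℓ := by
  have hn' : (n : ℝ) ≠ 0 := Nat.cast_ne_zero.2 hn
  refine ⟨edgePayoff fun _ _ => 1 / n, fun u => ?_⟩
  rw [strategyVec_dotProduct_edgePayoff]
  simp [hn']

theorem cost_le {n m : ℕ} (u : Action n m) : cost u ≤ m := u.2

theorem abs_lagrangian_le {n m : ℕ} (P : Setup n m) {c : ℝ} (hB : 0 < P.B) (hT : 0 < P.T)
    (hm : (m : ℝ) ≤ c * P.B / P.T) (hb : ∀ i, 0 < P.b i) (hb1 : ∑ i, P.b i = 1)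
    (hκ0 : 0 ≤ P.κ) (hκ1 : P.κ ≤ 1) (u : Action n m) (v : Fin n → ℕ) (i : Resource) :
    |P.lagrangian u v i| ≤ 2 + c := by
  have h0 := reward_nonneg hb hκ0 u v
  have h1 := reward_le_one hb hb1 hκ1 u v
  have hBr : (0 : ℝ) < P.B := Nat.cast_pos.2 hB
  have hTr : (0 : ℝ) < P.T := Nat.cast_pos.2 hT
  have hc : (0 : ℝ) ≤ (P.T : ℝ) / P.B * cost u := by positivity
  have hc' : (P.T : ℝ) / P.B * cost u ≤ c := by
    have : (cost u : ℝ) ≤ c * P.B / P.T := le_trans (Nat.cast_le.2 (cost_le u)) hm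
    calc (P.T : ℝ) / P.B * cost u ≤ P.T / P.B * (c * P.B / P.T) :=
          mul_le_mul_of_nonneg_left this (by positivity)
      _ = c := by field_simp
  cases i with
  | troops =>
    simp only [Setup.lagrangian]
    rw [abs_le]
    constructor <;> linarith
  | time =>
    simp only [Setup.lagrangian]
    rw [abs_le]
    constructor <;> linarith

/-! ### The Moore-Penrose inverse of a symmetric matrix -/

section PseudoInverse

variable {ι : Type*} [Fintype ι] [DecidableEq ι] {A : Matrix ι ι ℝ}

theorem cfc_eq_mul (hA : A.IsHermitian) (f : ℝ → ℝ) :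
    hA.cfc f = (hA.eigenvectorUnitary : Matrix ι ι ℝ) *
      Matrix.diagonal (fun i => f (hA.eigenvalues i)) *
        star (hA.eigenvectorUnitary : Matrix ι ι ℝ) := by
  rw [Matrix.IsHermitian.cfc, Unitary.conjStarAlgAut_apply]
  rfl

theorem cfc_id_eq (hA : A.IsHermitian) : hA.cfc (fun x => x) = A := by
  rw [cfc_eq_mul]
  conv_rhs => rw [hA.spectral_theorem, Unitary.conjStarAlgAut_apply]
  rfl

theorem cfc_mul_cfc (hA : A.IsHermitian) (f g : ℝ → ℝ) :
    hA.cfc f * hA.cfc g = hA.cfc (fun x => f x * g x) := by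
  have h : star (hA.eigenvectorUnitary : Matrix ι ι ℝ) * hA.eigenvectorUnitary = 1 :=
    Unitary.coe_star_mul_self _
  simp only [cfc_eq_mul]
  calc _ = (hA.eigenvectorUnitary : Matrix ι ι ℝ) *
      Matrix.diagonal (fun i => f (hA.eigenvalues i)) *
      (star (hA.eigenvectorUnitary : Matrix ι ι ℝ) * hA.eigenvectorUnitary) *
      Matrix.diagonal (fun i => g (hA.eigenvalues i)) *
        star (hA.eigenvectorUnitary : Matrix ι ι ℝ) := by simp only [Matrix.mul_assoc]
    _ = _ := by rw [h, Matrix.mul_one, Matrix.mul_assoc _ (Matrix.diagonal _) (Matrix.diagonal _),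
                  Matrix.diagonal_mul_diagonal]

theorem cfc_congr (hA : A.IsHermitian) {f g : ℝ → ℝ} (h : ∀ x, f x = g x) :
    hA.cfc f = hA.cfc g := by
  rw [funext h]

theorem cfc_transpose (hA : A.IsHermitian) (f : ℝ → ℝ) : (hA.cfc f).transpose = hA.cfc f := by
  rw [cfc_eq_mul, Matrix.transpose_mul, Matrix.transpose_mul, Matrix.diagonal_transpose,
    Matrix.star_eq_conjTranspose, Matrix.conjTranspose_eq_transpose_of_trivial,
    Matrix.transpose_transpose, Matrix.mul_assoc]

theorem trace_cfc (hA : A.IsHermitian) (f : ℝ → ℝ) :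
    (hA.cfc f).trace = ∑ i, f (hA.eigenvalues i) := by
  have h : star (hA.eigenvectorUnitary : Matrix ι ι ℝ) * hA.eigenvectorUnitary = 1 :=
    Unitary.coe_star_mul_self _
  rw [cfc_eq_mul, Matrix.trace_mul_comm, ← Matrix.mul_assoc, h, Matrix.one_mul,
    Matrix.trace_diagonal]

theorem dotProduct_cfc_mulVec_nonneg (hA : A.IsHermitian) (f : ℝ → ℝ)
    (hf : ∀ i, 0 ≤ f (hA.eigenvalues i)) (x : ι → ℝ) : 0 ≤ x ⬝ᵥ (hA.cfc f).mulVec x := by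
  -- The quadratic form is the squared norm of the image under the symmetric square root.
  have h : hA.cfc f = hA.cfc (fun y => Real.sqrt (f y)) * hA.cfc (fun y => Real.sqrt (f y)) := by
    rw [cfc_mul_cfc, cfc_eq_mul, cfc_eq_mul]
    simp only [Real.mul_self_sqrt (hf _)]
  rw [h, ← Matrix.mulVec_mulVec, Matrix.dotProduct_mulVec, ← Matrix.mulVec_transpose,
    cfc_transpose]
  exact Finset.sum_nonneg fun i _ => mul_self_nonneg _

theorem cfc_sub_mul (hA : A.IsHermitian) (f g : ℝ → ℝ) (a : ℝ) :
    hA.cfc (fun y => f y - a * g y) = hA.cfc f - a • hA.cfc g := by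
  simp only [cfc_eq_mul]
  rw [← Matrix.smul_mul, ← Matrix.mul_smul, ← Matrix.sub_mul, ← Matrix.mul_sub,
    ← Matrix.diagonal_smul, Matrix.diagonal_sub]
  rfl

end PseudoInverse

/-! ### Co-occurrence matrices -/

variable {n m : ℕ}

theorem cooccurrence_mulVec (p : PMF (Action n m)) (x : GraphEdge n m → ℝ) :
    (cooccurrence p).mulVec x = ∑ u, ((p u).toReal * (strategyVec u ⬝ᵥ x)) • strategyVec u := by
  unfold cooccurrence
  rw [Matrix.sum_mulVec]
  refine Finset.sum_congr rfl fun u _ => ?_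
  rw [Matrix.smul_mulVec, Matrix.vecMulVec_mulVec, mul_smul, op_smul_eq_smul]

theorem dotProduct_cooccurrence_mulVec (p : PMF (Action n m)) (x y : GraphEdge n m → ℝ) :
    x ⬝ᵥ (cooccurrence p).mulVec y =
      ∑ u, (p u).toReal * ((strategyVec u ⬝ᵥ x) * (strategyVec u ⬝ᵥ y)) := by
  rw [cooccurrence_mulVec, dotProduct_sum]
  refine Finset.sum_congr rfl fun u _ => ?_
  rw [dotProduct_smul, dotProduct_comm x, smul_eq_mul]
  ring

theorem trace_cooccurrence (p : PMF (Action n m)) : (cooccurrence p).trace = n := by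
  unfold cooccurrence
  rw [Matrix.trace_sum]
  simp only [Matrix.trace_smul, Matrix.trace_vecMulVec, strategyVec_dotProduct_self, smul_eq_mul]
  rw [← Finset.sum_mul, sum_toReal_pmf, one_mul]

theorem cooccurrenceInv_mul (p : PMF (Action n m)) :
    cooccurrenceInv p * cooccurrence p = (cooccurrence_isHermitian p).cfc fun x => x⁻¹ * x := by
  have h := cfc_mul_cfc (cooccurrence_isHermitian p) (fun x => x⁻¹) fun x => x
  rwa [cfc_id_eq] at h

theorem mul_cooccurrenceInv (p : PMF (Action n m)) :
    cooccurrence p * cooccurrenceInv p = (cooccurrence_isHermitian p).cfc fun x => x⁻¹ * x := by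
  have h := cfc_mul_cfc (cooccurrence_isHermitian p) (fun x => x) fun x => x⁻¹
  rw [cfc_id_eq] at h
  exact h.trans (cfc_congr _ fun x => mul_comm _ _)

theorem cooccurrence_commute (p : PMF (Action n m)) :
    cooccurrence p * cooccurrenceInv p = cooccurrenceInv p * cooccurrence p := by
  rw [mul_cooccurrenceInv, cooccurrenceInv_mul]

theorem cooccurrence_mul_inv_mul (p : PMF (Action n m)) :
    cooccurrence p * cooccurrenceInv p * cooccurrence p = cooccurrence p := by
  have h := cfc_mul_cfc (cooccurrence_isHermitian p) (fun x => x⁻¹ * x) fun x => x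
  rw [cfc_id_eq] at h
  rw [mul_cooccurrenceInv, h]
  conv_rhs => rw [← cfc_id_eq (cooccurrence_isHermitian p)]
  refine cfc_congr _ fun x => ?_
  rcases eq_or_ne x 0 with rfl | hx
  · simp
  · field_simp

theorem cooccurrenceInv_mul_mul_inv (p : PMF (Action n m)) :
    cooccurrenceInv p * cooccurrence p * cooccurrenceInv p = cooccurrenceInv p := by
  have h := cfc_mul_cfc (cooccurrence_isHermitian p) (fun x => x⁻¹ * x) fun x => x⁻¹
  rw [cooccurrenceInv_mul]
  refine h.trans (cfc_congr _ fun x => ?_)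
  rcases eq_or_ne x 0 with rfl | hx
  · simp
  · field_simp

theorem dotProduct_cooccurrenceInv_mulVec_comm (p : PMF (Action n m)) (x y : GraphEdge n m → ℝ) :
    x ⬝ᵥ (cooccurrenceInv p).mulVec y = y ⬝ᵥ (cooccurrenceInv p).mulVec x := by
  rw [Matrix.dotProduct_mulVec, ← Matrix.mulVec_transpose, cooccurrenceInv, cfc_transpose,
    dotProduct_comm]

theorem dotProduct_cooccurrence_mulVec_comm (p : PMF (Action n m)) (x y : GraphEdge n m → ℝ) :
    x ⬝ᵥ (cooccurrence p).mulVec y = y ⬝ᵥ (cooccurrence p).mulVec x := by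
  simp only [dotProduct_cooccurrence_mulVec]
  exact Finset.sum_congr rfl fun u _ => by ring

/-- The form `xᵀ C x` is a weighted sum of the squares `(u · x)²`, so it vanishes only if each term
does. -/
theorem dotProduct_eq_zero_of_cooccurrence_mulVec_eq_zero (p : PMF (Action n m))
    {x : GraphEdge n m → ℝ} (hx : (cooccurrence p).mulVec x = 0) {u : Action n m}
    (hu : u ∈ p.support) : strategyVec u ⬝ᵥ x = 0 := by
  have h := dotProduct_cooccurrence_mulVec p x x
  rw [hx, dotProduct_zero, eq_comm, Finset.sum_eq_zero_iff_of_nonneg fun u _ =>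
    mul_nonneg ENNReal.toReal_nonneg (mul_self_nonneg _)] at h
  have h1 := h u (Finset.mem_univ _)
  have h2 : (p u).toReal ≠ 0 :=
    (ENNReal.toReal_pos ((PMF.mem_support_iff _ _).1 hu) (p.apply_ne_top u)).ne'
  exact mul_self_eq_zero.1 ((mul_eq_zero.1 h1).resolve_left h2)

/-- The projection `C C⁻¹` fixes the strategies that have positive probability. -/
theorem cooccurrence_inv_mulVec_of_mem_support (p : PMF (Action n m)) {u : Action n m}
    (hu : u ∈ p.support) :
    (cooccurrence p * cooccurrenceInv p).mulVec (strategyVec u) = strategyVec u := by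
  -- The residual `z` lies in the kernel of `C`. It is therefore orthogonal to `u` and to the range
  -- of `C`, hence to itself.
  set z := strategyVec u - (cooccurrence p * cooccurrenceInv p).mulVec (strategyVec u) with hz
  have hCz : (cooccurrence p).mulVec z = 0 := by
    rw [hz, Matrix.mulVec_sub, Matrix.mulVec_mulVec, cooccurrence_commute, ← Matrix.mul_assoc,
      cooccurrence_mul_inv_mul, sub_self]
  have h1 := dotProduct_eq_zero_of_cooccurrence_mulVec_eq_zero p hCz hu
  have h2 : z ⬝ᵥ z = 0 := by
    conv_lhs => arg 2; rw [hz]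
    rw [dotProduct_sub, dotProduct_comm, h1, ← Matrix.mulVec_mulVec,
      dotProduct_cooccurrence_mulVec_comm, hCz, dotProduct_zero, sub_zero]
  exact (sub_eq_zero.1 (dotProduct_self_eq_zero.1 h2)).symm

theorem cooccurrence_inv_mulVec_of_mem_span (p : PMF (Action n m)) {x : GraphEdge n m → ℝ}
    (hx : x ∈ Submodule.span ℝ (strategyVec '' p.support)) :
    (cooccurrence p * cooccurrenceInv p).mulVec x = x := by
  induction hx using Submodule.span_induction with
  | mem x hx =>
    obtain ⟨u, hu, rfl⟩ := hx
    exact cooccurrence_inv_mulVec_of_mem_support p hu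
  | zero => exact Matrix.mulVec_zero _
  | add x y _ _ hx hy => rw [Matrix.mulVec_add, hx, hy]
  | smul a x _ hx => rw [Matrix.mulVec_smul, hx]

theorem cooccurrence_inv_mulVec {p : PMF (Action n m)} (hp : Spanning p) (u : Action n m) :
    (cooccurrence p * cooccurrenceInv p).mulVec (strategyVec u) = strategyVec u :=
  cooccurrence_inv_mulVec_of_mem_span p (hp u)

theorem cooccurrence_mulVec_mem_span {p : PMF (Action n m)} (q : PMF (Action n m))
    (hp : Spanning p) (x : GraphEdge n m → ℝ) :
    (cooccurrence q).mulVec x ∈ Submodule.span ℝ (strategyVec '' p.support) := by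
  rw [cooccurrence_mulVec]
  exact Submodule.sum_mem _ fun u _ => Submodule.smul_mem _ _ (hp u)

/-- All laws that explore every direction lead to the same projection. -/
theorem cooccurrence_mul_inv_eq {p q : PMF (Action n m)} (hp : Spanning p) (hq : Spanning q) :
    cooccurrence p * cooccurrenceInv p = cooccurrence q * cooccurrenceInv q := by
  -- The range of any co-occurrence matrix lies in the common span, which the projection of a
  -- spanning law fixes. Transposing this identity with `p` and `q` exchanged gives equality.
  have key : ∀ {p q : PMF (Action n m)}, Spanning p →
      cooccurrence p * cooccurrenceInv p * (cooccurrence q * cooccurrenceInv q) =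
        cooccurrence q * cooccurrenceInv q := by
    intro p q hp
    refine Matrix.ext_of_mulVec_single fun i => ?_
    rw [← Matrix.mulVec_mulVec]
    refine cooccurrence_inv_mulVec_of_mem_span p ?_
    rw [← Matrix.mulVec_mulVec]
    exact cooccurrence_mulVec_mem_span q hp _
  have ht : ∀ p : PMF (Action n m), (cooccurrence p * cooccurrenceInv p).transpose =
      cooccurrence p * cooccurrenceInv p := fun p => by
    rw [mul_cooccurrenceInv, cfc_transpose]
  have h1 := key (q := q) hp
  have h2 := congrArg Matrix.transpose (key (q := p) hq)
  rw [Matrix.transpose_mul, ht, ht] at h2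
  exact h2.symm.trans h1

/-! ### Consequences of the smallest nonzero eigenvalue -/

section Eigenvalue

variable {μ : PMF (Action n m)} {lam : ℝ}

theorem eigenvalues_eq_zero_or_le
    (hlam : IsLeast {x : ℝ | x ≠ 0 ∧
      Module.End.HasEigenvalue (Matrix.toLin' (cooccurrence μ)) x} lam) (i : GraphEdge n m) :
    (cooccurrence_isHermitian μ).eigenvalues i = 0 ∨
      lam ≤ (cooccurrence_isHermitian μ).eigenvalues i := by
  rcases eq_or_ne ((cooccurrence_isHermitian μ).eigenvalues i) 0 with h | h
  · exact Or.inl h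
  · refine Or.inr (hlam.2 ⟨h, ?_⟩)
    rw [Module.End.hasEigenvalue_iff_mem_spectrum, Matrix.spectrum_toLin']
    exact (cooccurrence_isHermitian μ).eigenvalues_mem_spectrum_real i

theorem least_eigenvalue_pos
    (hlam : IsLeast {x : ℝ | x ≠ 0 ∧
      Module.End.HasEigenvalue (Matrix.toLin' (cooccurrence μ)) x} lam) : 0 < lam := by
  obtain ⟨x, hx⟩ := hlam.1.2.exists_hasEigenvector
  have h1 : (cooccurrence μ).mulVec x = lam • x := by simpa using hx.apply_eq_smul
  have h2 : 0 ≤ x ⬝ᵥ (cooccurrence μ).mulVec x := by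
    rw [dotProduct_cooccurrence_mulVec]
    exact Finset.sum_nonneg fun u _ => mul_nonneg ENNReal.toReal_nonneg (mul_self_nonneg _)
  have h3 : 0 < x ⬝ᵥ x := lt_of_le_of_ne (Finset.sum_nonneg fun i _ => mul_self_nonneg _)
    fun h => hx.2 (dotProduct_self_eq_zero.1 h.symm)
  rw [h1, dotProduct_smul, smul_eq_mul] at h2
  exact lt_of_le_of_ne (nonneg_of_mul_nonneg_left h2 h3) hlam.1.1.symm

theorem trace_projection (p : PMF (Action n m)) :
    (cooccurrence p * cooccurrenceInv p).trace = (cooccurrence p).rank := by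
  rw [mul_cooccurrenceInv, trace_cfc, (cooccurrence_isHermitian p).rank_eq_card_non_zero_eigs,
    Fintype.card_subtype, Finset.card_filter]
  push_cast
  refine Finset.sum_congr rfl fun i _ => ?_
  split_ifs with h
  · exact inv_mul_cancel₀ h
  · rw [not_not.1 h, mul_zero]

/-- The trace `n` of the co-occurrence matrix is the sum of its eigenvalues, and each nonzero one
contributes at least `lam`; the projection counts them. -/
theorem trace_projection_le
    (hlam : IsLeast {x : ℝ | x ≠ 0 ∧
      Module.End.HasEigenvalue (Matrix.toLin' (cooccurrence μ)) x} lam) :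
    (cooccurrence μ * cooccurrenceInv μ).trace ≤ n / lam := by
  have h0 := least_eigenvalue_pos hlam
  rw [le_div_iff₀ h0, ← trace_cooccurrence μ, (cooccurrence_isHermitian μ).trace_eq_sum_eigenvalues,
    mul_cooccurrenceInv, trace_cfc, Finset.sum_mul]
  refine Finset.sum_le_sum fun i _ => ?_
  rcases eigenvalues_eq_zero_or_le hlam i with h | h
  · simp [h]
  · rw [inv_mul_cancel₀ (h0.trans_le h).ne', one_mul]
    exact h

/-- On the span the projection acts as the identity, and `C - lam • (C C⁺)` is positive semidefinite
because its spectral function is nonnegative at every eigenvalue. -/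
theorem mul_dotProduct_self_le
    (hlam : IsLeast {x : ℝ | x ≠ 0 ∧
      Module.End.HasEigenvalue (Matrix.toLin' (cooccurrence μ)) x} lam)
    {x : GraphEdge n m → ℝ} (hx : x ∈ Submodule.span ℝ (strategyVec '' μ.support)) :
    lam * (x ⬝ᵥ x) ≤ x ⬝ᵥ (cooccurrence μ).mulVec x := by
  set H := cooccurrence_isHermitian μ
  have h0 := least_eigenvalue_pos hlam
  have hP : (H.cfc fun y => y⁻¹ * y).mulVec x = x := by
    rw [← mul_cooccurrenceInv]
    exact cooccurrence_inv_mulVec_of_mem_span μ hx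
  have h1 := dotProduct_cfc_mulVec_nonneg H (fun y => y - lam * (y⁻¹ * y)) (fun i => by
    rcases eigenvalues_eq_zero_or_le hlam i with h | h
    · simp [h]
    · rw [inv_mul_cancel₀ (h0.trans_le h).ne', mul_one]
      exact sub_nonneg.2 h) x
  rw [cfc_sub_mul H (fun y => y), cfc_id_eq, Matrix.sub_mulVec, Matrix.smul_mulVec, hP, dotProduct_sub, dotProduct_smul,
    smul_eq_mul] at h1
  linarith

end Eigenvalue

/-! ### The kernel of the reward estimates -/

/-- The entry of the inverse co-occurrence matrix at a pair of strategies. -/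
def kernel (p : PMF (Action n m)) (u u' : Action n m) : ℝ :=
  strategyVec u ⬝ᵥ (cooccurrenceInv p).mulVec (strategyVec u')

theorem kernel_comm (p : PMF (Action n m)) (u u' : Action n m) : kernel p u u' = kernel p u' u :=
  dotProduct_cooccurrenceInv_mulVec_comm p _ _

/-- The estimates of a linear payoff are unbiased. -/
theorem sum_mul_kernel {p : PMF (Action n m)} (hp : Spanning p) {ρ : Action n m → ℝ}
    {ℓ : GraphEdge n m → ℝ} (hρ : ∀ u, ρ u = strategyVec u ⬝ᵥ ℓ) (u' : Action n m) :
    ∑ u, (p u).toReal * (ρ u * kernel p u' u) = ρ u' := by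
  have h : ∀ u, (p u).toReal * (ρ u * kernel p u' u) = (p u).toReal *
      ((strategyVec u ⬝ᵥ ℓ) * (strategyVec u ⬝ᵥ (cooccurrenceInv p).mulVec (strategyVec u'))) :=
    fun u => by rw [hρ, kernel_comm]; rfl
  simp only [h]
  rw [← dotProduct_cooccurrence_mulVec, Matrix.mulVec_mulVec, cooccurrence_inv_mulVec hp, hρ,
    dotProduct_comm]

/-- This is `C⁺ C C⁺ = C⁺`. It makes the variance of the estimates linear, not quadratic, in the
size of the kernel. -/
theorem sum_kernel_sq (p : PMF (Action n m)) (u' : Action n m) :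
    ∑ u, (p u).toReal * kernel p u u' ^ 2 = kernel p u' u' := by
  have h := dotProduct_cooccurrence_mulVec p
    ((cooccurrenceInv p).mulVec (strategyVec u')) ((cooccurrenceInv p).mulVec (strategyVec u'))
  simp only [kernel, sq]
  rw [← h, dotProduct_comm, dotProduct_cooccurrenceInv_mulVec_comm, Matrix.mulVec_mulVec,
    Matrix.mulVec_mulVec, cooccurrenceInv_mul_mul_inv]

theorem sum_kernel_self_eq_trace (p : PMF (Action n m)) :
    ∑ u, (p u).toReal * kernel p u u = (cooccurrence p * cooccurrenceInv p).trace := by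
  rw [cooccurrence, Finset.sum_mul, Matrix.trace_sum]
  refine Finset.sum_congr rfl fun u _ => ?_
  rw [Matrix.smul_mul, Matrix.trace_smul, Matrix.vecMulVec_mul, Matrix.trace_vecMulVec,
    smul_eq_mul, kernel, Matrix.dotProduct_mulVec, dotProduct_comm]

theorem kernel_self_nonneg (p : PMF (Action n m)) (u : Action n m) : 0 ≤ kernel p u u := by
  rw [← sum_kernel_sq]
  exact Finset.sum_nonneg fun u _ => mul_nonneg ENNReal.toReal_nonneg (sq_nonneg _)

/-- The diagonal of the kernel of a law that dominates a multiple of `μ`. -/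
theorem kernel_self_le {μ p : PMF (Action n m)} {lam γ : ℝ} (hμ : Spanning μ) (hp : Spanning p)
    (hlam : IsLeast {x : ℝ | x ≠ 0 ∧
      Module.End.HasEigenvalue (Matrix.toLin' (cooccurrence μ)) x} lam)
    (hγ : 0 < γ) (hpμ : ∀ u, γ * (μ u).toReal ≤ (p u).toReal) (u : Action n m) :
    kernel p u u ≤ n / (γ * lam) := by
  have h0 := least_eigenvalue_pos hlam
  set y := (cooccurrenceInv p).mulVec (strategyVec u) with hy
  have hyspan : y ∈ Submodule.span ℝ (strategyVec '' μ.support) := by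
    rw [hy, ← cooccurrenceInv_mul_mul_inv, ← cooccurrence_commute, Matrix.mul_assoc,
      ← Matrix.mulVec_mulVec]
    exact cooccurrence_mulVec_mem_span p hμ _
  -- For `y = C⁺ u` the diagonal entry is `yᵀ C y`, which dominates `γ` times the form of `μ`. The
  -- entry is also `u · y`, so Cauchy-Schwarz bounds its square by `n |y|²`; together these bound
  -- the entry itself.
  have h1 : γ * (lam * (y ⬝ᵥ y)) ≤ kernel p u u := by
    calc γ * (lam * (y ⬝ᵥ y)) ≤ γ * (y ⬝ᵥ (cooccurrence μ).mulVec y) :=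
          mul_le_mul_of_nonneg_left (mul_dotProduct_self_le hlam hyspan) hγ.le
      _ ≤ y ⬝ᵥ (cooccurrence p).mulVec y := by
          simp only [dotProduct_cooccurrence_mulVec, Finset.mul_sum]
          refine Finset.sum_le_sum fun u _ => ?_
          rw [← mul_assoc]
          exact mul_le_mul_of_nonneg_right (hpμ u) (mul_self_nonneg _)
      _ = kernel p u u := by
          rw [hy, Matrix.mulVec_mulVec, cooccurrence_inv_mulVec hp, dotProduct_comm]
          rfl
  have h2 : kernel p u u ^ 2 ≤ n * (y ⬝ᵥ y) := by
    have h := Finset.sum_mul_sq_le_sq_mul_sq Finset.univ (strategyVec u) y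
    have h3 : ∑ e, strategyVec u e ^ 2 = n := by
      rw [← strategyVec_dotProduct_self u]
      exact Finset.sum_congr rfl fun e _ => sq _
    have h4 : ∑ e, y e ^ 2 = y ⬝ᵥ y := Finset.sum_congr rfl fun e _ => sq _
    rw [h3, h4] at h
    exact h
  have hk := kernel_self_nonneg p u
  rw [le_div_iff₀ (mul_pos hγ h0)]
  rcases hk.eq_or_lt with h | h
  · rw [← h, zero_mul]
    positivity
  · refine le_of_mul_le_mul_right ?_ h
    have h5 : γ * lam * kernel p u u ^ 2 ≤ γ * lam * (n * (y ⬝ᵥ y)) :=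
      mul_le_mul_of_nonneg_left h2 (mul_pos hγ h0).le
    have h6 : n * (γ * (lam * (y ⬝ᵥ y))) ≤ n * kernel p u u :=
      mul_le_mul_of_nonneg_left h1 (Nat.cast_nonneg n)
    nlinarith

/-- Polarization: the form of `C⁺` is nonnegative at `u + u'` and at `u - u'`. -/
theorem abs_kernel_le {p : PMF (Action n m)} {Λ : ℝ} (h : ∀ u, kernel p u u ≤ Λ)
    (u u' : Action n m) : |kernel p u u'| ≤ Λ := by
  have hnn : ∀ x, 0 ≤ x ⬝ᵥ (cooccurrenceInv p).mulVec x := fun x => by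
    rw [← cooccurrenceInv_mul_mul_inv, ← Matrix.mulVec_mulVec, ← Matrix.mulVec_mulVec,
      dotProduct_cooccurrenceInv_mulVec_comm, dotProduct_comm, dotProduct_cooccurrence_mulVec]
    exact Finset.sum_nonneg fun u _ => mul_nonneg ENNReal.toReal_nonneg (mul_self_nonneg _)
  have h1 := hnn (strategyVec u + strategyVec u')
  have h2 := hnn (strategyVec u - strategyVec u')
  rw [Matrix.mulVec_add, add_dotProduct, dotProduct_add, dotProduct_add] at h1
  rw [Matrix.mulVec_sub, sub_dotProduct, dotProduct_sub, dotProduct_sub] at h2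
  change 0 ≤ kernel p u u + kernel p u u' + (kernel p u' u + kernel p u' u') at h1
  change 0 ≤ kernel p u u - kernel p u u' - (kernel p u' u - kernel p u' u') at h2
  rw [kernel_comm p u' u] at h1 h2
  rw [abs_le]
  constructor <;> linarith [h u, h u']

theorem dotProduct_estimate (P : Setup n m) (s : State n m) (u u' : Action n m) (ρ : ℝ) :
    strategyVec u' ⬝ᵥ P.estimate s u ρ =
      ρ * kernel (samplePath P.γ P.μ s.w s.w_pos) u' u := by
  rw [Setup.estimate, dotProduct_smul, smul_eq_mul, kernel]

/-! ### The kernel of the sampling law -/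

theorem mul_le_samplePath (γ : unitInterval) (μ : PMF (Action n m)) (w : GraphEdge n m → ℝ)
    (hw : ∀ e, 0 < w e) (u : Action n m) :
    γ * (μ u).toReal ≤ (samplePath γ μ w hw u).toReal := by
  rw [samplePath_toReal]
  have h1 : (0 : ℝ) ≤ 1 - γ := sub_nonneg.2 γ.2.2
  have h2 := pathWeight_pos hw u
  have h3 : 0 ≤ ∑ u', pathWeight w u' := Finset.sum_nonneg fun u' _ => (pathWeight_pos hw u').le
  have : 0 ≤ (1 - (γ : ℝ)) * (pathWeight w u / ∑ u', pathWeight w u') := by positivity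
  linarith

theorem spanning_samplePath {γ : unitInterval} (hγ : 0 < (γ : ℝ)) {μ : PMF (Action n m)}
    (hμ : Spanning μ) (w : GraphEdge n m → ℝ) (hw : ∀ e, 0 < w e) :
    Spanning (samplePath γ μ w hw) := by
  intro u
  refine Submodule.span_mono (Set.image_mono fun u' hu' => ?_) (hμ u)
  rw [PMF.mem_support_iff] at hu' ⊢
  intro h
  have h1 := mul_le_samplePath γ μ w hw u'
  rw [h, ENNReal.toReal_zero] at h1
  exact absurd h1 (not_le.2 (mul_pos hγ (ENNReal.toReal_pos hu' (μ.apply_ne_top u'))))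

/-! ### Static comparators of dynamic policies -/

theorem expect_historyLaw_succ (D : PMF (Fin n → ℕ)) (π : Policy n m) (t : ℕ)
    (f : History n m → ℝ≥0∞) :
    expect (historyLaw D π (t + 1)) f =
      expect (historyLaw D π t) fun h => expect (π h) fun u => expect D fun v =>
        f ((u, v) :: h) := by
  rw [historyLaw]
  simp only [expect_bind, expect_pure]

/-- The number of rounds in which the learner played `u`. -/
def visits (u : Action n m) (h : History n m) : ℕ :=
  (h.map fun p => if p.1 = u then 1 else 0).sum

theorem sum_visits (h : History n m) : ∑ u, visits u h = h.length := by
  induction h with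
  | nil => simp [visits]
  | cons p h ih =>
    simp only [visits, List.map_cons, List.sum_cons, Finset.sum_add_distrib] at ih ⊢
    rw [ih]
    simp [add_comm]

theorem sum_visits_mul_cost (h : History n m) : ∑ u, visits u h * cost u = spent h := by
  induction h with
  | nil => simp [visits, spent]
  | cons p h ih =>
    simp only [visits, spent, List.map_cons, List.sum_cons, add_mul,
      Finset.sum_add_distrib] at ih ⊢
    rw [ih]
    simp

theorem length_and_spent_of_mem_support {D : PMF (Fin n → ℕ)} {π : Policy n m} {B : ℕ}
    (hπ : π.Feasible B) (t : ℕ) :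
    ∀ h ∈ (historyLaw D π t).support, h.length = t ∧ spent h ≤ B := by
  induction t with
  | zero =>
    intro h hh
    rw [historyLaw, PMF.mem_support_pure_iff] at hh
    simp [hh, spent]
  | succ t ih =>
    intro h hh
    rw [historyLaw, PMF.mem_support_bind_iff] at hh
    obtain ⟨h', hh', hh⟩ := hh
    rw [PMF.mem_support_bind_iff] at hh
    obtain ⟨u, hu, hh⟩ := hh
    rw [PMF.mem_support_bind_iff] at hh
    obtain ⟨v, hv, hh⟩ := hh
    rw [PMF.mem_support_pure_iff] at hh
    obtain ⟨h1, h2⟩ := ih h' hh'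
    have h3 := hπ h' h2 u hu
    subst hh
    refine ⟨by simp [h1], ?_⟩
    simp only [spent, List.map_cons, List.sum_cons] at h3 ⊢
    omega

/-- The expected number of rounds, out of the first `t`, in which the learner plays `u`. -/
def expectedVisits (D : PMF (Fin n → ℕ)) (π : Policy n m) (t : ℕ) (u : Action n m) : ℝ≥0∞ :=
  expect (historyLaw D π t) fun h => (visits u h : ℝ≥0∞)

theorem expectedVisits_succ (D : PMF (Fin n → ℕ)) (π : Policy n m) (t : ℕ) (u : Action n m) :
    expectedVisits D π (t + 1) u =
      expectedVisits D π t u + expect (historyLaw D π t) fun h => π h u := by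
  unfold expectedVisits
  rw [expect_historyLaw_succ, ← expect_add]
  congr 1
  funext h
  have : ∀ u' : Action n m, ∀ v : Fin n → ℕ, ((visits u ((u', v) :: h) : ℕ) : ℝ≥0∞) =
      (if u' = u then 1 else 0) + visits u h := by
    intro u' v
    simp [visits]
  simp only [this, expect_const, expect_add]
  rw [add_comm]
  congr 1
  simp [expect, tsum_fintype]

theorem sum_expectedVisits {D : PMF (Fin n → ℕ)} {π : Policy n m} {B : ℕ}
    (hπ : π.Feasible B) (t : ℕ) : ∑ u, expectedVisits D π t u = t := by
  unfold expectedVisits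
  rw [← expect_finsetSum]
  simp only [← Nat.cast_sum, sum_visits]
  rw [expect_congr_support _ fun h hh => by
    rw [(length_and_spent_of_mem_support hπ t h hh).1], expect_const]

theorem sum_expectedVisits_mul_cost_le {D : PMF (Fin n → ℕ)} {π : Policy n m} {B : ℕ}
    (hπ : π.Feasible B) (t : ℕ) : ∑ u, expectedVisits D π t u * (cost u : ℝ≥0∞) ≤ B := by
  unfold expectedVisits
  simp only [← expect_mul_right, ← expect_finsetSum, ← Nat.cast_mul, ← Nat.cast_sum,
    sum_visits_mul_cost]
  refine (expect_mono_support _ fun h hh => ?_).trans (expect_const _ (B : ℝ≥0∞)).le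
  exact Nat.cast_le.2 (length_and_spent_of_mem_support hπ t h hh).2

theorem collected_nonneg {b : Fin n → ℝ} {κ : ℝ} (hb : ∀ i, 0 < b i) (hκ : 0 ≤ κ)
    (h : History n m) : 0 ≤ collected b κ h := by
  refine List.sum_nonneg fun x hx => ?_
  obtain ⟨p, _, rfl⟩ := List.mem_map.1 hx
  exact reward_nonneg hb hκ _ _

/-- The adversary's draw is independent of the past and of the current allocation, so each visit to
`u` earns the same mean, however the policy came to choose `u`. -/
theorem expect_collected {b : Fin n → ℝ} {κ : ℝ} (hb : ∀ i, 0 < b i) (hκ : 0 ≤ κ)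
    (D : PMF (Fin n → ℕ)) (π : Policy n m) (t : ℕ) :
    expect (historyLaw D π t) (fun h => ENNReal.ofReal (collected b κ h)) =
      ∑ u, expectedVisits D π t u * expect D fun v => ENNReal.ofReal (reward b κ u v) := by
  induction t with
  | zero => simp [historyLaw, expectedVisits, expect_pure, collected, visits]
  | succ t ih =>
    simp only [expectedVisits_succ, add_mul, Finset.sum_add_distrib]
    rw [← ih, expect_historyLaw_succ]
    simp only [← expect_mul_right, ← expect_finsetSum]
    rw [← expect_add]
    congr 1
    funext h
    have : ∀ (u : Action n m) (v : Fin n → ℕ), ENNReal.ofReal (collected b κ ((u, v) :: h)) =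
        ENNReal.ofReal (collected b κ h) + ENNReal.ofReal (reward b κ u v) := by
      intro u v
      rw [← ENNReal.ofReal_add (collected_nonneg hb hκ h) (reward_nonneg hb hκ u v)]
      simp [collected, add_comm]
    simp only [this, expect_add, expect_const]
    congr 1
    simp [expect, tsum_fintype]

/-- The expected reward of an allocation. -/
def meanReward (b : Fin n → ℝ) (κ : ℝ) (D : PMF (Fin n → ℕ)) (u : Action n m) : ℝ :=
  ∑' v, (D v).toReal * reward b κ u v

theorem meanReward_le_one {b : Fin n → ℝ} {κ : ℝ} (hb : ∀ i, 0 < b i) (hb1 : ∑ i, b i = 1)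
    (hκ0 : 0 ≤ κ) (hκ : κ ≤ 1) (D : PMF (Fin n → ℕ)) (u : Action n m) :
    meanReward b κ D u ≤ 1 := by
  rw [← tsum_toReal_pmf D]
  refine Summable.tsum_le_tsum (fun v => ?_) (summable_toReal_mul_of_bounded D (K := 1) fun v => ?_)
    (summable_toReal_pmf D)
  · exact mul_le_of_le_one_right ENNReal.toReal_nonneg (reward_le_one hb hb1 hκ u v)
  · rw [abs_of_nonneg (reward_nonneg hb hκ0 u v)]
    exact reward_le_one hb hb1 hκ u v

theorem meanReward_nonneg {b : Fin n → ℝ} {κ : ℝ} (hb : ∀ i, 0 < b i)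
    (hκ0 : 0 ≤ κ) (D : PMF (Fin n → ℕ)) (u : Action n m) :
    0 ≤ meanReward b κ D u :=
  tsum_nonneg fun v => mul_nonneg ENNReal.toReal_nonneg (reward_nonneg hb hκ0 u v)

/-- A feasible dynamic policy does not collect more in expectation than some fixed mixture of
allocations that satisfies the budget constraint in expectation. -/
theorem exists_mixture {b : Fin n → ℝ} {κ : ℝ} (hb : ∀ i, 0 < b i) (hκ : 0 ≤ κ)
    (D : PMF (Fin n → ℕ)) {π : Policy n m} {B T : ℕ} (hT : 0 < T) (hπ : π.Feasible B) :
    ∃ X : Action n m → ℝ, (∀ u, 0 ≤ X u) ∧ ∑ u, X u = 1 ∧ T * ∑ u, X u * cost u ≤ B ∧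
      T * ∑ u, X u * meanReward b κ D u = policyValue b κ D T π := by
  have hTr : (T : ℝ) ≠ 0 := Nat.cast_ne_zero.2 hT.ne'
  have hfin : ∀ u, expectedVisits D π T u ≠ ∞ := by
    intro u
    have h := sum_expectedVisits (D := D) hπ T
    refine ne_top_of_le_ne_top (ENNReal.natCast_ne_top T) ?_
    rw [← h]
    exact Finset.single_le_sum (fun u _ => zero_le) (Finset.mem_univ u)
  refine ⟨fun u => (expectedVisits D π T u).toReal / T,
    fun u => div_nonneg ENNReal.toReal_nonneg (Nat.cast_nonneg _), ?_, ?_, ?_⟩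
  · rw [← Finset.sum_div, ← ENNReal.toReal_sum fun u _ => hfin u, sum_expectedVisits hπ]
    simp [hTr]
  · have h := ENNReal.toReal_mono (ENNReal.natCast_ne_top B)
      (sum_expectedVisits_mul_cost_le (D := D) hπ T)
    rw [ENNReal.toReal_sum fun u _ => ENNReal.mul_ne_top (hfin u) (ENNReal.natCast_ne_top _)] at h
    simp only [ENNReal.toReal_mul, ENNReal.toReal_natCast] at h
    rw [Finset.mul_sum]
    refine le_trans (le_of_eq (Finset.sum_congr rfl fun u _ => ?_)) h
    field_simp
  · have htop : ∀ u : Action n m, expect D (fun v => ENNReal.ofReal (reward b κ u v)) ≠ ∞ := by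
      intro u
      -- Here `κ` has no upper bound, hence the crude `max 1 κ`; only finiteness matters.
      refine ne_top_of_le_ne_top
        (ENNReal.ofReal_ne_top (r := ∑ i, b i * max 1 κ)) ?_
      rw [← expect_const D (ENNReal.ofReal (∑ i, b i * max 1 κ))]
      refine expect_mono _ fun v => ENNReal.ofReal_le_ofReal ?_
      refine Finset.sum_le_sum fun i _ => mul_le_mul_of_nonneg_left ?_ (hb i).le
      split_ifs
      · exact le_max_left _ _
      · exact le_max_right _ _
      · exact zero_le_one.trans (le_max_left _ _)
    rw [policyValue, tsum_toReal_mul_eq _ fun h => collected_nonneg hb hκ h,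
      expect_collected hb hκ, ENNReal.toReal_sum fun u _ => ENNReal.mul_ne_top (hfin u) (htop u),
      Finset.mul_sum]
    refine Finset.sum_congr rfl fun u _ => ?_
    rw [ENNReal.toReal_mul, meanReward, tsum_toReal_mul_eq _ fun v => reward_nonneg hb hκ u v]
    field_simp

theorem exists_feasible (n m B : ℕ) : ∃ π : Policy n m, π.Feasible B := by
  refine ⟨fun _ => PMF.pure ⟨fun _ => 0, by simp⟩, fun h hh u hu => ?_⟩
  rw [PMF.mem_support_pure_iff] at hu
  subst hu
  simpa [cost] using hh

theorem optDP_le {b : Fin n → ℝ} {κ : ℝ} (hb : ∀ i, 0 < b i) (hb1 : ∑ i, b i = 1)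
    (hκ0 : 0 ≤ κ) (hκ : κ ≤ 1) (D : PMF (Fin n → ℕ)) {B T : ℕ} (hT : 0 < T) :
    optDP m B T b κ D ≤ T := by
  obtain ⟨π₀, h₀⟩ := exists_feasible n m B
  refine csSup_le ⟨_, π₀, h₀, rfl⟩ ?_
  rintro x ⟨π, hπ, rfl⟩
  obtain ⟨X, hX, hX1, -, hval⟩ := exists_mixture hb hκ0 D hT hπ
  rw [← hval]
  refine mul_le_of_le_one_right (Nat.cast_nonneg T) ?_
  rw [← hX1]
  exact Finset.sum_le_sum fun u _ =>
    mul_le_of_le_one_right (hX u) (meanReward_le_one hb hb1 hκ0 hκ D u)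

/-- The supremum need not be shown to be attained: a loss of `1` disappears in the final constant.
-/
theorem exists_policy_gt (b : Fin n → ℝ) (κ : ℝ) (D : PMF (Fin n → ℕ)) (B T : ℕ) :
    ∃ π : Policy n m, π.Feasible B ∧ optDP m B T b κ D - 1 < policyValue b κ D T π := by
  obtain ⟨π₀, h₀⟩ := exists_feasible n m B
  obtain ⟨x, ⟨π, hπ, rfl⟩, hx⟩ := exists_lt_of_lt_csSup
    (s := {x : ℝ | ∃ π : Policy n m, π.Feasible B ∧ policyValue b κ D T π = x})
    ⟨_, π₀, h₀, rfl⟩ (sub_one_lt _)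
  exact ⟨π, hπ, hx⟩

/-! ### The number of strategies, the number of edges, and the dimension -/

/-- With the unused troops assigned to the extra symbol `none`, an allocation is a multiset of size
`m` over `n + 1` symbols, and every such multiset comes from a word of length `m`. -/
theorem card_action_le (n m : ℕ) : Fintype.card (Action n m) ≤ (n + 1) ^ m := by
  classical
  let toMultiset : Action n m → Multiset (Option (Fin n)) := fun u =>
    ∑ i, Multiset.replicate (u.1 i : ℕ) (some i) + Multiset.replicate (m - cost u) none
  have hcard : ∀ u, (toMultiset u).card = m := fun u => by
    have := cost_le u
    simp only [toMultiset, Multiset.card_add, Multiset.card_sum, Multiset.card_replicate]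
    change cost u + (m - cost u) = m
    omega
  let toSym : Action n m → Sym (Option (Fin n)) m := fun u => ⟨toMultiset u, hcard u⟩
  have hinj : Function.Injective toSym := by
    intro u u' h
    have h1 : toMultiset u = toMultiset u' := congrArg Subtype.val h
    refine Subtype.ext (funext fun i => Fin.ext ?_)
    have h2 : ∀ u : Action n m, (toMultiset u).count (some i) = u.1 i := fun u => by
      simp [toMultiset, Multiset.count_sum', Multiset.count_replicate]
    rw [← h2 u, ← h2 u', h1]
  refine (Fintype.card_le_of_injective _ hinj).trans ?_
  refine (Fintype.card_le_of_surjective (Sym.ofVector : List.Vector (Option (Fin n)) m → _)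
    fun s => ?_).trans ?_
  · obtain ⟨l, hl⟩ := Quotient.exists_rep s.1
    refine ⟨⟨l, ?_⟩, ?_⟩
    · have := s.2
      rw [← hl] at this
      exact this
    · exact Subtype.ext hl
  · rw [card_vector]
    simp

theorem two_le_card_action (hn : n ≠ 0) (hm : 1 ≤ m) : 2 ≤ Fintype.card (Action n m) := by
  obtain ⟨k, rfl⟩ := Nat.exists_eq_succ_of_ne_zero hn
  refine Fintype.one_lt_card_iff.2 ⟨⟨fun _ => 0, by simp⟩,
    ⟨fun i => if i = 0 then ⟨1, by omega⟩ else 0, ?_⟩, fun h => ?_⟩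
  · simp only [apply_ite Fin.val]
    simp [hm]
  · have := congrFun (congrArg Subtype.val h) 0
    simp [Fin.ext_iff] at this

/-- The allocation that reaches the tail of the edge `e` in a single step, follows `e`, and
assigns no troops to other battlefields. -/
def edgeAction (e : BattleEdge n m) : Action n m :=
  ⟨fun x => ⟨if (x : ℕ) + 1 = e.1.1 then e.1.2.1 else if x = e.1.1 then e.1.2.2 - e.1.2.1 else 0,
    by split_ifs <;> omega⟩, by
    obtain ⟨⟨i, j, k⟩, h1, h2⟩ := e
    simp only at h1 h2 ⊢
    have hjk : (j : ℕ) ≤ k := h1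
    have hk : (k : ℕ) ≤ m := Nat.le_of_lt_succ k.2
    calc ∑ x : Fin n, (if (x : ℕ) + 1 = i then (j : ℕ) else if x = i then (k : ℕ) - j else 0)
        ≤ ∑ x : Fin n, ((if (x : ℕ) + 1 = i then (j : ℕ) else 0) +
            if x = i then (k : ℕ) - j else 0) := by
          refine Finset.sum_le_sum fun x _ => ?_
          split_ifs <;> omega
      _ ≤ j + (k - j) := by
          rw [Finset.sum_add_distrib, Finset.sum_ite_eq' Finset.univ i, if_pos (Finset.mem_univ _)]
          refine Nat.add_le_add_right ?_ _
          rcases Nat.eq_zero_or_pos (i : ℕ) with hi | hi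
          · simp [hi]
          · have : ∀ x : Fin n, ((x : ℕ) + 1 = i) = (x = ⟨i - 1, by omega⟩) := fun x => by
              rw [Fin.ext_iff]
              exact propext ⟨fun h => by simp only; omega, fun h => by simp only at h; omega⟩
            simp [this]
      _ ≤ m := by omega⟩

theorem troopsBefore_edgeAction (e : BattleEdge n m) (k : ℕ) (hk : k ≤ n) :
    troopsBefore (edgeAction e) k =
      if k < e.1.1 then 0 else if k = e.1.1 then (e.1.2.1 : ℕ) else e.1.2.2 := by
  obtain ⟨⟨i, j, l⟩, h1, h2⟩ := e
  have hjl : (j : ℕ) ≤ l := h1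
  simp only at h2 ⊢
  induction k with
  | zero =>
    rw [troopsBefore_zero]
    rcases Nat.eq_zero_or_pos (i : ℕ) with hi | hi
    · simp [hi, h2 hi]
    · simp [hi]
  | succ k ih =>
    have hs := troopsBefore_succ (edgeAction ⟨(i, j, l), h1, h2⟩) ⟨k, hk⟩
    simp only at hs
    rw [hs, ih (Nat.le_of_succ_le hk)]
    simp only [edgeAction, Fin.ext_iff]
    split_ifs <;> omega

theorem onPath_edgeAction (e e' : BattleEdge n m) :
    OnPath (edgeAction e) (Sum.inl e') ↔
      (if (e'.1.1 : ℕ) < e.1.1 then 0 else if (e'.1.1 : ℕ) = e.1.1 then (e.1.2.1 : ℕ)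
        else e.1.2.2) = e'.1.2.1 ∧
      (if (e'.1.1 : ℕ) + 1 < e.1.1 then 0 else if (e'.1.1 : ℕ) + 1 = e.1.1 then (e.1.2.1 : ℕ)
        else e.1.2.2) = e'.1.2.2 := by
  simp only [OnPath]
  rw [troopsBefore_edgeAction _ _ (Nat.le_of_lt e'.1.1.2), troopsBefore_edgeAction _ _ e'.1.1.2]

/-- A family of edges each of which lies on the path of only one allocation of a family is not
larger than the rank of the co-occurrence matrix. -/
theorem card_le_rank {μ : PMF (Action n m)} (hμ : Spanning μ) {ι : Type*} [Fintype ι]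
    (act : ι → Action n m) (edge : ι → BattleEdge n m)
    (h : ∀ a b, OnPath (act a) (Sum.inl (edge b)) ↔ a = b) :
    Fintype.card ι ≤ (cooccurrence μ).rank := by
  classical
  have hind : LinearIndependent ℝ fun a => strategyVec (act a) := by
    rw [Fintype.linearIndependent_iff]
    intro g hg a
    have := congrFun hg (Sum.inl (edge a))
    simpa [Finset.sum_apply, strategyVec, h] using this
  rw [← finrank_span_eq_card hind, Matrix.rank]
  refine Submodule.finrank_mono (Submodule.span_le.2 ?_)
  rintro _ ⟨a, rfl⟩
  -- Each strategy vector is in the range of `C`, with preimage `C⁺ u`.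
  refine ⟨(cooccurrenceInv μ).mulVec (strategyVec (act a)), ?_⟩
  rw [Matrix.mulVecLin_apply, Matrix.mulVec_mulVec, cooccurrence_inv_mulVec hμ]

/-- For such an edge the path of `edgeAction` stays at level `0`, rises along the edge and stays
level afterwards, so it contains no other edge of this kind. -/
theorem card_fromZero_le_rank {μ : PMF (Action n m)} (hμ : Spanning μ) :
    Fintype.card {e : BattleEdge n m // (e.1.2.1 : ℕ) = 0 ∧ 0 < (e.1.2.2 : ℕ)} ≤
      (cooccurrence μ).rank := by
  refine card_le_rank hμ (fun e => edgeAction e.1) (fun e => e.1) ?_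
  rintro ⟨⟨⟨i, j, k⟩, h1, h2⟩, h3, h4⟩ ⟨⟨⟨i', j', k'⟩, h1', h2'⟩, h3', h4'⟩
  have hjk : (j : ℕ) ≤ k := h1
  have hjk' : (j' : ℕ) ≤ k' := h1'
  simp only [onPath_edgeAction, Subtype.ext_iff, Prod.ext_iff, Fin.ext_iff]
  dsimp only at h3 h4 h3' h4'
  split_ifs <;> omega

/-- For such an edge the path of `edgeAction` rises only twice, and its first rise starts at level
`0`; so the edge is the only one of its kind on the path. -/
theorem card_inner_le_rank {μ : PMF (Action n m)} (hμ : Spanning μ) :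
    Fintype.card {e : BattleEdge n m // 0 < (e.1.2.1 : ℕ) ∧ (e.1.2.1 : ℕ) < e.1.2.2} ≤
      (cooccurrence μ).rank := by
  refine card_le_rank hμ (fun e => edgeAction e.1) (fun e => e.1) ?_
  rintro ⟨⟨⟨i, j, k⟩, h1, h2⟩, h3, h4⟩ ⟨⟨⟨i', j', k'⟩, h1', h2'⟩, h3', h4'⟩
  have hjk : (j : ℕ) ≤ k := h1
  have hjk' : (j' : ℕ) ≤ k' := h1'
  simp only [onPath_edgeAction, Subtype.ext_iff, Prod.ext_iff, Fin.ext_iff]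
  dsimp only at h3 h4 h3' h4'
  split_ifs <;> omega

theorem mul_le_rank {μ : PMF (Action n m)} (hμ : Spanning μ) : n * m ≤ (cooccurrence μ).rank := by
  refine le_trans ?_ (card_fromZero_le_rank hμ)
  have h : Fintype.card (Fin n × Fin m) = n * m := by simp
  rw [← h]
  refine Fintype.card_le_of_injective
    (fun a => ⟨⟨(a.1, 0, a.2.succ), by simp⟩, by simp⟩) fun a a' h => ?_
  simpa [Subtype.ext_iff, Prod.ext_iff] using h

theorem rank_le_div {μ : PMF (Action n m)} {lam : ℝ}
    (hlam : IsLeast {x : ℝ | x ≠ 0 ∧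
      Module.End.HasEigenvalue (Matrix.toLin' (cooccurrence μ)) x} lam) :
    ((cooccurrence μ).rank : ℝ) ≤ n / lam := by
  rw [← trace_projection]
  exact trace_projection_le hlam

theorem mul_le_div {μ : PMF (Action n m)} {lam : ℝ} (hμ : Spanning μ)
    (hlam : IsLeast {x : ℝ | x ≠ 0 ∧
      Module.End.HasEigenvalue (Matrix.toLin' (cooccurrence μ)) x} lam) :
    (n * m : ℝ) ≤ n / lam := by
  refine le_trans ?_ (rank_le_div hlam)
  exact_mod_cast mul_le_rank hμ

/-- Edges rising from level `0` and edges rising from a positive level are each at most as many as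
the rank. The level edges and the auxiliary edges number at most `n * (m + 1) ≤ 2 * n * m` each,
hence at most twice the rank. The total is `1 + 1 + 2 + 2 = 6`. -/
theorem card_graphEdge_le {μ : PMF (Action n m)} (hμ : Spanning μ) (hn : n ≠ 0) (hm : 1 ≤ m) :
    Fintype.card (GraphEdge n m) ≤ 6 * (cooccurrence μ).rank := by
  have h1 : Fintype.card (BattleEdge n m) ≤
      Fintype.card ({e : BattleEdge n m // (e.1.2.1 : ℕ) = 0 ∧ 0 < (e.1.2.2 : ℕ)} ⊕
        {e : BattleEdge n m // 0 < (e.1.2.1 : ℕ) ∧ (e.1.2.1 : ℕ) < e.1.2.2} ⊕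
        (Fin n × Fin (m + 1))) := by
    refine Fintype.card_le_of_injective (fun e =>
      if h : (e.1.2.1 : ℕ) = 0 ∧ 0 < (e.1.2.2 : ℕ) then Sum.inl ⟨e, h⟩
      else if h : 0 < (e.1.2.1 : ℕ) ∧ (e.1.2.1 : ℕ) < e.1.2.2 then Sum.inr (Sum.inl ⟨e, h⟩)
      else Sum.inr (Sum.inr (e.1.1, e.1.2.1))) ?_
    intro e e' h
    simp only at h
    split_ifs at h with h1 h2 h3 h4 h5 h6 <;> simp at h
    · exact h
    · exact h
    · have := e.2.1
      have := e'.2.1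
      simp only [Subtype.ext_iff, Prod.ext_iff, Fin.ext_iff, Fin.le_def] at *
      omega
  rw [Fintype.card_sum, Fintype.card_sum, Fintype.card_prod, Fintype.card_fin,
    Fintype.card_fin] at h1
  have h2 := card_fromZero_le_rank hμ
  have h3 := card_inner_le_rank hμ
  have h4 := mul_le_rank hμ
  rw [Fintype.card_sum, Fintype.card_fin]
  have h5 : m + 1 ≤ n * (m + 1) := Nat.le_mul_of_pos_left _ (Nat.pos_of_ne_zero hn)
  have h6 : n ≤ n * m := Nat.le_mul_of_pos_right _ hm
  rw [Nat.mul_succ] at h1 h5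
  omega

/-! ### Exponential weights with importance-weighted estimates -/

section Abstract

variable {U I : Type*} [Fintype U] [Fintype I]

/-- A step of exponential weights: `p = γ μ + (1 - γ) q` is the sampling law, `q` the law given by
the weights, and `k` the row of the kernel that belongs to the sampled action. -/
theorem sum_mul_exp_kernel_le {p μ q k : U → ℝ} {γ η ρ kk : ℝ} (hγ0 : 0 ≤ γ) (hγ : γ < 1)
    (hμ : ∀ u, 0 ≤ μ u) (hq : ∀ u, 0 ≤ q u) (hq1 : ∑ u, q u = 1)
    (hp : ∀ u, p u = γ * μ u + (1 - γ) * q u) (hk1 : ∑ u, p u * k u = 1)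
    (hk2 : ∑ u, p u * k u ^ 2 = kk) (hb : ∀ u, |η * (ρ * k u)| ≤ 2) :
    ∑ u, q u * Real.exp (η * (ρ * k u)) ≤
      Real.exp (η * ((ρ - γ * (ρ * ∑ u, μ u * k u)) / (1 - γ) +
        Real.exp 2 * η * ρ ^ 2 * kk / (1 - γ))) := by
  have h1γ : 0 < 1 - γ := sub_pos.2 hγ
  -- The moments of the kernel are known under `p`, not under `q`; they are transferred through `(1
  -- - γ) q = p - γ μ`. For the second moment the term with `μ` is simply dropped.
  have h1 : (1 - γ) * ∑ u, q u * k u = 1 - γ * ∑ u, μ u * k u := by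
    have h : (1 - γ) * ∑ u, q u * k u = ∑ u, p u * k u - γ * ∑ u, μ u * k u := by
      rw [Finset.mul_sum, Finset.mul_sum, ← Finset.sum_sub_distrib]
      exact Finset.sum_congr rfl fun u _ => by rw [hp]; ring
    rw [h, hk1]
  have h2 : (1 - γ) * ∑ u, q u * k u ^ 2 ≤ kk := by
    rw [← hk2, Finset.mul_sum]
    refine Finset.sum_le_sum fun u _ => ?_
    rw [hp]
    nlinarith [mul_nonneg (mul_nonneg hγ0 (hμ u)) (sq_nonneg (k u))]
  refine (sum_mul_exp_le hq hq1 hb).trans ?_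
  have h3 : ∑ u, q u * (η * (ρ * k u)) = η * ((ρ - γ * (ρ * ∑ u, μ u * k u)) / (1 - γ)) := by
    have : ∑ u, q u * (η * (ρ * k u)) = η * ρ * ∑ u, q u * k u := by
      rw [Finset.mul_sum]
      exact Finset.sum_congr rfl fun u _ => by ring
    rw [this, eq_div_of_mul_eq h1γ.ne' ((mul_comm _ _).trans h1)]
    ring
  have h4 : Real.exp 2 * ∑ u, q u * (η * (ρ * k u)) ^ 2 ≤
      η * (Real.exp 2 * η * ρ ^ 2 * kk / (1 - γ)) := by
    have h5 : ∑ u, q u * (η * (ρ * k u)) ^ 2 = (η * ρ) ^ 2 * ∑ u, q u * k u ^ 2 := by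
      rw [Finset.mul_sum]
      exact Finset.sum_congr rfl fun u _ => by ring
    have h6 : ∑ u, q u * k u ^ 2 ≤ kk / (1 - γ) := by
      rw [le_div_iff₀ h1γ, mul_comm]
      exact h2
    rw [h5]
    calc Real.exp 2 * ((η * ρ) ^ 2 * ∑ u, q u * k u ^ 2)
        ≤ Real.exp 2 * ((η * ρ) ^ 2 * (kk / (1 - γ))) := by gcongr
      _ = _ := by ring
  rw [h3]
  refine le_trans ?_ (Real.add_one_le_exp _)
  rw [mul_add]
  linarith

/-- A step of Hedge. -/
theorem sum_mul_exp_neg_le {q L : I → ℝ} {ε R : ℝ} (hε : 0 ≤ ε)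
    (hq : ∀ i, 0 ≤ q i) (hq1 : ∑ i, q i = 1) (hL : ∀ i, |L i| ≤ R) :
    ∑ i, q i * Real.exp (-ε * L i) ≤
      Real.exp (ε * (-∑ i, q i * L i + ε * R ^ 2 * Real.exp (ε * R))) := by
  have hb : ∀ i, |-ε * L i| ≤ ε * R := fun i => by
    rw [abs_mul, abs_neg, abs_of_nonneg hε]
    exact mul_le_mul_of_nonneg_left (hL i) hε
  refine (sum_mul_exp_le hq hq1 hb).trans ?_
  refine le_trans ?_ (Real.add_one_le_exp _)
  have h1 : ∑ i, q i * (-ε * L i) = -(ε * ∑ i, q i * L i) := by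
    rw [Finset.mul_sum, ← Finset.sum_neg_distrib]
    exact Finset.sum_congr rfl fun i _ => by ring
  have h2 : ∑ i, q i * (-ε * L i) ^ 2 ≤ (ε * R) ^ 2 := by
    calc ∑ i, q i * (-ε * L i) ^ 2 ≤ ∑ i, q i * (ε * R) ^ 2 := by
          refine Finset.sum_le_sum fun i _ => mul_le_mul_of_nonneg_left ?_ (hq i)
          rw [← sq_abs (-ε * L i)]
          exact pow_le_pow_left₀ (abs_nonneg _) (hb i) 2
      _ = (ε * R) ^ 2 := by rw [← Finset.sum_mul, hq1, one_mul]
  have h3 := mul_le_mul_of_nonneg_left h2 (Real.exp_pos (ε * R)).le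
  rw [h1]
  nlinarith

/-! ### Moments of the increment of the potential in one round -/

/-- The bound for the increment of the potential in a round in which the learner plays `u` and the
dual algorithm draws `i`: `ρ` are the payoffs, `K` the kernel, `μ` the exploration law, `X` the
comparator and `e` the error of the dual algorithm. -/
def incrementBound (μ X : U → ℝ) (q : I → ℝ) (K : U → U → ℝ) (ρ : U → I → ℝ) (γ η opt e : ℝ)
    (u : U) (i : I) : ℝ :=
  opt + (-∑ k, q k * ρ u k + e) +
    ((ρ u i - γ * (ρ u i * ∑ x, μ x * K x u)) / (1 - γ) +
      Real.exp 2 * η * ρ u i ^ 2 * K u u / (1 - γ)) - ρ u i * ∑ x, X x * K x u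

/-- A bound, up to the norm of the kernel, for `incrementBound`. -/
def incrementConst (R e₁ : ℝ) : ℝ := 1 + 5 * R + e₁ + 2 * Real.exp 2 * R ^ 2

/-- The hypotheses on the data of a round under which the increments are controlled. -/
structure RoundBounds (p μ X : U → ℝ) (q : I → ℝ) (K : U → U → ℝ) (ρ : U → I → ℝ)
    (γ η opt e R Λ N e₁ : ℝ) : Prop where
  p_nonneg : ∀ u, 0 ≤ p u
  p_sum : ∑ u, p u = 1
  μ_nonneg : ∀ u, 0 ≤ μ u
  μ_sum : ∑ u, μ u = 1
  X_nonneg : ∀ u, 0 ≤ X u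
  X_sum : ∑ u, X u = 1
  q_nonneg : ∀ i, 0 ≤ q i
  q_sum : ∑ i, q i = 1
  K_symm : ∀ u u', K u u' = K u' u
  K_abs : ∀ u u', |K u u'| ≤ Λ
  K_nonneg : ∀ u, 0 ≤ K u u
  K_sq : ∀ u', ∑ u, p u * K u u' ^ 2 = K u' u'
  K_trace : ∑ u, p u * K u u ≤ N
  unbiased : ∀ i u', ∑ u, p u * (ρ u i * K u' u) = ρ u' i
  ρ_abs : ∀ u i, |ρ u i| ≤ R
  R_nonneg : 0 ≤ R
  γ_nonneg : 0 ≤ γ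
  γ_le : γ ≤ 1 / 2
  η_nonneg : 0 ≤ η
  η_Λ : η * Λ ≤ 1
  η_N : η * N ≤ γ
  Λ_ge : 1 ≤ Λ
  opt_nonneg : 0 ≤ opt
  opt_le : opt ≤ 1
  e_nonneg : 0 ≤ e
  e_le : e ≤ e₁

namespace RoundBounds

variable {p μ X : U → ℝ} {q : I → ℝ} {K : U → U → ℝ} {ρ : U → I → ℝ}
  {γ η opt e R Λ N e₁ : ℝ}

theorem sum_weights_mul (h : RoundBounds p μ X q K ρ γ η opt e R Λ N e₁) (f : U → ℝ) :
    ∑ z : U × I, p z.1 * q z.2 * f z.1 = ∑ u, p u * f u := by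
  rw [Fintype.sum_prod_type]
  refine Finset.sum_congr rfl fun u _ => ?_
  dsimp only
  rw [← Finset.sum_mul, ← Finset.mul_sum, h.q_sum, mul_one]

theorem sum_weights (h : RoundBounds p μ X q K ρ γ η opt e R Λ N e₁) :
    ∑ z : U × I, p z.1 * q z.2 = 1 := by
  simpa [h.p_sum] using h.sum_weights_mul fun _ => 1

theorem abs_sum_kernel_le (h : RoundBounds p μ X q K ρ γ η opt e R Λ N e₁) {y : U → ℝ}
    (hy : ∀ u, 0 ≤ y u) (hy1 : ∑ u, y u = 1) (u : U) : |∑ x, y x * K x u| ≤ Λ := by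
  calc |∑ x, y x * K x u| ≤ ∑ x, |y x * K x u| := Finset.abs_sum_le_sum_abs _ _
    _ ≤ ∑ x, y x * Λ := by
        refine Finset.sum_le_sum fun x _ => ?_
        rw [abs_mul, abs_of_nonneg (hy x)]
        exact mul_le_mul_of_nonneg_left (h.K_abs x u) (hy x)
    _ = Λ := by rw [← Finset.sum_mul, hy1, one_mul]

/-- Jensen's inequality reduces an averaged row to single rows, whose second moments are diagonal
entries of the kernel. -/
theorem sum_sq_kernel_le (h : RoundBounds p μ X q K ρ γ η opt e R Λ N e₁) {y : U → ℝ}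
    (hy : ∀ u, 0 ≤ y u) (hy1 : ∑ u, y u = 1) :
    ∑ u, p u * (∑ x, y x * K x u) ^ 2 ≤ Λ := by
  calc ∑ u, p u * (∑ x, y x * K x u) ^ 2
      ≤ ∑ u, p u * ∑ x, y x * K x u ^ 2 :=
        Finset.sum_le_sum fun u _ => mul_le_mul_of_nonneg_left
          (Real.pow_arith_mean_le_arith_mean_pow_of_even _ _ _ (fun x _ => hy x) hy1 even_two)
          (h.p_nonneg u)
    _ = ∑ x, y x * K x x := by
        simp only [Finset.mul_sum]
        rw [Finset.sum_comm]
        refine Finset.sum_congr rfl fun x _ => ?_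
        rw [← h.K_sq x, Finset.mul_sum]
        exact Finset.sum_congr rfl fun u _ => by rw [h.K_symm x u]; ring
    _ ≤ ∑ x, y x * Λ := Finset.sum_le_sum fun x _ =>
        mul_le_mul_of_nonneg_left ((le_abs_self _).trans (h.K_abs x x)) (hy x)
    _ = Λ := by rw [← Finset.sum_mul, hy1, one_mul]

theorem sum_payoff_kernel (h : RoundBounds p μ X q K ρ γ η opt e R Λ N e₁) (y : U → ℝ) (i : I) :
    ∑ u, p u * (ρ u i * ∑ x, y x * K x u) = ∑ x, y x * ρ x i := by
  simp only [Finset.mul_sum]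
  rw [Finset.sum_comm]
  refine Finset.sum_congr rfl fun x _ => ?_
  rw [← h.unbiased i x, Finset.mul_sum]
  exact Finset.sum_congr rfl fun u _ => by ring

theorem abs_mean_le (h : RoundBounds p μ X q K ρ γ η opt e R Λ N e₁) (u : U) :
    |∑ k, q k * ρ u k| ≤ R := by
  calc |∑ k, q k * ρ u k| ≤ ∑ k, |q k * ρ u k| := Finset.abs_sum_le_sum_abs _ _
    _ ≤ ∑ k, q k * R := by
        refine Finset.sum_le_sum fun k _ => ?_
        rw [abs_mul, abs_of_nonneg (h.q_nonneg k)]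
        exact mul_le_mul_of_nonneg_left (h.ρ_abs u k) (h.q_nonneg k)
    _ = R := by rw [← Finset.sum_mul, h.q_sum, one_mul]

/-- The increment without the terms that carry off-diagonal entries of the kernel. -/
theorem abs_regular_part_le (h : RoundBounds p μ X q K ρ γ η opt e R Λ N e₁) (u : U) (i : I) :
    |opt + (-∑ k, q k * ρ u k + e) + ρ u i / (1 - γ) +
      Real.exp 2 * η * ρ u i ^ 2 * K u u / (1 - γ)| ≤ 1 + 3 * R + e₁ + 2 * Real.exp 2 * R ^ 2 := by
  have hγ := h.γ_le
  have h1γ : 0 < 1 - γ := by linarith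
  have hinv : (1 - γ)⁻¹ ≤ 2 := by
    rw [inv_le_comm₀ h1γ two_pos]
    linarith
  have hinv0 : 0 < (1 - γ)⁻¹ := inv_pos.2 h1γ
  have hR := h.R_nonneg
  have t1 := abs_le.1 (h.abs_mean_le u)
  have t2 : |ρ u i / (1 - γ)| ≤ 2 * R := by
    rw [div_eq_mul_inv, abs_mul, abs_of_pos hinv0]
    calc |ρ u i| * (1 - γ)⁻¹ ≤ R * 2 :=
          mul_le_mul (h.ρ_abs u i) hinv hinv0.le hR
      _ = 2 * R := mul_comm _ _
  have hη : η * K u u ≤ 1 :=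
    (mul_le_mul_of_nonneg_left ((le_abs_self _).trans (h.K_abs u u)) h.η_nonneg).trans h.η_Λ
  have hη0 : 0 ≤ η * K u u := mul_nonneg h.η_nonneg (h.K_nonneg u)
  have hρ2 : ρ u i ^ 2 ≤ R ^ 2 := by
    rw [← sq_abs (ρ u i)]
    exact pow_le_pow_left₀ (abs_nonneg _) (h.ρ_abs u i) 2
  have t3 : Real.exp 2 * η * ρ u i ^ 2 * K u u / (1 - γ) ≤ 2 * Real.exp 2 * R ^ 2 := by
    calc Real.exp 2 * η * ρ u i ^ 2 * K u u / (1 - γ)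
        = Real.exp 2 * (ρ u i ^ 2 * (η * K u u * (1 - γ)⁻¹)) := by rw [div_eq_mul_inv]; ring
      _ ≤ Real.exp 2 * (R ^ 2 * (1 * 2)) := by gcongr
      _ = _ := by ring
  have t3' : 0 ≤ Real.exp 2 * η * ρ u i ^ 2 * K u u / (1 - γ) := by
    have := h.η_nonneg
    have := h.K_nonneg u
    positivity
  have t2' := abs_le.1 t2
  have := h.opt_nonneg
  have := h.opt_le
  have := h.e_nonneg
  have := h.e_le
  have := (Real.exp_pos 2).le
  have : 0 ≤ 2 * Real.exp 2 * R ^ 2 := by positivity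
  rw [abs_le]
  constructor <;> linarith [t1.1, t1.2, t2'.1, t2'.2]

theorem abs_exploration_part_le (h : RoundBounds p μ X q K ρ γ η opt e R Λ N e₁) (u : U) (i : I) :
    |γ * (ρ u i * ∑ x, μ x * K x u) / (1 - γ)| ≤ R * |∑ x, μ x * K x u| := by
  have hγ := h.γ_le
  have h1γ : 0 < 1 - γ := by linarith
  rw [abs_div, abs_of_pos h1γ, div_le_iff₀ h1γ, abs_mul, abs_mul, abs_of_nonneg h.γ_nonneg]
  have h1 := mul_le_mul_of_nonneg_right (h.ρ_abs u i) (abs_nonneg (∑ x, μ x * K x u))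
  have h0 : 0 ≤ R * |∑ x, μ x * K x u| := mul_nonneg h.R_nonneg (abs_nonneg _)
  calc γ * (|ρ u i| * |∑ x, μ x * K x u|) ≤ γ * (R * |∑ x, μ x * K x u|) :=
        mul_le_mul_of_nonneg_left h1 h.γ_nonneg
    -- This is `γ ≤ 1 - γ`.
    _ ≤ R * |∑ x, μ x * K x u| * (1 - γ) := by nlinarith

theorem abs_comparator_part_le (h : RoundBounds p μ X q K ρ γ η opt e R Λ N e₁) (u : U) (i : I) :
    |ρ u i * ∑ x, X x * K x u| ≤ R * |∑ x, X x * K x u| := by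
  rw [abs_mul]
  exact mul_le_mul_of_nonneg_right (h.ρ_abs u i) (abs_nonneg _)

theorem incrementBound_eq (u : U) (i : I) :
    incrementBound μ X q K ρ γ η opt e u i =
      (opt + (-∑ k, q k * ρ u k + e) + ρ u i / (1 - γ) +
        Real.exp 2 * η * ρ u i ^ 2 * K u u / (1 - γ)) -
      γ * (ρ u i * ∑ x, μ x * K x u) / (1 - γ) - ρ u i * ∑ x, X x * K x u := by
  unfold incrementBound
  ring

theorem abs_incrementBound_le (h : RoundBounds p μ X q K ρ γ η opt e R Λ N e₁) (u : U) (i : I) :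
    |incrementBound μ X q K ρ γ η opt e u i| ≤ incrementConst R e₁ * Λ := by
  have hR := h.R_nonneg
  have hΛ := h.Λ_ge
  have he₁ := h.e_nonneg.trans h.e_le
  have h1 := h.abs_regular_part_le u i
  have h2 := (h.abs_exploration_part_le u i).trans
    (mul_le_mul_of_nonneg_left (h.abs_sum_kernel_le h.μ_nonneg h.μ_sum u) hR)
  have h3 := (h.abs_comparator_part_le u i).trans
    (mul_le_mul_of_nonneg_left (h.abs_sum_kernel_le h.X_nonneg h.X_sum u) hR)
  have h4 : 0 ≤ 1 + 3 * R + e₁ + 2 * Real.exp 2 * R ^ 2 := by positivity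
  have h5 := le_mul_of_one_le_right h4 hΛ
  rw [incrementBound_eq]
  refine (abs_sub _ _).trans ((add_le_add_left (abs_sub _ _) _).trans ?_)
  unfold incrementConst
  nlinarith

/-- Apart from a part bounded by a constant, the increment consists of two averaged rows of the
kernel, weighted by `μ` and by `X`, each with second moment at most `Λ`; the constant is absorbed by
`1 ≤ Λ`. -/
theorem sum_incrementBound_sq_le (h : RoundBounds p μ X q K ρ γ η opt e R Λ N e₁) :
    ∑ z : U × I, p z.1 * q z.2 * incrementBound μ X q K ρ γ η opt e z.1 z.2 ^ 2 ≤
      9 * incrementConst R e₁ ^ 2 * Λ := by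
  have hR := h.R_nonneg
  have hΛ := h.Λ_ge
  have he₁ := h.e_nonneg.trans h.e_le
  have hc : R ≤ incrementConst R e₁ := by
    unfold incrementConst
    nlinarith [mul_nonneg (Real.exp_pos 2).le (sq_nonneg R)]
  set c := incrementConst R e₁
  have hc0 : 0 ≤ c := hR.trans hc
  have key : ∀ z : U × I, incrementBound μ X q K ρ γ η opt e z.1 z.2 ^ 2 ≤
      3 * c ^ 2 + 3 * c ^ 2 * (∑ x, μ x * K x z.1) ^ 2 + 3 * c ^ 2 * (∑ x, X x * K x z.1) ^ 2 := by
    intro z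
    have h1 : |opt + (-∑ k, q k * ρ z.1 k + e) + ρ z.1 z.2 / (1 - γ) +
        Real.exp 2 * η * ρ z.1 z.2 ^ 2 * K z.1 z.1 / (1 - γ)| ≤ c :=
      (h.abs_regular_part_le z.1 z.2).trans (by simp only [c, incrementConst]; linarith)
    have h2 := (h.abs_exploration_part_le z.1 z.2).trans
      (mul_le_mul_of_nonneg_right hc (abs_nonneg _))
    have h3 := (h.abs_comparator_part_le z.1 z.2).trans
      (mul_le_mul_of_nonneg_right hc (abs_nonneg _))
    rw [incrementBound_eq]
    generalize opt + (-∑ k, q k * ρ z.1 k + e) + ρ z.1 z.2 / (1 - γ) +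
        Real.exp 2 * η * ρ z.1 z.2 ^ 2 * K z.1 z.1 / (1 - γ) = a at h1 ⊢
    generalize γ * (ρ z.1 z.2 * ∑ x, μ x * K x z.1) / (1 - γ) = b at h2 ⊢
    generalize ρ z.1 z.2 * ∑ x, X x * K x z.1 = d at h3 ⊢
    have s1 := pow_le_pow_left₀ (abs_nonneg _) h1 2
    have s2 := pow_le_pow_left₀ (abs_nonneg _) h2 2
    have s3 := pow_le_pow_left₀ (abs_nonneg _) h3 2
    rw [sq_abs] at s1 s2 s3
    rw [mul_pow, sq_abs] at s2 s3
    -- The three squares sum to `3 * (a² + b² + d²) - (a - b - d)²`.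
    nlinarith [sq_nonneg (a + b), sq_nonneg (a + d), sq_nonneg (b - d)]
  calc ∑ z : U × I, p z.1 * q z.2 * incrementBound μ X q K ρ γ η opt e z.1 z.2 ^ 2
      ≤ ∑ z : U × I, p z.1 * q z.2 * (3 * c ^ 2 + 3 * c ^ 2 * (∑ x, μ x * K x z.1) ^ 2 +
          3 * c ^ 2 * (∑ x, X x * K x z.1) ^ 2) :=
        Finset.sum_le_sum fun z _ => mul_le_mul_of_nonneg_left (key z)
          (mul_nonneg (h.p_nonneg _) (h.q_nonneg _))
    _ = 3 * c ^ 2 + 3 * c ^ 2 * (∑ u, p u * (∑ x, μ x * K x u) ^ 2) +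
          3 * c ^ 2 * (∑ u, p u * (∑ x, X x * K x u) ^ 2) := by
        rw [h.sum_weights_mul fun u => 3 * c ^ 2 + 3 * c ^ 2 * (∑ x, μ x * K x u) ^ 2 +
          3 * c ^ 2 * (∑ x, X x * K x u) ^ 2]
        simp only [mul_add, Finset.sum_add_distrib, mul_left_comm _ (3 * c ^ 2)]
        rw [← Finset.sum_mul, h.p_sum, one_mul, ← Finset.mul_sum, ← Finset.mul_sum]
    _ ≤ 3 * c ^ 2 + 3 * c ^ 2 * Λ + 3 * c ^ 2 * Λ := by
        have := h.sum_sq_kernel_le h.μ_nonneg h.μ_sum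
        have := h.sum_sq_kernel_le h.X_nonneg h.X_sum
        gcongr
    _ ≤ 9 * c ^ 2 * Λ := by nlinarith [sq_nonneg c]

/-- The payoffs of Edge and Hedge have the same mean and cancel, except for the factor `1 / (1 -
γ)`. This remainder and the exploration term cost `2 * γ * R` each, and the second-order term is at
most a multiple of `η * N ≤ γ`. -/
theorem sum_incrementBound_le (h : RoundBounds p μ X q K ρ γ η opt e R Λ N e₁) :
    ∑ z : U × I, p z.1 * q z.2 * incrementBound μ X q K ρ γ η opt e z.1 z.2 ≤
      opt - (∑ i, q i * ∑ x, X x * ρ x i) + (e + γ * (4 * R + 2 * Real.exp 2 * R ^ 2)) := by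
  have hγ := h.γ_le
  have hγ0 := h.γ_nonneg
  have h1γ : 0 < 1 - γ := by linarith
  have hinv : (1 - γ)⁻¹ ≤ 2 := by
    rw [inv_le_comm₀ h1γ two_pos]
    linarith
  have hinv0 : 0 < (1 - γ)⁻¹ := inv_pos.2 h1γ
  have hR := h.R_nonneg
  have hη := h.η_nonneg
  have hone := h.sum_weights
  have hpush := h.sum_weights_mul
  have hlin : ∀ y : U → ℝ, ∑ z : U × I, p z.1 * q z.2 * (ρ z.1 z.2 * ∑ x, y x * K x z.1) =
      ∑ i, q i * ∑ x, y x * ρ x i := by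
    intro y
    rw [Fintype.sum_prod_type, Finset.sum_comm]
    refine Finset.sum_congr rfl fun i _ => ?_
    rw [← h.sum_payoff_kernel y i, Finset.mul_sum]
    exact Finset.sum_congr rfl fun u _ => by ring
  have hmean : ∑ z : U × I, p z.1 * q z.2 * ρ z.1 z.2 = ∑ u, p u * ∑ k, q k * ρ u k := by
    rw [Fintype.sum_prod_type]
    refine Finset.sum_congr rfl fun u _ => ?_
    rw [Finset.mul_sum]
    exact Finset.sum_congr rfl fun i _ => by ring
  have hmean_le : ∑ u, p u * ∑ k, q k * ρ u k ≤ R := by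
    calc ∑ u, p u * ∑ k, q k * ρ u k ≤ ∑ u, p u * R := Finset.sum_le_sum fun u _ =>
          mul_le_mul_of_nonneg_left ((le_abs_self _).trans (h.abs_mean_le u)) (h.p_nonneg u)
      _ = R := by rw [← Finset.sum_mul, h.p_sum, one_mul]
  have hμmean : -R ≤ ∑ i, q i * ∑ x, μ x * ρ x i := by
    calc -R = ∑ i, q i * ∑ x, μ x * -R := by
          simp only [← Finset.sum_mul, h.q_sum, h.μ_sum, one_mul]
      _ ≤ _ := Finset.sum_le_sum fun i _ => mul_le_mul_of_nonneg_left
          (Finset.sum_le_sum fun x _ => mul_le_mul_of_nonneg_left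
            (abs_le.1 (h.ρ_abs x i)).1 (h.μ_nonneg x)) (h.q_nonneg i)
  have hpt : ∀ z : U × I, incrementBound μ X q K ρ γ η opt e z.1 z.2 ≤
      (opt + e) - ∑ k, q k * ρ z.1 k + (1 - γ)⁻¹ * ρ z.1 z.2
        - γ * (1 - γ)⁻¹ * (ρ z.1 z.2 * ∑ x, μ x * K x z.1)
        + 2 * Real.exp 2 * R ^ 2 * η * K z.1 z.1 - ρ z.1 z.2 * ∑ x, X x * K x z.1 := by
    intro z
    have hρ2 : ρ z.1 z.2 ^ 2 ≤ R ^ 2 := by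
      rw [← sq_abs (ρ z.1 z.2)]
      exact pow_le_pow_left₀ (abs_nonneg _) (h.ρ_abs z.1 z.2) 2
    have hK := h.K_nonneg z.1
    have : Real.exp 2 * η * ρ z.1 z.2 ^ 2 * K z.1 z.1 / (1 - γ) ≤
        2 * Real.exp 2 * R ^ 2 * η * K z.1 z.1 := by
      calc Real.exp 2 * η * ρ z.1 z.2 ^ 2 * K z.1 z.1 / (1 - γ)
          = Real.exp 2 * η * K z.1 z.1 * (ρ z.1 z.2 ^ 2 * (1 - γ)⁻¹) := by
            rw [div_eq_mul_inv]; ring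
        _ ≤ Real.exp 2 * η * K z.1 z.1 * (R ^ 2 * 2) := by gcongr
        _ = _ := by ring
    rw [incrementBound_eq]
    rw [div_eq_mul_inv] at this ⊢
    rw [div_eq_mul_inv, div_eq_mul_inv]
    linarith
  calc ∑ z : U × I, p z.1 * q z.2 * incrementBound μ X q K ρ γ η opt e z.1 z.2
      ≤ ∑ z : U × I, p z.1 * q z.2 * ((opt + e) - ∑ k, q k * ρ z.1 k + (1 - γ)⁻¹ * ρ z.1 z.2
        - γ * (1 - γ)⁻¹ * (ρ z.1 z.2 * ∑ x, μ x * K x z.1)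
        + 2 * Real.exp 2 * R ^ 2 * η * K z.1 z.1 - ρ z.1 z.2 * ∑ x, X x * K x z.1) :=
        Finset.sum_le_sum fun z _ => mul_le_mul_of_nonneg_left (hpt z)
          (mul_nonneg (h.p_nonneg _) (h.q_nonneg _))
    _ = (opt + e) * (∑ z : U × I, p z.1 * q z.2)
        - (∑ z : U × I, p z.1 * q z.2 * ∑ k, q k * ρ z.1 k)
        + (1 - γ)⁻¹ * (∑ z : U × I, p z.1 * q z.2 * ρ z.1 z.2)
        - γ * (1 - γ)⁻¹ * (∑ z : U × I, p z.1 * q z.2 * (ρ z.1 z.2 * ∑ x, μ x * K x z.1))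
        + 2 * Real.exp 2 * R ^ 2 * η * (∑ z : U × I, p z.1 * q z.2 * K z.1 z.1)
        - ∑ z : U × I, p z.1 * q z.2 * (ρ z.1 z.2 * ∑ x, X x * K x z.1) := by
        rw [Finset.mul_sum, Finset.mul_sum, Finset.mul_sum, Finset.mul_sum,
          ← Finset.sum_sub_distrib, ← Finset.sum_add_distrib, ← Finset.sum_sub_distrib,
          ← Finset.sum_add_distrib, ← Finset.sum_sub_distrib]
        exact Finset.sum_congr rfl fun z _ => by ring
    _ ≤ _ := by
        rw [hone, hpush (fun u => ∑ k, q k * ρ u k), hpush (fun u => K u u), hlin μ, hlin X, hmean]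
        have hγinv : (1 - γ)⁻¹ = 1 + γ * (1 - γ)⁻¹ := by field_simp; ring
        have hg0 : 0 ≤ γ * (1 - γ)⁻¹ := by positivity
        have hg : γ * (1 - γ)⁻¹ ≤ γ * 2 := mul_le_mul_of_nonneg_left hinv hγ0
        have b1 : γ * (1 - γ)⁻¹ * (∑ u, p u * ∑ k, q k * ρ u k) ≤ γ * 2 * R :=
          (mul_le_mul_of_nonneg_left hmean_le hg0).trans (mul_le_mul_of_nonneg_right hg hR)
        have b2 : γ * (1 - γ)⁻¹ * (-∑ i, q i * ∑ x, μ x * ρ x i) ≤ γ * 2 * R :=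
          (mul_le_mul_of_nonneg_left (neg_le.1 hμmean) hg0).trans
            (mul_le_mul_of_nonneg_right hg hR)
        have b3 : 2 * Real.exp 2 * R ^ 2 * η * (∑ u, p u * K u u) ≤
            2 * Real.exp 2 * R ^ 2 * γ := by
          rw [mul_assoc _ η]
          refine mul_le_mul_of_nonneg_left ?_ (by positivity)
          exact (mul_le_mul_of_nonneg_left h.K_trace hη).trans h.η_N
        have b4 : (1 - γ)⁻¹ * (∑ u, p u * ∑ k, q k * ρ u k) = (∑ u, p u * ∑ k, q k * ρ u k) +
            γ * (1 - γ)⁻¹ * (∑ u, p u * ∑ k, q k * ρ u k) := by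
          conv_lhs => rw [hγinv]
          ring
        linarith

/-- The exponential moment of the increment. -/
theorem sum_exp_incrementBound_le (h : RoundBounds p μ X q K ρ γ η opt e R Λ N e₁) {θ a rX : ℝ}
    (hθ : 0 ≤ θ) (hθΛ : θ * Λ ≤ a) (hrX : rX ≤ ∑ i, q i * ∑ x, X x * ρ x i) :
    ∑ u, p u * ∑ i, q i * Real.exp (θ * incrementBound μ X q K ρ γ η opt e u i) ≤
      1 + θ * (opt - rX) + (θ * (e + γ * (4 * R + 2 * Real.exp 2 * R ^ 2)) +
        9 * incrementConst R e₁ ^ 2 * Real.exp (incrementConst R e₁ * a) * (θ ^ 2 * Λ)) := by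
  have hc0 : 0 ≤ incrementConst R e₁ := by
    have := h.R_nonneg
    have := h.e_nonneg.trans h.e_le
    unfold incrementConst
    positivity
  have hb : ∀ z : U × I, |θ * incrementBound μ X q K ρ γ η opt e z.1 z.2| ≤
      incrementConst R e₁ * a := by
    intro z
    rw [abs_mul, abs_of_nonneg hθ]
    calc θ * |incrementBound μ X q K ρ γ η opt e z.1 z.2|
        ≤ θ * (incrementConst R e₁ * Λ) :=
          mul_le_mul_of_nonneg_left (h.abs_incrementBound_le z.1 z.2) hθ
      _ = incrementConst R e₁ * (θ * Λ) := by ring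
      _ ≤ _ := mul_le_mul_of_nonneg_left hθΛ hc0
  have hone := h.sum_weights
  have h1 := sum_mul_exp_le (fun z : U × I => mul_nonneg (h.p_nonneg z.1) (h.q_nonneg z.2))
    hone hb
  have h2 : ∑ z : U × I, p z.1 * q z.2 * Real.exp (θ * incrementBound μ X q K ρ γ η opt e z.1 z.2)
      = ∑ u, p u * ∑ i, q i * Real.exp (θ * incrementBound μ X q K ρ γ η opt e u i) := by
    rw [Fintype.sum_prod_type]
    refine Finset.sum_congr rfl fun u _ => ?_
    rw [Finset.mul_sum]
    exact Finset.sum_congr rfl fun i _ => by ring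
  have h3 : ∑ z : U × I, p z.1 * q z.2 * (θ * incrementBound μ X q K ρ γ η opt e z.1 z.2) =
      θ * ∑ z : U × I, p z.1 * q z.2 * incrementBound μ X q K ρ γ η opt e z.1 z.2 := by
    rw [Finset.mul_sum]
    exact Finset.sum_congr rfl fun z _ => by ring
  have h4 : ∑ z : U × I, p z.1 * q z.2 * (θ * incrementBound μ X q K ρ γ η opt e z.1 z.2) ^ 2 =
      θ ^ 2 * ∑ z : U × I, p z.1 * q z.2 * incrementBound μ X q K ρ γ η opt e z.1 z.2 ^ 2 := by
    rw [Finset.mul_sum]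
    exact Finset.sum_congr rfl fun z _ => by ring
  rw [h2, h3, h4] at h1
  have h5 : θ * ∑ z : U × I, p z.1 * q z.2 * incrementBound μ X q K ρ γ η opt e z.1 z.2 ≤
      θ * (opt - rX + (e + γ * (4 * R + 2 * Real.exp 2 * R ^ 2))) :=
    mul_le_mul_of_nonneg_left (h.sum_incrementBound_le.trans (by linarith)) hθ
  have h6 : Real.exp (incrementConst R e₁ * a) *
      (θ ^ 2 * ∑ z : U × I, p z.1 * q z.2 * incrementBound μ X q K ρ γ η opt e z.1 z.2 ^ 2) ≤
      Real.exp (incrementConst R e₁ * a) * (θ ^ 2 * (9 * incrementConst R e₁ ^ 2 * Λ)) :=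
    mul_le_mul_of_nonneg_left
      (mul_le_mul_of_nonneg_left h.sum_incrementBound_sq_le (sq_nonneg θ)) (Real.exp_pos _).le
  linarith

end RoundBounds

end Abstract

/-! ### The potential -/

/-- The standing assumptions on a run of the algorithm. -/
structure Regime (P : Setup n m) (c lam : ℝ) : Prop where
  c_pos : 0 < c
  n_ne : n ≠ 0
  m_pos : 1 ≤ m
  T_pos : 0 < P.T
  B_pos : 0 < P.B
  m_le : (m : ℝ) ≤ c * P.B / P.T
  b_pos : ∀ i, 0 < P.b i
  b_sum : ∑ i, P.b i = 1
  κ_nonneg : 0 ≤ P.κ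
  κ_le : P.κ ≤ 1
  spanning : Spanning P.μ
  least : IsLeast {x : ℝ | x ≠ 0 ∧
    Module.End.HasEigenvalue (Matrix.toLin' (cooccurrence P.μ)) x} lam
  γ_pos : 0 < (P.γ : ℝ)
  γ_le : (P.γ : ℝ) ≤ 1 / 2
  η_eq : (1 + c) * P.η * n = P.γ * lam
  ε_pos : 0 < P.ε

/-- A mixture of allocations that keeps the budget in expectation, and its mean reward. -/
structure Comparator (P : Setup n m) (X : Action n m → ℝ) (opt : ℝ) : Prop where
  nonneg : ∀ u, 0 ≤ X u
  sum_eq : ∑ u, X u = 1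
  budget : P.T * ∑ u, X u * cost u ≤ P.B
  value : ∑ u, X u * meanReward P.b P.κ P.D u = opt

/-- The error of a step of the dual algorithm, for payoffs bounded by `R`. -/
def hedgeError (ε R : ℝ) : ℝ := ε * R ^ 2 * Real.exp (ε * R)

/-- The logarithmic potential of a state after `t` rounds, none of which was the last one. -/
def logPotential (P : Setup n m) (X : Action n m → ℝ) (opt : ℝ) (t : ℕ) (s : State n m) : ℝ :=
  t * opt + 1 / P.ε * Real.log (∑ i, s.h i) +
    1 / P.η * (Real.log (∑ u, pathWeight s.w u) - ∑ u, X u * Real.log (pathWeight s.w u))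

/-- The bound for the increment of the potential in a round. -/
def stepBound (P : Setup n m) (c : ℝ) (X : Action n m → ℝ) (opt : ℝ) (s : State n m)
    (v : Fin n → ℕ) (u : Action n m) (i : Resource) : ℝ :=
  incrementBound (fun u => (P.μ u).toReal) X (fun k => (proportional s.h s.h_pos k).toReal)
    (kernel (samplePath P.γ P.μ s.w s.w_pos)) (fun u k => P.lagrangian u v k) P.γ P.η opt
    (hedgeError P.ε (2 + c)) u i

namespace Regime

variable {P : Setup n m} {c lam : ℝ}

theorem lam_pos (h : Regime P c lam) : 0 < lam := least_eigenvalue_pos h.least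

theorem n_pos (h : Regime P c lam) : (0 : ℝ) < n := Nat.cast_pos.2 (Nat.pos_of_ne_zero h.n_ne)

theorem η_pos (h : Regime P c lam) : 0 < P.η := by
  have h1 : 0 < (1 + c) * P.η * n := by
    rw [h.η_eq]
    exact mul_pos h.γ_pos h.lam_pos
  have h2 := pos_of_mul_pos_left h1 h.n_pos.le
  exact pos_of_mul_pos_right h2 (by linarith [h.c_pos])

theorem η_eq_div (h : Regime P c lam) : P.η = P.γ * lam / ((1 + c) * n) := by
  have := h.n_pos
  have := h.c_pos
  rw [eq_div_iff (by positivity), ← h.η_eq]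
  ring

theorem one_le_dim (h : Regime P c lam) : 1 ≤ (n : ℝ) / lam := by
  refine le_trans ?_ (mul_le_div h.spanning h.least)
  have h1 : 1 ≤ n * m := Nat.mul_pos (Nat.pos_of_ne_zero h.n_ne) h.m_pos
  exact_mod_cast h1

theorem roundBounds (h : Regime P c lam) {X : Action n m → ℝ} {opt : ℝ} (hX : Comparator P X opt)
    (s : State n m) (v : Fin n → ℕ) :
    RoundBounds (fun u => (samplePath P.γ P.μ s.w s.w_pos u).toReal) (fun u => (P.μ u).toReal) X
      (fun k => (proportional s.h s.h_pos k).toReal) (kernel (samplePath P.γ P.μ s.w s.w_pos))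
      (fun u k => P.lagrangian u v k) P.γ P.η opt (hedgeError P.ε (2 + c)) (2 + c)
      (n / (P.γ * lam)) (n / lam) (hedgeError P.ε (2 + c)) := by
  have hc := h.c_pos
  have hn := h.n_pos
  have hlam := h.lam_pos
  have hγ := h.γ_pos
  have hsp := spanning_samplePath h.γ_pos h.spanning s.w s.w_pos
  have hdiag := kernel_self_le h.spanning hsp h.least h.γ_pos
    (mul_le_samplePath P.γ P.μ s.w s.w_pos)
  have hmean : ∀ u : Action n m, 0 ≤ meanReward P.b P.κ P.D u :=
    meanReward_nonneg h.b_pos h.κ_nonneg P.D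
  exact
    { p_nonneg := fun u => ENNReal.toReal_nonneg
      p_sum := sum_toReal_pmf _
      μ_nonneg := fun u => ENNReal.toReal_nonneg
      μ_sum := sum_toReal_pmf _
      X_nonneg := hX.nonneg
      X_sum := hX.sum_eq
      q_nonneg := fun i => ENNReal.toReal_nonneg
      q_sum := sum_toReal_pmf _
      K_symm := kernel_comm _
      K_abs := abs_kernel_le hdiag
      K_nonneg := kernel_self_nonneg _
      K_sq := sum_kernel_sq _
      -- Passing to the trace for `μ` itself gives `n / lam`; the bound on the diagonal entries
      -- would lose a factor `1 / γ`.
      K_trace := by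
        rw [sum_kernel_self_eq_trace, cooccurrence_mul_inv_eq hsp h.spanning]
        exact trace_projection_le h.least
      unbiased := fun i u' => by
        obtain ⟨ℓ, hℓ⟩ := exists_lagrangian_eq_dotProduct P h.n_ne v i
        exact sum_mul_kernel hsp hℓ u'
      ρ_abs := fun u i => abs_lagrangian_le P h.B_pos h.T_pos h.m_le h.b_pos h.b_sum h.κ_nonneg
        h.κ_le u v i
      R_nonneg := by linarith
      γ_nonneg := hγ.le
      γ_le := h.γ_le
      η_nonneg := h.η_pos.le
      η_Λ := by
        have : P.η * (n / (P.γ * lam)) = 1 / (1 + c) := by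
          rw [h.η_eq_div]
          field_simp
        rw [this, div_le_one (by linarith)]
        linarith
      η_N := by
        have : P.η * (n / lam) = P.γ / (1 + c) := by
          rw [h.η_eq_div]
          field_simp
        rw [this]
        exact div_le_self hγ.le (by linarith)
      Λ_ge := by
        rw [mul_comm, ← div_div]
        exact (one_le_div hγ).2 ((h.γ_le.trans (by norm_num)).trans h.one_le_dim)
      opt_nonneg := by
        rw [← hX.value]
        exact Finset.sum_nonneg fun u _ => mul_nonneg (hX.nonneg u) (hmean u)
      opt_le := by
        rw [← hX.value, ← hX.sum_eq]
        exact Finset.sum_le_sum fun u _ => mul_le_of_le_one_right (hX.nonneg u)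
          (meanReward_le_one h.b_pos h.b_sum h.κ_nonneg h.κ_le P.D u)
      e_nonneg := by
        have := h.ε_pos
        unfold hedgeError
        positivity
      e_le := le_rfl }

/-! ### Change of the potential in one round -/

theorem sum_h_pos (s : State n m) : 0 < ∑ i, s.h i :=
  Finset.sum_pos (fun i _ => s.h_pos i) Finset.univ_nonempty

theorem sum_pathWeight_pos {w : GraphEdge n m → ℝ} (hw : ∀ e, 0 < w e) :
    0 < ∑ u : Action n m, pathWeight w u :=
  Finset.sum_pos (fun u _ => pathWeight_pos hw u) Finset.univ_nonempty

theorem log_hedge_update_le (h : Regime P c lam) (s : State n m) (v : Fin n → ℕ)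
    (u : Action n m) (i : Resource) :
    1 / P.ε * Real.log (∑ k, (P.update s u v i).h k) ≤ 1 / P.ε * Real.log (∑ k, s.h k) +
      (-∑ k, (proportional s.h s.h_pos k).toReal * P.lagrangian u v k +
        hedgeError P.ε (2 + c)) := by
  have hε := h.ε_pos
  have hH := sum_h_pos s
  have h1 := sum_mul_exp_neg_le (q := fun k => (proportional s.h s.h_pos k).toReal)
    (L := fun k => P.lagrangian u v k) hε.le (fun k => ENNReal.toReal_nonneg) (sum_toReal_pmf _)
    fun k => abs_lagrangian_le P h.B_pos h.T_pos h.m_le h.b_pos h.b_sum h.κ_nonneg h.κ_le u v k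
  have h2 : ∑ k, (P.update s u v i).h k = (∑ k, s.h k) *
      ∑ k, (proportional s.h s.h_pos k).toReal * Real.exp (-P.ε * P.lagrangian u v k) := by
    rw [Finset.mul_sum]
    refine Finset.sum_congr rfl fun k _ => ?_
    rw [proportional_toReal]
    simp only [Setup.update]
    field_simp
  have hpos : 0 < ∑ k, (proportional s.h s.h_pos k).toReal *
      Real.exp (-P.ε * P.lagrangian u v k) := by
    have := sum_h_pos (P.update s u v i)
    rw [h2] at this
    exact pos_of_mul_pos_right this hH.le
  rw [h2, Real.log_mul hH.ne' hpos.ne', mul_add]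
  refine add_le_add le_rfl ?_
  rw [one_div, inv_mul_le_iff₀ hε]
  exact (Real.log_le_iff_le_exp hpos).2 h1

theorem log_pathWeight_update (s : State n m) (v : Fin n → ℕ) (u u' : Action n m)
    (i : Resource) :
    Real.log (pathWeight (P.update s u v i).w u') = Real.log (pathWeight s.w u') +
      P.η * (P.lagrangian u v i * kernel (samplePath P.γ P.μ s.w s.w_pos) u' u) := by
  simp only [Setup.update]
  rw [pathWeight_newWeight, Real.log_mul (pathWeight_pos s.w_pos u').ne' (Real.exp_pos _).ne',
    Real.log_exp, dotProduct_estimate]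

theorem log_sum_pathWeight_update_le (h : Regime P c lam) {X : Action n m → ℝ} {opt : ℝ}
    (hX : Comparator P X opt) (s : State n m) (v : Fin n → ℕ) (u : Action n m) (i : Resource) :
    1 / P.η * Real.log (∑ u', pathWeight (P.update s u v i).w u') ≤
      1 / P.η * Real.log (∑ u', pathWeight s.w u') +
      ((P.lagrangian u v i - P.γ * (P.lagrangian u v i * ∑ x, (P.μ x).toReal *
          kernel (samplePath P.γ P.μ s.w s.w_pos) x u)) / (1 - P.γ) +
        Real.exp 2 * P.η * P.lagrangian u v i ^ 2 *
          kernel (samplePath P.γ P.μ s.w s.w_pos) u u / (1 - P.γ)) := by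
  have hη := h.η_pos
  have hc := h.c_pos
  have hr := h.roundBounds hX s v
  have hW := sum_pathWeight_pos (n := n) (m := m) s.w_pos
  have hsp := spanning_samplePath h.γ_pos h.spanning s.w s.w_pos
  set K := kernel (samplePath P.γ P.μ s.w s.w_pos) with hK
  have hsum1 : ∑ u', (samplePath P.γ P.μ s.w s.w_pos u').toReal * K u' u = 1 := by
    obtain ⟨ℓ, hℓ⟩ := exists_one_eq_dotProduct (n := n) (m := m) h.n_ne
    have := sum_mul_kernel hsp hℓ u
    rw [← this]
    exact Finset.sum_congr rfl fun u' _ => by rw [one_mul, hK, kernel_comm]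
  -- The factor `1 + c` in the rate serves this purpose: the product is at most `(2 + c) / (1 + c) ≤
  -- 2`.
  have hbound : ∀ u', |P.η * (P.lagrangian u v i * K u' u)| ≤ 2 := by
    intro u'
    have h1 : P.η * (n / (P.γ * lam)) = 1 / (1 + c) := by
      have := h.n_pos
      have := h.lam_pos
      have := h.γ_pos
      rw [h.η_eq_div]
      field_simp
    have hL : |P.lagrangian u v i| ≤ 2 + c := hr.ρ_abs u i
    rw [abs_mul, abs_mul, abs_of_pos hη]
    calc P.η * (|P.lagrangian u v i| * |K u' u|) ≤ P.η * ((2 + c) * (n / (P.γ * lam))) := by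
          have := hr.K_abs u' u
          gcongr
      _ = (2 + c) * (P.η * (n / (P.γ * lam))) := by ring
      _ ≤ 2 := by
          rw [h1, mul_one_div, div_le_iff₀ (by linarith)]
          linarith
  have h1 := sum_mul_exp_kernel_le (p := fun u => (samplePath P.γ P.μ s.w s.w_pos u).toReal)
    (μ := fun u => (P.μ u).toReal) (q := fun u => pathWeight s.w u / ∑ u', pathWeight s.w u')
    (k := fun u' => K u' u) (η := P.η) (ρ := P.lagrangian u v i) h.γ_pos.le
    (h.γ_le.trans_lt (by norm_num)) hr.μ_nonneg
    (fun u' => div_nonneg (pathWeight_pos s.w_pos u').le hW.le)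
    (by rw [← Finset.sum_div, div_self hW.ne'])
    (samplePath_toReal P.γ P.μ s.w s.w_pos) hsum1 (hr.K_sq u) hbound
  have h2 : ∑ u', pathWeight (P.update s u v i).w u' = (∑ u', pathWeight s.w u') *
      ∑ u', (pathWeight s.w u' / ∑ u', pathWeight s.w u') *
        Real.exp (P.η * (P.lagrangian u v i * K u' u)) := by
    rw [Finset.mul_sum]
    refine Finset.sum_congr rfl fun u' _ => ?_
    simp only [Setup.update]
    rw [pathWeight_newWeight, dotProduct_estimate]
    field_simp
    rfl
  have hpos : 0 < ∑ u', (pathWeight s.w u' / ∑ u', pathWeight s.w u') *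
        Real.exp (P.η * (P.lagrangian u v i * K u' u)) := by
    have := sum_pathWeight_pos (n := n) (m := m) (P.update s u v i).w_pos
    rw [h2] at this
    exact pos_of_mul_pos_right this hW.le
  rw [h2, Real.log_mul hW.ne' hpos.ne', mul_add]
  refine add_le_add le_rfl ?_
  rw [one_div, inv_mul_le_iff₀ hη]
  exact (Real.log_le_iff_le_exp hpos).2 h1

theorem logPotential_update_le (h : Regime P c lam) {X : Action n m → ℝ} {opt : ℝ}
    (hX : Comparator P X opt) (t : ℕ) (s : State n m) (v : Fin n → ℕ) (u : Action n m)
    (i : Resource) :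
    logPotential P X opt (t + 1) (P.update s u v i) ≤
      logPotential P X opt t s + stepBound P c X opt s v u i := by
  have hη := h.η_pos
  have h1 := h.log_hedge_update_le s v u i
  have h2 := h.log_sum_pathWeight_update_le hX s v u i
  have h3 : 1 / P.η * ∑ u', X u' * Real.log (pathWeight (P.update s u v i).w u') =
      1 / P.η * ∑ u', X u' * Real.log (pathWeight s.w u') +
        P.lagrangian u v i * ∑ x, X x * kernel (samplePath P.γ P.μ s.w s.w_pos) x u := by
    simp only [log_pathWeight_update, mul_add, Finset.sum_add_distrib, add_right_inj]
    rw [Finset.mul_sum, Finset.mul_sum]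
    refine Finset.sum_congr rfl fun x _ => ?_
    field_simp
  unfold logPotential stepBound incrementBound
  rw [mul_sub, mul_sub, h3]
  push_cast
  linarith

/-- The mean payoff of a comparator is at least its reward. -/
theorem reward_le_lagrangian (h : Regime P c lam) {X : Action n m → ℝ} {opt : ℝ}
    (hX : Comparator P X opt) (s : State n m) (v : Fin n → ℕ) :
    ∑ x, X x * reward P.b P.κ x v ≤
      ∑ i, (proportional s.h s.h_pos i).toReal * ∑ x, X x * P.lagrangian x v i := by
  have hB : (0 : ℝ) < P.B := Nat.cast_pos.2 h.B_pos
  have htr : ∑ x, X x * reward P.b P.κ x v ≤ ∑ x, X x * P.lagrangian x v Resource.troops := by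
    have h1 : ∑ x, X x * P.lagrangian x v Resource.troops =
        ∑ x, X x * reward P.b P.κ x v + (1 - (P.T * ∑ x, X x * cost x) / P.B) := by
      rw [← hX.sum_eq, Finset.mul_sum, Finset.sum_div, ← Finset.sum_sub_distrib,
        ← Finset.sum_add_distrib]
      refine Finset.sum_congr rfl fun x _ => ?_
      simp only [Setup.lagrangian]
      ring
    have h2 : (P.T * ∑ x, X x * cost x) / P.B ≤ 1 := (div_le_one hB).2 hX.budget
    linarith
  calc ∑ x, X x * reward P.b P.κ x v
      = ∑ i, (proportional s.h s.h_pos i).toReal * ∑ x, X x * reward P.b P.κ x v := by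
        rw [← Finset.sum_mul, sum_toReal_pmf, one_mul]
    _ ≤ _ := by
        refine Finset.sum_le_sum fun i _ => mul_le_mul_of_nonneg_left ?_ ENNReal.toReal_nonneg
        cases i with
        | troops => exact htr
        | time => exact le_rfl

/-- The growth rate of the exponential potential. -/
def growth (P : Setup n m) (c lam θ a : ℝ) : ℝ :=
  θ * (hedgeError P.ε (2 + c) + P.γ * (4 * (2 + c) + 2 * Real.exp 2 * (2 + c) ^ 2)) +
    9 * incrementConst (2 + c) (hedgeError P.ε (2 + c)) ^ 2 *
      Real.exp (incrementConst (2 + c) (hedgeError P.ε (2 + c)) * a) *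
        (θ ^ 2 * (n / (P.γ * lam)))

theorem growth_nonneg (h : Regime P c lam) {θ : ℝ} (hθ : 0 ≤ θ) (a : ℝ) :
    0 ≤ growth P c lam θ a := by
  have := h.ε_pos
  have := h.c_pos
  have := h.γ_pos
  have := h.lam_pos
  unfold growth hedgeError
  positivity

/-- For fixed `v` the exponential moment is bounded by an expression affine in the reward of `X`
against `v`. The mean of that reward is `opt`, so the first-order term vanishes on averaging over
`v`; its fluctuations need no separate treatment. -/
theorem expect_exp_stepBound_le (h : Regime P c lam) {X : Action n m → ℝ} {opt : ℝ}
    (hX : Comparator P X opt) (s : State n m) {θ a : ℝ} (hθ : 0 ≤ θ)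
    (hθa : θ * (n / (P.γ * lam)) ≤ a) :
    (expect P.D fun v => expect (samplePath P.γ P.μ s.w s.w_pos) fun u =>
      expect (proportional s.h s.h_pos) fun i =>
        ENNReal.ofReal (Real.exp (θ * stepBound P c X opt s v u i))) ≤
      ENNReal.ofReal (Real.exp (growth P c lam θ a)) := by
  have hg := h.growth_nonneg hθ a
  have hr0 : ∀ v, 0 ≤ ∑ x, X x * reward P.b P.κ x v := fun v =>
    Finset.sum_nonneg fun x _ => mul_nonneg (hX.nonneg x) (reward_nonneg h.b_pos h.κ_nonneg x v)
  have hr1 : ∀ v, ∑ x, X x * reward P.b P.κ x v ≤ 1 := fun v => by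
    rw [← hX.sum_eq]
    exact Finset.sum_le_sum fun x _ => mul_le_of_le_one_right (hX.nonneg x)
      (reward_le_one h.b_pos h.b_sum h.κ_le x v)
  have hreal : ∀ v, ∑ u, (samplePath P.γ P.μ s.w s.w_pos u).toReal *
      ∑ i, (proportional s.h s.h_pos i).toReal * Real.exp (θ * stepBound P c X opt s v u i) ≤
      1 + θ * (opt - ∑ x, X x * reward P.b P.κ x v) + growth P c lam θ a := fun v =>
    (h.roundBounds hX s v).sum_exp_incrementBound_le hθ hθa (h.reward_le_lagrangian hX s v)
  have key : ∀ v, (expect (samplePath P.γ P.μ s.w s.w_pos) fun u =>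
      expect (proportional s.h s.h_pos) fun i =>
        ENNReal.ofReal (Real.exp (θ * stepBound P c X opt s v u i))) ≤
      ENNReal.ofReal (1 + θ * (opt - ∑ x, X x * reward P.b P.κ x v) + growth P c lam θ a) := by
    intro v
    have h2 : ∀ u, (expect (proportional s.h s.h_pos) fun i =>
        ENNReal.ofReal (Real.exp (θ * stepBound P c X opt s v u i))) = ENNReal.ofReal
        (∑ i, (proportional s.h s.h_pos i).toReal *
          Real.exp (θ * stepBound P c X opt s v u i)) := fun u =>
      expect_fintype _ fun i => (Real.exp_pos _).le
    simp only [h2]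
    rw [expect_fintype _ fun u => Finset.sum_nonneg fun i _ =>
      mul_nonneg ENNReal.toReal_nonneg (Real.exp_pos _).le]
    exact ENNReal.ofReal_le_ofReal (hreal v)
  refine (expect_mono _ key).trans ?_
  rw [expect_ofReal P.D (K := 1 + θ * opt + growth P c lam θ a)
    (fun v => le_trans (Finset.sum_nonneg fun u _ => mul_nonneg ENNReal.toReal_nonneg
      (Finset.sum_nonneg fun i _ => mul_nonneg ENNReal.toReal_nonneg (Real.exp_pos _).le))
      (hreal v)) fun v => by nlinarith [mul_nonneg hθ (hr0 v)]]
  refine ENNReal.ofReal_le_ofReal ?_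
  have hval : ∑' v, (P.D v).toReal * ∑ x, X x * reward P.b P.κ x v = opt := by
    rw [← hX.value]
    simp only [Finset.mul_sum]
    rw [Summable.tsum_finsetSum fun x _ => ?_]
    · refine Finset.sum_congr rfl fun x _ => ?_
      rw [meanReward, ← tsum_mul_left]
      exact tsum_congr fun v => by ring
    · refine summable_toReal_mul_of_bounded P.D (K := X x) fun v => ?_
      have h0 := reward_nonneg h.b_pos h.κ_nonneg x v
      rw [abs_of_nonneg (mul_nonneg (hX.nonneg x) h0)]
      exact mul_le_of_le_one_right (hX.nonneg x) (reward_le_one h.b_pos h.b_sum h.κ_le x v)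
  have hsum : ∑' v, (P.D v).toReal * (1 + θ * (opt - ∑ x, X x * reward P.b P.κ x v) +
      growth P c lam θ a) = 1 + growth P c lam θ a := by
    have h1 : ∀ v, (P.D v).toReal * (1 + θ * (opt - ∑ x, X x * reward P.b P.κ x v) +
        growth P c lam θ a) = (P.D v).toReal * (1 + θ * opt + growth P c lam θ a) -
          θ * ((P.D v).toReal * ∑ x, X x * reward P.b P.κ x v) := fun v => by ring
    have h2 : Summable fun v => (P.D v).toReal * ∑ x, X x * reward P.b P.κ x v :=
      summable_toReal_mul_of_bounded P.D (K := 1) fun v => by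
        rw [abs_of_nonneg (hr0 v)]
        exact hr1 v
    simp only [h1]
    rw [((summable_toReal_pmf P.D).mul_right _).tsum_sub (h2.mul_left θ), tsum_mul_right,
      tsum_mul_left, tsum_toReal_pmf, hval]
    ring
  rw [hsum, add_comm]
  exact Real.add_one_le_exp _

/-! ### The supermartingale -/

/-- The part of the state that is determined by the rounds played so far. -/
structure Consistent (P : Setup n m) (t : ℕ) (s : State n m) : Prop where
  time : s.h Resource.time = Real.exp (-P.ε * s.total)
  troops : s.h Resource.troops =
    Real.exp (-P.ε * (s.total + t - (P.T : ℝ) / P.B * (P.B - s.x)))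

theorem consistent_init (P : Setup n m) : Consistent P 0 P.init := by
  constructor <;> simp [Setup.init]

theorem Consistent.update {t : ℕ} {s : State n m} (hs : Consistent P t s) {u : Action n m}
    (hu : cost u ≤ s.x) (v : Fin n → ℕ) (i : Resource) :
    Consistent P (t + 1) (P.update s u v i) := by
  constructor
  · simp only [Setup.update, hs.time, Setup.lagrangian]
    rw [← Real.exp_add]
    congr 1
    ring
  · simp only [Setup.update, hs.troops, Setup.lagrangian]
    rw [← Real.exp_add]
    congr 1
    push_cast [Nat.cast_sub hu]
    ring

theorem neg_le_log_sum (h : Regime P c lam) {s : State n m} {i : Resource} {y : ℝ}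
    (hy : s.h i = Real.exp (-P.ε * y)) : -y ≤ 1 / P.ε * Real.log (∑ k, s.h k) := by
  have hε := h.ε_pos
  have h1 : s.h i ≤ ∑ k, s.h k := Finset.single_le_sum (fun k _ => (s.h_pos k).le)
    (Finset.mem_univ i)
  have h2 := Real.log_le_log (s.h_pos i) h1
  rw [hy, Real.log_exp] at h2
  rw [one_div, le_inv_mul_iff₀ hε]
  linarith

theorem le_logPotential (h : Regime P c lam) {X : Action n m → ℝ} {opt : ℝ}
    (hX : Comparator P X opt) (t : ℕ) (s : State n m) :
    t * opt + 1 / P.ε * Real.log (∑ i, s.h i) ≤ logPotential P X opt t s := by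
  have h1 : ∑ u, X u * Real.log (pathWeight s.w u) ≤ Real.log (∑ u, pathWeight s.w u) := by
    calc ∑ u, X u * Real.log (pathWeight s.w u)
        ≤ ∑ u, X u * Real.log (∑ u, pathWeight s.w u) := by
          refine Finset.sum_le_sum fun u _ => mul_le_mul_of_nonneg_left ?_ (hX.nonneg u)
          exact Real.log_le_log (pathWeight_pos s.w_pos u)
            (Finset.single_le_sum (fun k _ => (pathWeight_pos s.w_pos k).le) (Finset.mem_univ u))
      _ = _ := by rw [← Finset.sum_mul, hX.sum_eq, one_mul]
  have h2 := mul_nonneg (one_div_pos.2 h.η_pos).le (sub_nonneg.2 h1)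
  unfold logPotential
  linarith

theorem regret_le_of_not_stopped (h : Regime P c lam) {X : Action n m → ℝ} {opt : ℝ}
    (hX : Comparator P X opt) {s : State n m} (hs : Consistent P P.T s) :
    P.T * opt - s.total ≤ logPotential P X opt P.T s := by
  have h1 := h.le_logPotential hX P.T s
  have h2 := h.neg_le_log_sum hs.time
  linarith

/-- When at most `m` troops are left, the bonus `1` per round minus the scaled consumption sums to
at most `t - T + c` for the troops resource. Its cumulative payoff thus falls short of the reward by
about `T - t`, which pays for the remaining `(T - t) * opt`. -/
theorem regret_le_of_exhausted (h : Regime P c lam) {X : Action n m → ℝ} {opt : ℝ}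
    (hX : Comparator P X opt) {t : ℕ} (ht : t ≤ P.T) {s : State n m} (hs : Consistent P t s)
    (hx : s.x ≤ m) : P.T * opt - s.total ≤ logPotential P X opt t s + c := by
  have h1 := h.le_logPotential hX t s
  have h2 := h.neg_le_log_sum hs.troops
  have hB : (0 : ℝ) < P.B := Nat.cast_pos.2 h.B_pos
  have hT : (0 : ℝ) < P.T := Nat.cast_pos.2 h.T_pos
  have h3 : (P.T : ℝ) / P.B * (P.B - s.x) = P.T - P.T / P.B * s.x := by field_simp
  have h4 : (P.T : ℝ) / P.B * s.x ≤ c := by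
    have : (s.x : ℝ) ≤ c * P.B / P.T := le_trans (Nat.cast_le.2 hx) h.m_le
    calc (P.T : ℝ) / P.B * s.x ≤ P.T / P.B * (c * P.B / P.T) :=
          mul_le_mul_of_nonneg_left this (by positivity)
      _ = c := by field_simp
  have h5 : (t : ℝ) ≤ P.T := Nat.cast_le.2 ht
  have h6 := (h.roundBounds hX s 0).opt_le
  nlinarith [mul_nonneg (sub_nonneg.2 h5) (sub_nonneg.2 h6)]

open Classical in
/-- A function of the time and the state that dominates the exponential regret at the end of the
game and does not increase in expectation. -/
def potential (P : Setup n m) (c lam : ℝ) (X : Action n m → ℝ) (opt θ a : ℝ) (t : ℕ)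
    (s : State n m) : ℝ≥0∞ :=
  if s.stopped then ENNReal.ofReal (Real.exp (θ * (P.T * opt - s.total)))
  else if Consistent P t s then
    ENNReal.ofReal (Real.exp (θ * logPotential P X opt t s +
      (θ * c + incrementConst (2 + c) (hedgeError P.ε (2 + c)) * a) +
        ((P.T : ℝ) - t) * growth P c lam θ a))
  -- The value `∞` makes a finite expectation exclude inconsistent states, so no separate
  -- almost-sure invariant is needed.
  else ∞

theorem neg_le_mul_stepBound (h : Regime P c lam) {X : Action n m → ℝ} {opt : ℝ}
    (hX : Comparator P X opt) {θ a : ℝ} (hθ : 0 ≤ θ) (hθa : θ * (n / (P.γ * lam)) ≤ a)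
    (s : State n m) (v : Fin n → ℕ) (u : Action n m) (i : Resource) :
    -(incrementConst (2 + c) (hedgeError P.ε (2 + c)) * a) ≤ θ * stepBound P c X opt s v u i := by
  have hr := h.roundBounds hX s v
  have h1 := (abs_le.1 (hr.abs_incrementBound_le u i)).1
  have hc0 : 0 ≤ incrementConst (2 + c) (hedgeError P.ε (2 + c)) := by
    have := hr.R_nonneg
    have := hr.e_nonneg
    unfold incrementConst
    positivity
  have h2 := mul_le_mul_of_nonneg_left h1 hθ
  have h3 := mul_le_mul_of_nonneg_left hθa hc0
  unfold stepBound
  linarith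

theorem incrementConst_mul_nonneg (h : Regime P c lam) {θ a : ℝ} (hθ : 0 ≤ θ)
    (hθa : θ * (n / (P.γ * lam)) ≤ a) :
    0 ≤ θ * c + incrementConst (2 + c) (hedgeError P.ε (2 + c)) * a := by
  have := h.ε_pos
  have := h.c_pos
  have := h.γ_pos
  have := h.lam_pos
  have ha : 0 ≤ a := le_trans (by positivity) hθa
  unfold incrementConst hedgeError
  positivity

/-- Whether the game ends depends on the drawn `u`, so the increment cannot be averaged over the
regular rounds alone. Instead the average is taken over all `u`; where the game ends, the increment
is bounded below by `neg_le_mul_stepBound`, and the constant slack in `potential` pays for it. The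
slack is needed only once. -/
theorem expect_step_potential_le (h : Regime P c lam) {X : Action n m → ℝ} {opt : ℝ}
    (hX : Comparator P X opt) {θ a : ℝ} (hθ : 0 ≤ θ) (hθa : θ * (n / (P.γ * lam)) ≤ a)
    {t : ℕ} (ht : t < P.T) (s : State n m) :
    expect (P.step s) (potential P c lam X opt θ a (t + 1)) ≤ potential P c lam X opt θ a t s := by
  have hg := h.growth_nonneg hθ a
  by_cases hst : s.stopped = true
  · rw [Setup.step, if_pos hst, expect_pure]
    simp [potential, hst]
  by_cases hs : Consistent P t s
  swap
  · simp [potential, hst, hs]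
  rw [Setup.step, if_neg hst]
  set M := θ * logPotential P X opt t s +
      (θ * c + incrementConst (2 + c) (hedgeError P.ε (2 + c)) * a) +
        ((P.T : ℝ) - (t + 1)) * growth P c lam θ a with hM
  have htT : (0 : ℝ) ≤ (P.T : ℝ) - (t + 1) := by
    have : ((t + 1 : ℕ) : ℝ) ≤ P.T := Nat.cast_le.2 ht
    push_cast at this
    linarith
  have hfinal : potential P c lam X opt θ a t s =
      ENNReal.ofReal (Real.exp M) * ENNReal.ofReal (Real.exp (growth P c lam θ a)) := by
    rw [potential, if_neg hst, if_pos hs, ← ENNReal.ofReal_mul (Real.exp_pos _).le,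
      ← Real.exp_add]
    congr 2
    rw [hM]
    ring
  rw [hfinal]
  refine le_trans ?_ (mul_le_mul_right (h.expect_exp_stepBound_le hX s hθ hθa) _)
  simp only [← expect_mul_left, expect_bind]
  refine expect_mono _ fun v => expect_mono _ fun u => ?_
  have hmul : ∀ i, ENNReal.ofReal (Real.exp M) *
      ENNReal.ofReal (Real.exp (θ * stepBound P c X opt s v u i)) =
      ENNReal.ofReal (Real.exp (M + θ * stepBound P c X opt s v u i)) := fun i => by
    rw [← ENNReal.ofReal_mul (Real.exp_pos _).le, ← Real.exp_add]
  simp only [hmul]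
  split_ifs with hx
  · simp only [expect_bind, expect_pure]
    set y := ENNReal.ofReal (Real.exp (θ * (logPotential P X opt t s + c)))
    have hleft : ∀ u' : ReducedAction n m s.x,
        potential P c lam X opt θ a (t + 1) (P.finish s u'.1 v) ≤ y := by
      intro u'
      have h1 := h.regret_le_of_exhausted hX ht.le hs (hx.le.trans (cost_le u))
      have h2 := reward_nonneg h.b_pos h.κ_nonneg u'.1 v
      rw [potential, if_pos (by rfl)]
      refine ENNReal.ofReal_le_ofReal (Real.exp_le_exp.2 (mul_le_mul_of_nonneg_left ?_ hθ))
      simp only [Setup.finish]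
      linarith
    refine (expect_mono _ hleft).trans ?_
    -- No resource is drawn in the last round; a fictitious draw is inserted for comparison with the
    -- right-hand side.
    rw [expect_const, ← expect_const (proportional s.h s.h_pos) y]
    refine expect_mono _ fun i => ENNReal.ofReal_le_ofReal (Real.exp_le_exp.2 ?_)
    have h1 := h.neg_le_mul_stepBound hX hθ hθa s v u i
    have h2 := mul_nonneg htT hg
    rw [hM]
    linarith
  · simp only [expect_bind, expect_pure]
    refine expect_mono _ fun i => ?_
    rw [potential, if_neg (by simp [Setup.update]), if_pos (hs.update (not_lt.1 hx) v i)]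
    refine ENNReal.ofReal_le_ofReal (Real.exp_le_exp.2 ?_)
    have h1 := mul_le_mul_of_nonneg_left (h.logPotential_update_le hX t s v u i) hθ
    rw [hM]
    push_cast
    linarith

theorem expect_run_potential_le (h : Regime P c lam) {X : Action n m → ℝ} {opt : ℝ}
    (hX : Comparator P X opt) {θ a : ℝ} (hθ : 0 ≤ θ) (hθa : θ * (n / (P.γ * lam)) ≤ a)
    (t : ℕ) (ht : t ≤ P.T) :
    expect (P.run t) (potential P c lam X opt θ a t) ≤ potential P c lam X opt θ a 0 P.init := by
  induction t with
  | zero => rw [Setup.run, expect_pure]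
  | succ t ih =>
    rw [Setup.run, expect_bind]
    exact (expect_mono _ fun s => h.expect_step_potential_le hX hθ hθa ht s).trans
      (ih (Nat.le_of_succ_le ht))

theorem exp_regret_le_potential (h : Regime P c lam) {X : Action n m → ℝ} {opt : ℝ}
    (hX : Comparator P X opt) {θ a : ℝ} (hθ : 0 ≤ θ) (hθa : θ * (n / (P.γ * lam)) ≤ a)
    (s : State n m) :
    ENNReal.ofReal (Real.exp (θ * (P.T * opt - s.total))) ≤
      potential P c lam X opt θ a P.T s := by
  unfold potential
  split_ifs with h1 h2
  · exact le_rfl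
  · refine ENNReal.ofReal_le_ofReal (Real.exp_le_exp.2 ?_)
    have h3 := mul_le_mul_of_nonneg_left (h.regret_le_of_not_stopped hX h2) hθ
    have h4 := h.incrementConst_mul_nonneg hθ hθa
    rw [sub_self, zero_mul]
    linarith
  · exact le_top

/-- The exponential moment of the regret against a comparator. -/
theorem expect_exp_regret_le (h : Regime P c lam) {X : Action n m → ℝ} {opt : ℝ}
    (hX : Comparator P X opt) {θ a : ℝ} (hθ : 0 ≤ θ) (hθa : θ * (n / (P.γ * lam)) ≤ a) :
    (expect (P.run P.T) fun s => ENNReal.ofReal (Real.exp (θ * (P.T * opt - s.total)))) ≤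
      ENNReal.ofReal (Real.exp (θ * (1 / P.ε * Real.log 2 +
        1 / P.η * Real.log (Fintype.card (Action n m))) +
        (θ * c + incrementConst (2 + c) (hedgeError P.ε (2 + c)) * a) +
          P.T * growth P c lam θ a)) := by
  refine (expect_mono _ fun s => h.exp_regret_le_potential hX hθ hθa s).trans
    ((h.expect_run_potential_le hX hθ hθa P.T le_rfl).trans (le_of_eq ?_))
  rw [potential, if_neg (by simp [Setup.init]), if_pos (consistent_init P)]
  have h1 : ∑ i : Resource, (P.init.h i) = 2 := by
    simp only [Setup.init, Finset.sum_const, Finset.card_univ]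
    norm_num [show Fintype.card Resource = 2 from rfl]
  have h2 : logPotential P X opt 0 P.init =
      1 / P.ε * Real.log 2 + 1 / P.η * Real.log (Fintype.card (Action n m)) := by
    unfold logPotential
    rw [h1]
    simp [Setup.init, pathWeight_one]
  rw [h2]
  simp

end Regime

/-! ### The regret never exceeds the number of rounds -/

/-- Zero expectation of a function with values `0` and `∞` expresses that the total is almost surely
nonnegative. -/
theorem expect_run_total_nonneg (P : Setup n m) (hb : ∀ i, 0 < P.b i) (hκ : 0 ≤ P.κ) (t : ℕ) :
    expect (P.run t) (fun s => if 0 ≤ s.total then 0 else ∞) = 0 := by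
  induction t with
  | zero => simp [Setup.run, expect_pure, Setup.init]
  | succ t ih =>
    rw [Setup.run, expect_bind, ← nonpos_iff_eq_zero]
    refine (expect_mono _ fun s => ?_).trans ih.le
    split_ifs with hs
    swap
    · exact le_top
    have hr : ∀ (u : Action n m) v, 0 ≤ s.total + reward P.b P.κ u v := fun u v =>
      add_nonneg hs (reward_nonneg hb hκ u v)
    unfold Setup.step
    split_ifs with hst
    · simp [expect_pure, hs]
    · simp only [expect_bind]
      refine (expect_mono (g := fun _ => 0) _ fun v => ?_).trans (expect_const _ _).le
      refine (expect_mono (g := fun _ => 0) _ fun u => ?_).trans (expect_const _ _).le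
      split_ifs with hx
      · simp only [expect_bind, expect_pure, Setup.finish, hr, if_true, expect_const, le_refl]
      · simp only [expect_bind, expect_pure, Setup.update, hr, if_true, expect_const, le_refl]

theorem one_le_probRegretLE (P : Setup n m) (hT : 0 < P.T) (hb : ∀ i, 0 < P.b i)
    (hb1 : ∑ i, P.b i = 1) (hκ0 : 0 ≤ P.κ) (hκ : P.κ ≤ 1) {r : ℝ} (hr : P.T ≤ r) :
    1 ≤ P.probRegretLE r := by
  have h := one_sub_le_toOuterMeasure (P.run P.T)
    {s | optDP m P.B P.T P.b P.κ P.D - s.total ≤ r}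
    (fun s => if 0 ≤ s.total then 0 else ∞) le_rfl (fun s hs => ?_)
    (by rw [expect_run_total_nonneg P hb hκ0]; exact zero_le)
  · rwa [sub_zero] at h
  · split_ifs with h0
    · refine absurd ?_ hs
      have := optDP_le (m := m) (B := P.B) hb hb1 hκ0 hκ P.D hT
      change _ - _ ≤ r
      linarith
    · exact le_top

/-! ### The choice of the parameters -/

/-- With `x = T ^ (1 / 3)`, `N = n / λ`, `F = N + E`, `ℓ = log S` and `L = log (T / δ)`, the
quantities that govern the regret are bounded in terms of `x ^ 2 * √(N m L)`. -/
theorem parameter_bounds {x N m L ℓ F γ q : ℝ} (hx : 1 ≤ x) (hN : 1 ≤ N) (hm : 1 ≤ m)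
    (hL : 1 ≤ L) (hℓ : 1 / 2 ≤ ℓ) (hF0 : N ≤ F) (hF : F ≤ 7 * N) (hγ : 0 < γ)
    (hγ2 : γ ^ 2 * (F * x ^ 2) = N ^ 2 * ℓ) (hℓL : ℓ ≤ 5 * m * L) (hq0 : 0 ≤ q)
    (hq : q ^ 2 = N * m * L) :
    γ * x ^ 3 ≤ 3 * (x ^ 2 * q) ∧ N / γ * ℓ ≤ 6 * (x ^ 2 * q) ∧
      (L ≤ x ^ 2 → L * (N / γ) ≤ 4 * (x ^ 2 * q)) ∧
      x ^ 3 * (L / (x ^ 2 * q)) ^ 2 * (N / γ) ≤ 4 * L := by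
  have hx0 : 0 < x := by linarith
  have hN0 : 0 < N := by linarith
  have hm0 : 0 < m := by linarith
  have hL0 : 0 < L := by linarith
  have hℓ0 : 0 < ℓ := by linarith
  have hFpos : 0 < F := by linarith
  have hΛsq : (N / γ) ^ 2 = F * x ^ 2 / ℓ := by
    rw [div_pow, div_eq_div_iff (by positivity) (by positivity), ← hγ2]
    ring
  -- The factor `14` comes from `F ≤ 7 * N` and `1 / ℓ ≤ 2`.
  have hΛle : (N / γ) ^ 2 ≤ 14 * N * x ^ 2 := by
    rw [hΛsq, div_le_iff₀ hℓ0]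
    have : F * x ^ 2 ≤ 7 * N * x ^ 2 := by gcongr
    have : 14 * N * x ^ 2 * (1 / 2) ≤ 14 * N * x ^ 2 * ℓ := by gcongr
    linarith
  have hΛ0 : 0 < N / γ := div_pos hN0 hγ
  have hqpos : 0 < q := by
    refine lt_of_le_of_ne hq0 fun h => ?_
    rw [← h] at hq
    have : 0 < N * m * L := by positivity
    linarith [zero_pow (M₀ := ℝ) two_ne_zero]
  refine ⟨?_, ?_, fun hLx => ?_, ?_⟩
  · rw [← sq_le_sq₀ (by positivity) (by positivity)]
    have h1 : γ ^ 2 * x ^ 2 ≤ N * ℓ := by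
      have : γ ^ 2 * x ^ 2 * N ≤ N * ℓ * N := by
        calc γ ^ 2 * x ^ 2 * N ≤ γ ^ 2 * x ^ 2 * F := by gcongr
          _ = N * ℓ * N := by linarith
      exact le_of_mul_le_mul_right this hN0
    calc (γ * x ^ 3) ^ 2 = (γ ^ 2 * x ^ 2) * x ^ 4 := by ring
      _ ≤ (N * (5 * m * L)) * x ^ 4 := mul_le_mul_of_nonneg_right
          (h1.trans (mul_le_mul_of_nonneg_left hℓL hN0.le)) (by positivity)
      _ = 5 * (x ^ 4 * q ^ 2) := by rw [hq]; ring
      _ ≤ 9 * (x ^ 4 * q ^ 2) := by gcongr; norm_num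
      _ = _ := by ring
  · rw [← sq_le_sq₀ (by positivity) (by positivity)]
    calc (N / γ * ℓ) ^ 2 = F * x ^ 2 * ℓ := by rw [mul_pow, hΛsq]; field_simp
      _ ≤ 7 * N * x ^ 2 * (5 * m * L) := by gcongr
      _ = 35 * (q ^ 2 * x ^ 2) * 1 := by rw [hq]; ring
      _ ≤ 36 * (q ^ 2 * x ^ 2) * x ^ 2 := by
          gcongr
          · norm_num
          · exact one_le_pow₀ hx
      _ = _ := by ring
  · rw [← sq_le_sq₀ (by positivity) (by positivity)]
    calc (L * (N / γ)) ^ 2 = L * L * (N / γ) ^ 2 := by ring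
      _ ≤ L * x ^ 2 * (14 * N * x ^ 2) := by gcongr
      _ = 14 * (N * 1 * L) * x ^ 4 := by ring
      _ ≤ 16 * (N * m * L) * x ^ 4 := by gcongr; norm_num
      _ = _ := by rw [← hq]; ring
  · have h1 : N / γ ≤ 4 * (x * N * m) := by
      rw [← sq_le_sq₀ (by positivity) (by positivity)]
      calc (N / γ) ^ 2 ≤ 14 * N * x ^ 2 := hΛle
        _ = 14 * (N * 1) * x ^ 2 * 1 := by ring
        _ ≤ 16 * (N * N) * x ^ 2 * (m ^ 2) := by
            gcongr
            · norm_num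
            · exact one_le_pow₀ hm
        _ = _ := by ring
    calc x ^ 3 * (L / (x ^ 2 * q)) ^ 2 * (N / γ)
        ≤ x ^ 3 * (L / (x ^ 2 * q)) ^ 2 * (4 * (x * N * m)) := by gcongr
      _ = 4 * L * ((N * m * L) / q ^ 2) := by field_simp
      _ = 4 * L := by rw [hq, div_self (by positivity), mul_one]

theorem hedgeError_le {ε a R T : ℝ} (hT : 1 ≤ T) (ha : 0 ≤ a) (hR : 0 ≤ R)
    (h : ε ≤ a / Real.sqrt T) : hedgeError ε R * Real.sqrt T ≤ hedgeError a R ∧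
      hedgeError ε R ≤ hedgeError a R := by
  have hs : 1 ≤ Real.sqrt T := Real.one_le_sqrt.2 hT
  have h1 : ε * Real.sqrt T ≤ a := (le_div_iff₀ (by linarith)).1 h
  have h2 : ε ≤ a := h.trans (div_le_self ha hs)
  unfold hedgeError
  constructor
  · calc ε * R ^ 2 * Real.exp (ε * R) * Real.sqrt T
        = ε * Real.sqrt T * R ^ 2 * Real.exp (ε * R) := by ring
      _ ≤ a * R ^ 2 * Real.exp (a * R) := by gcongr
  · gcongr

/-! ### Exponential Markov inequality with tuned parameters -/

/-- The constant in front of `L` in the exponent of the final bound. -/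
def exponentConst (c a₁ a₂ : ℝ) : ℝ :=
  1 / a₁ + 6 * (1 + c) + c + 4 * incrementConst (2 + c) (hedgeError a₂ (2 + c)) +
    hedgeError a₂ (2 + c) + 3 * (4 * (2 + c) + 2 * Real.exp 2 * (2 + c) ^ 2) +
    4 * (9 * incrementConst (2 + c) (hedgeError a₂ (2 + c)) ^ 2 *
      Real.exp (incrementConst (2 + c) (hedgeError a₂ (2 + c)) * 4))

theorem Regime.exponent_le {P : Setup n m} {c lam a₁ a₂ : ℝ} (h : Regime P c lam)
    (ha₁ : 0 < a₁) (ha₂ : 0 < a₂) (hε1 : a₁ / Real.sqrt P.T ≤ P.ε)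
    (hε2 : P.ε ≤ a₂ / Real.sqrt P.T) {Q L : ℝ} (hL1 : 1 ≤ L)
    (hQT : Real.sqrt P.T ≤ Q) (hγQ : (P.γ : ℝ) * P.T ≤ 3 * Q)
    (hΛℓ : n / lam / P.γ * Real.log (Fintype.card (Action n m)) ≤ 6 * Q)
    (hvar : P.T * (L / Q) ^ 2 * (n / lam / P.γ) ≤ 4 * L) :
    L / Q * (1 / P.ε * Real.log 2 + 1 / P.η * Real.log (Fintype.card (Action n m))) +
      (L / Q * c + incrementConst (2 + c) (hedgeError P.ε (2 + c)) * 4) +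
        P.T * growth P c lam (L / Q) 4 ≤ exponentConst c a₁ a₂ * L := by
  have hc := h.c_pos
  have hT1 : (1 : ℝ) ≤ P.T := Nat.one_le_cast.2 h.T_pos
  have hsT : 1 ≤ Real.sqrt P.T := Real.one_le_sqrt.2 hT1
  have hQ1 : 1 ≤ Q := hsT.trans hQT
  have hQ0 : 0 < Q := by linarith
  set θ := L / Q with hθdef
  have hθ : 0 ≤ θ := by positivity
  have hθQ : θ * Q = L := by rw [hθdef]; field_simp
  have hΛ : (n : ℝ) / (P.γ * lam) = n / lam / P.γ := by rw [div_div, mul_comm]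
  have hhe := hedgeError_le hT1 ha₂.le (R := 2 + c) (by linarith) hε2
  have hhe0 : 0 ≤ hedgeError P.ε (2 + c) := by
    have := h.ε_pos
    unfold hedgeError
    positivity
  set he := hedgeError P.ε (2 + c) with hhe_def
  set he' := hedgeError a₂ (2 + c) with hhe'_def
  have hic0 : 0 ≤ incrementConst (2 + c) he := by unfold incrementConst; positivity
  have hic : incrementConst (2 + c) he ≤ incrementConst (2 + c) he' := by
    unfold incrementConst
    linarith [hhe.2]
  set ic := incrementConst (2 + c) he with hic_def
  set ic' := incrementConst (2 + c) he' with hic'_def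
  set k := 4 * (2 + c) + 2 * Real.exp 2 * (2 + c) ^ 2 with hk
  have hk0 : 0 ≤ k := by positivity
  have e1 : θ * (1 / P.ε * Real.log 2) ≤ 1 / a₁ * L := by
    have h1 : 1 / P.ε ≤ 1 / a₁ * Real.sqrt P.T := by
      rw [one_div, inv_le_comm₀ h.ε_pos (by positivity)]
      refine le_trans (le_of_eq ?_) hε1
      rw [one_div, mul_inv, inv_inv, div_eq_mul_inv]
    have h2 : 1 / P.ε * Real.log 2 ≤ 1 / a₁ * Q := by
      calc 1 / P.ε * Real.log 2 ≤ 1 / P.ε * 1 := by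
            have := h.ε_pos
            have := Real.log_two_lt_d9
            gcongr
            linarith
        _ ≤ 1 / a₁ * Q := by
            rw [mul_one]
            exact h1.trans (mul_le_mul_of_nonneg_left hQT (by positivity))
    calc θ * (1 / P.ε * Real.log 2) ≤ θ * (1 / a₁ * Q) := mul_le_mul_of_nonneg_left h2 hθ
      _ = 1 / a₁ * L := by rw [← hθQ]; ring
  have e2 : θ * (1 / P.η * Real.log (Fintype.card (Action n m))) ≤ 6 * (1 + c) * L := by
    have h1 : 1 / P.η = (1 + c) * (n / lam / P.γ) := by
      have := h.n_pos
      have := h.lam_pos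
      have := h.γ_pos
      rw [h.η_eq_div]
      field_simp
    calc θ * (1 / P.η * Real.log (Fintype.card (Action n m)))
        = θ * (1 + c) * (n / lam / P.γ * Real.log (Fintype.card (Action n m))) := by
          rw [h1]; ring
      _ ≤ θ * (1 + c) * (6 * Q) := by gcongr
      _ = 6 * (1 + c) * L := by rw [← hθQ]; ring
  have hθL : θ ≤ L := by
    rw [← hθQ]
    exact le_mul_of_one_le_right hθ hQ1
  have e3 : θ * c ≤ c * L := by
    rw [mul_comm]
    exact mul_le_mul_of_nonneg_left hθL hc.le
  have e4 : ic * 4 ≤ 4 * ic' * L := by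
    calc ic * 4 ≤ 4 * ic' * 1 := by linarith
      _ ≤ 4 * ic' * L := mul_le_mul_of_nonneg_left hL1 (by linarith)
  have e5 : P.T * (θ * he) ≤ he' * L := by
    have h1 : P.T * he ≤ he' * Q := by
      calc (P.T : ℝ) * he = he * Real.sqrt P.T * Real.sqrt P.T := by
            rw [mul_assoc, Real.mul_self_sqrt (by linarith), mul_comm]
        _ ≤ he' * Q := mul_le_mul hhe.1 hQT (by positivity) (hhe0.trans hhe.2)
    calc P.T * (θ * he) = θ * (P.T * he) := by ring
      _ ≤ θ * (he' * Q) := mul_le_mul_of_nonneg_left h1 hθ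
      _ = he' * L := by rw [← hθQ]; ring
  have e6 : P.T * (θ * (P.γ * k)) ≤ 3 * k * L := by
    calc P.T * (θ * (P.γ * k)) = θ * k * (P.γ * P.T) := by ring
      _ ≤ θ * k * (3 * Q) := mul_le_mul_of_nonneg_left hγQ (by positivity)
      _ = 3 * k * L := by rw [← hθQ]; ring
  have e7 : P.T * (9 * ic ^ 2 * Real.exp (ic * 4) * (θ ^ 2 * (n / (P.γ * lam)))) ≤
      4 * (9 * ic' ^ 2 * Real.exp (ic' * 4)) * L := by
    calc P.T * (9 * ic ^ 2 * Real.exp (ic * 4) * (θ ^ 2 * (n / (P.γ * lam))))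
        = 9 * ic ^ 2 * Real.exp (ic * 4) * (P.T * θ ^ 2 * (n / lam / P.γ)) := by rw [hΛ]; ring
      _ ≤ 9 * ic ^ 2 * Real.exp (ic * 4) * (4 * L) :=
          mul_le_mul_of_nonneg_left hvar (by positivity)
      _ ≤ 9 * ic' ^ 2 * Real.exp (ic' * 4) * (4 * L) := by gcongr
      _ = _ := by ring
  have hgr : P.T * growth P c lam θ 4 = P.T * (θ * he) + P.T * (θ * (P.γ * k)) +
      P.T * (9 * ic ^ 2 * Real.exp (ic * 4) * (θ ^ 2 * (n / (P.γ * lam)))) := by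
    unfold growth
    ring
  have hconst : exponentConst c a₁ a₂ * L = 1 / a₁ * L + 6 * (1 + c) * L + c * L + 4 * ic' * L +
      he' * L + 3 * k * L + 4 * (9 * ic' ^ 2 * Real.exp (ic' * 4)) * L := by
    unfold exponentConst
    ring
  rw [hgr, hconst, mul_add θ]
  clear_value ic ic' he he' k
  linarith only [e1, e2, e3, e4, e5, e6, e7]

/-- A high-probability bound for the regret, in terms of the quantities of `parameter_bounds`. -/
theorem Regime.le_probRegretLE {P : Setup n m} {c lam a₁ a₂ : ℝ} (h : Regime P c lam)
    (ha₁ : 0 < a₁) (ha₂ : 0 < a₂) (hε1 : a₁ / Real.sqrt P.T ≤ P.ε)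
    (hε2 : P.ε ≤ a₂ / Real.sqrt P.T) {δ : ℝ} (hδ : 0 < δ) {Q L r : ℝ}
    (hL : L = Real.log (P.T / δ)) (hL1 : 1 ≤ L) (hQT : Real.sqrt P.T ≤ Q)
    (hγQ : (P.γ : ℝ) * P.T ≤ 3 * Q)
    (hΛℓ : n / lam / P.γ * Real.log (Fintype.card (Action n m)) ≤ 6 * Q)
    (hΛL : L * (n / lam / P.γ) ≤ 4 * Q)
    (hvar : P.T * (L / Q) ^ 2 * (n / lam / P.γ) ≤ 4 * L)
    (hr : (exponentConst c a₁ a₂ + 2) * Q ≤ r) :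
    1 - δ ≤ P.probRegretLE r := by
  have hexp := h.exponent_le ha₁ ha₂ hε1 hε2 hL1 hQT hγQ hΛℓ hvar
  have hT1 : (1 : ℝ) ≤ P.T := Nat.one_le_cast.2 h.T_pos
  have hQ1 : 1 ≤ Q := (Real.one_le_sqrt.2 hT1).trans hQT
  have hQ0 : 0 < Q := by linarith
  set θ := L / Q with hθdef
  have hθ : 0 ≤ θ := by positivity
  have hθQ : θ * Q = L := by rw [hθdef]; field_simp
  have hθL : θ ≤ L := by
    rw [← hθQ]
    exact le_mul_of_one_le_right hθ hQ1
  have hΛ : (n : ℝ) / (P.γ * lam) = n / lam / P.γ := by rw [div_div, mul_comm]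
  have hθa : θ * (n / (P.γ * lam)) ≤ 4 := by
    rw [hΛ, hθdef, div_mul_eq_mul_div, div_le_iff₀ hQ0]
    exact hΛL
  obtain ⟨π, hπ, hval⟩ := exists_policy_gt (m := m) P.b P.κ P.D P.B P.T
  obtain ⟨X, hX0, hX1, hXB, hXv⟩ := exists_mixture h.b_pos h.κ_nonneg P.D h.T_pos hπ
  have hX : Comparator P X (∑ u, X u * meanReward P.b P.κ P.D u) := ⟨hX0, hX1, hXB, rfl⟩
  set opt := ∑ u, X u * meanReward P.b P.κ P.D u
  have hmain := h.expect_exp_regret_le hX hθ hθa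
  have hδL : Real.exp (-L) ≤ δ := by
    -- In fact `exp (-L) = δ / T`.
    rw [hL, Real.exp_neg, Real.exp_log (by positivity), inv_div]
    exact div_le_self hδ.le hT1
  refine one_sub_le_toOuterMeasure _ _
    (fun s => ENNReal.ofReal (Real.exp (-(θ * (r - 1)))) *
      ENNReal.ofReal (Real.exp (θ * (P.T * opt - s.total)))) hδ.le (fun s hs => ?_) ?_
  · rw [← ENNReal.ofReal_mul (Real.exp_pos _).le, ← Real.exp_add, ENNReal.one_le_ofReal]
    refine Real.one_le_exp ?_
    have hs' : r < optDP m P.B P.T P.b P.κ P.D - s.total := not_le.1 hs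
    have : 0 ≤ P.T * opt - s.total - (r - 1) := by linarith
    nlinarith [mul_nonneg hθ this]
  · rw [expect_mul_left]
    refine (mul_le_mul_right hmain _).trans ?_
    rw [← ENNReal.ofReal_mul (Real.exp_pos _).le, ← Real.exp_add]
    refine ENNReal.ofReal_le_ofReal (le_trans (Real.exp_le_exp.2 ?_) hδL)
    -- Of the two extra multiples of `L`, one covers the loss `θ ≤ L` caused by the nearly optimal
    -- policy, the other leaves the factor `exp (-L)`.
    have h1 : (exponentConst c a₁ a₂ + 2) * L ≤ θ * r := by
      calc (exponentConst c a₁ a₂ + 2) * L = θ * ((exponentConst c a₁ a₂ + 2) * Q) := by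
            rw [← hθQ]; ring
        _ ≤ θ * r := mul_le_mul_of_nonneg_left hr hθ
    linarith

theorem log_two_ge_half : (1 : ℝ) / 2 ≤ Real.log 2 := by
  linarith [Real.log_two_gt_d9]

theorem one_le_log_div {T δ : ℝ} (hT : 1 ≤ T) (hδ : 0 < δ) (hδ3 : 3 * δ ≤ 1) :
    1 ≤ Real.log (T / δ) := by
  rw [Real.le_log_iff_exp_le (by positivity), le_div_iff₀ hδ]
  have := Real.exp_one_lt_d9
  nlinarith

/-- The number of strategies is controlled by the confidence, because exploration with
probability at most one forces the number of rounds to be large. -/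
theorem log_card_action_le {n m : ℕ} {T δ N x : ℝ} (hn : n ≠ 0) (hm : 1 ≤ m) (hT : x ^ 3 = T)
    (hx : 1 ≤ x) (hδ : 0 < δ) (hδ3 : 3 * δ ≤ 1) (hN : (n : ℝ) ≤ N)
    (hNx : N * Real.log (Fintype.card (Action n m)) ≤ 7 * x ^ 2) :
    Real.log (Fintype.card (Action n m)) ≤ 5 * m * Real.log (T / δ) := by
  have hn1 : (1 : ℝ) ≤ n := Nat.one_le_cast.2 (Nat.pos_of_ne_zero hn)
  have hcard2 : (2 : ℝ) ≤ Fintype.card (Action n m) := by exact_mod_cast two_le_card_action hn hm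
  have hℓ : 1 / 2 ≤ Real.log (Fintype.card (Action n m)) :=
    log_two_ge_half.trans (Real.log_le_log two_pos hcard2)
  have hT1 : 1 ≤ T := by
    rw [← hT]
    exact one_le_pow₀ hx
  have hL1 := one_le_log_div hT1 hδ hδ3
  have h1 : Real.log (Fintype.card (Action n m)) ≤ m * Real.log (n + 1) := by
    rw [← Real.log_pow]
    refine Real.log_le_log (by linarith) ?_
    exact_mod_cast card_action_le n m
  -- Since `ℓ ≥ 1 / 2`, the hypothesis gives `n ≤ N ≤ 14 * x ^ 2 ≤ 14 * T`.
  have h2 : (n : ℝ) + 1 ≤ 28 * T := by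
    have h3 : N * (1 / 2) ≤ 7 * x ^ 2 :=
      (mul_le_mul_of_nonneg_left hℓ (by linarith)).trans hNx
    have h4 : x ^ 2 ≤ T := by
      rw [← hT]
      exact pow_le_pow_right₀ hx (by norm_num)
    linarith
  have h3 : Real.log (n + 1) ≤ 5 * Real.log (T / δ) := by
    have h4 : Real.log T ≤ Real.log (T / δ) := by
      refine Real.log_le_log (by linarith) ?_
      rw [le_div_iff₀ hδ]
      nlinarith
    have h5 : Real.log 28 ≤ 4 := by
      rw [Real.log_le_iff_le_exp (by norm_num)]
      have h6 : (2.7 : ℝ) ^ 4 ≤ Real.exp 1 ^ 4 :=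
        pow_le_pow_left₀ (by norm_num) (by linarith [Real.exp_one_gt_d9]) 4
      rw [← Real.exp_nat_mul] at h6
      norm_num at h6 ⊢
      linarith
    calc Real.log (n + 1) ≤ Real.log (28 * T) := Real.log_le_log (by linarith) h2
      _ = Real.log 28 + Real.log T := Real.log_mul (by norm_num) (by linarith)
      _ ≤ 5 * Real.log (T / δ) := by linarith
  calc Real.log (Fintype.card (Action n m)) ≤ m * Real.log (n + 1) := h1
    _ ≤ m * (5 * Real.log (T / δ)) := mul_le_mul_of_nonneg_left h3 (Nat.cast_nonneg m)
    _ = _ := by ring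

theorem exponentConst_pos {c a₁ a₂ : ℝ} (hc : 0 < c) (ha₁ : 0 < a₁) (ha₂ : 0 < a₂) :
    0 < exponentConst c a₁ a₂ := by
  unfold exponentConst incrementConst hedgeError
  positivity

end

end Blotto

/-! ### The regret bound -/

theorem theorem2 (c a₁ a₂ : ℝ) (hc : 0 < c) (ha₁ : 0 < a₁) :
    ∃ C : ℝ, 0 < C ∧
      ∀ (n m : ℕ) (P : Blotto.Setup n m),
        1 ≤ m → 1 ≤ P.T → (m : ℝ) ≤ c * P.B / P.T →
        (∀ i, 0 < P.b i) → ∑ i, P.b i = 1 →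
        0 ≤ P.κ → P.κ ≤ 1 →
        Blotto.Spanning P.μ →
        ∀ lam : ℝ,
          IsLeast {x : ℝ | x ≠ 0 ∧
            Module.End.HasEigenvalue (Matrix.toLin' (Blotto.cooccurrence P.μ)) x} lam →
        ∀ S E : ℕ, S = Fintype.card (Blotto.Action n m) →
          E = Fintype.card (Blotto.GraphEdge n m) →
        (P.γ : ℝ) = n / lam *
          Real.sqrt (Real.log S / ((n / (E * lam) + 1) * E * (P.T : ℝ) ^ (2 / 3 : ℝ))) →
        P.η = 1 / (1 + c) *
          Real.sqrt (Real.log S / ((n / (E * lam) + 1) * E * (P.T : ℝ) ^ (2 / 3 : ℝ))) →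
        a₁ / Real.sqrt P.T ≤ P.ε → P.ε ≤ a₂ / Real.sqrt P.T →
        ∀ δ : ℝ, 0 < δ → δ < 1 →
          1 - C * (δ * P.T) ≤
            P.probRegretLE
              (C * ((P.T : ℝ) ^ (1 / 6 : ℝ) *
                Real.sqrt (n * P.B / lam * Real.log (P.T / δ)))) := by
  -- For `a₂ ≤ 0` no rate `ε` meets both bounds, so any constant works.
  rcases le_or_gt a₂ 0 with ha₂ | ha₂
  · refine ⟨1, one_pos, fun n m P _ hT _ _ _ _ _ _ lam _ S E _ _ _ _ hε1 hε2 => ?_⟩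
    have hs : 0 < Real.sqrt P.T := Real.sqrt_pos.2 (Nat.cast_pos.2 hT)
    exact absurd (hε1.trans hε2) (not_le.2 ((div_nonpos_of_nonpos_of_nonneg ha₂ hs.le).trans_lt
      (div_pos ha₁ hs)))
  have hk := Blotto.exponentConst_pos hc ha₁ ha₂
  -- The summand `6` covers both the `2` required by `Regime.le_probRegretLE` and the trivial case
  -- `T ≤ 6 * (x ^ 2 * q)`.
  set k := Blotto.exponentConst c a₁ a₂ + 6 with hk_def
  have hk6 : 6 ≤ k := by linarith
  have hsc : 0 < Real.sqrt c := Real.sqrt_pos.2 hc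
  -- The summand `3` permits the assumption `δ ≤ 1 / 3`, which ensures `1 ≤ L` because `exp 1 < 3`.
  refine ⟨Real.sqrt c * k + 3, by positivity, ?_⟩
  intro n m P hm hT hmB hb hb1 hκ0 hκ1 hμ lam hlam S E hS hE hγ hη hε1 hε2 δ hδ0 hδ1
  have hn : n ≠ 0 := by
    rintro rfl
    simp at hb1
  have hT1 : (1 : ℝ) ≤ P.T := Nat.one_le_cast.2 hT
  have hm1 : (1 : ℝ) ≤ m := Nat.one_le_cast.2 hm
  have hn1 : (1 : ℝ) ≤ n := Nat.one_le_cast.2 (Nat.pos_of_ne_zero hn)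
  have hT0 : (0 : ℝ) < P.T := by linarith
  have hmT : m * (P.T : ℝ) ≤ c * P.B := (le_div_iff₀ hT0).1 hmB
  have hB : 0 < P.B := by
    rw [← Nat.cast_pos (α := ℝ)]
    by_contra h
    have : c * (P.B : ℝ) ≤ 0 := mul_nonpos_of_nonneg_of_nonpos hc.le (not_lt.1 h)
    have h2 : 1 ≤ m * (P.T : ℝ) := one_le_mul_of_one_le_of_one_le hm1 hT1
    linarith only [this, h2, hmT]
  have hprob0 : ∀ r, 0 ≤ P.probRegretLE r := fun r => ENNReal.toReal_nonneg
  have hlam0 := Blotto.least_eigenvalue_pos hlam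
  -- small confidence
  rcases le_or_gt 1 ((Real.sqrt c * k + 3) * (δ * P.T)) with hCδ | hCδ
  · exact le_trans (by linarith) (hprob0 _)
  have hδ3 : 3 * δ ≤ 1 := by
    have h1 : 3 * δ ≤ (Real.sqrt c * k + 3) * (δ * P.T) := by
      have h2 : δ ≤ δ * P.T := le_mul_of_one_le_right hδ0.le hT1
      have h3 : 0 ≤ Real.sqrt c * k * (δ * P.T) := by positivity
      linarith
    linarith
  set L := Real.log (P.T / δ) with hL
  have hL1 : 1 ≤ L := Blotto.one_le_log_div hT1 hδ0 hδ3
  set N := (n : ℝ) / lam with hN_def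
  have hNnm : (n * m : ℝ) ≤ N := Blotto.mul_le_div hμ hlam
  have hNn : (n : ℝ) ≤ N := (le_mul_of_one_le_right (Nat.cast_nonneg n) hm1).trans hNnm
  have hN1 : 1 ≤ N := hn1.trans hNn
  have hE6 : (E : ℝ) ≤ 6 * N := by
    have h1 : (E : ℝ) ≤ 6 * ((Blotto.cooccurrence P.μ).rank : ℝ) := by
      rw [hE]
      exact_mod_cast Blotto.card_graphEdge_le hμ hn hm
    linarith [Blotto.rank_le_div hlam]
  have hE0 : (0 : ℝ) < E := by
    rw [hE]
    exact_mod_cast Fintype.card_pos_iff.2 ⟨Sum.inr 0⟩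
  -- the parameters in terms of the cube root of the number of rounds
  set x := (P.T : ℝ) ^ (1 / 3 : ℝ) with hx_def
  have hx1 : 1 ≤ x := Real.one_le_rpow hT1 (by norm_num)
  have hx0 : 0 < x := by linarith
  have hx3 : x ^ 3 = P.T := by
    rw [hx_def, ← Real.rpow_natCast, ← Real.rpow_mul hT0.le]
    norm_num
  have hx2 : (P.T : ℝ) ^ (2 / 3 : ℝ) = x ^ 2 := by
    rw [hx_def, ← Real.rpow_natCast, ← Real.rpow_mul hT0.le]
    norm_num
  have hx6 : ((P.T : ℝ) ^ (1 / 6 : ℝ)) ^ 2 = x := by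
    rw [hx_def, ← Real.rpow_natCast, ← Real.rpow_mul hT0.le]
    norm_num
  set ℓ := Real.log (Fintype.card (Blotto.Action n m)) with hℓ_def
  have hℓ : 1 / 2 ≤ ℓ := by
    have hcard2 : (2 : ℝ) ≤ Fintype.card (Blotto.Action n m) := by
      exact_mod_cast Blotto.two_le_card_action hn hm
    exact Blotto.log_two_ge_half.trans (Real.log_le_log two_pos hcard2)
  set F := N + E with hF_def
  have hF : (n / (E * lam) + 1) * E = F := by
    rw [hF_def, hN_def]
    field_simp
  have hF0 : 0 < F := by linarith
  rw [hS, hF, hx2, ← hℓ_def] at hγ hη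
  have hγ0 : 0 < (P.γ : ℝ) := by
    rw [hγ]
    have : 0 < ℓ / (F * x ^ 2) := by positivity
    positivity
  have hγ2 : (P.γ : ℝ) ^ 2 * (F * x ^ 2) = N ^ 2 * ℓ := by
    rw [hγ, mul_pow, Real.sq_sqrt (by positivity)]
    field_simp
  have hηγ : (1 + c) * P.η * n = P.γ * lam := by
    rw [hγ, hη, hN_def]
    field_simp
  have hε0 : 0 < P.ε := lt_of_lt_of_le (div_pos ha₁ (Real.sqrt_pos.2 hT0)) hε1
  -- Here `γ ≤ 1` enters: it bounds the dimension by the number of rounds, which is what allows `ℓ`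
  -- to be compared with `m * L`.
  have hNx : N * ℓ ≤ 7 * x ^ 2 := by
    have h1 : N ^ 2 * ℓ ≤ 1 * (7 * N * x ^ 2) := by
      rw [← hγ2]
      have h2 : (P.γ : ℝ) ^ 2 ≤ 1 := pow_le_one₀ hγ0.le P.γ.2.2
      have h3 : F ≤ 7 * N := by linarith
      gcongr
    refine le_of_mul_le_mul_left (le_trans (le_of_eq ?_) (h1.trans (le_of_eq ?_)))
      (zero_lt_one.trans_le hN1) <;> ring
  have hℓL : ℓ ≤ 5 * m * L := Blotto.log_card_action_le hn hm hx3 hx1 hδ0 hδ3 hNn hNx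
  set q := Real.sqrt (N * m * L) with hq_def
  have hq0 : 0 ≤ q := Real.sqrt_nonneg _
  have hq2 : q ^ 2 = N * m * L := Real.sq_sqrt (by positivity)
  have hNm : 1 ≤ N * m := one_le_mul_of_one_le_of_one_le hN1 hm1
  have hq1 : 1 ≤ q := Real.one_le_sqrt.2 (one_le_mul_of_one_le_of_one_le hNm hL1)
  obtain ⟨b1, b2, b3, b4⟩ := Blotto.parameter_bounds hx1 hN1 hm1 hL1 hℓ (by linarith)
    (by linarith) hγ0 hγ2 hℓL hq0 hq2
  set r := (Real.sqrt c * k + 3) * ((P.T : ℝ) ^ (1 / 6 : ℝ) *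
    Real.sqrt (n * P.B / lam * L)) with hr_def
  have hr : k * (x ^ 2 * q) ≤ r := by
    have h1 : x ^ 2 * q ≤ Real.sqrt c * ((P.T : ℝ) ^ (1 / 6 : ℝ) *
        Real.sqrt (n * P.B / lam * L)) := by
      rw [← sq_le_sq₀ (by positivity) (by positivity), mul_pow, mul_pow, mul_pow, hx6,
        hq2, Real.sq_sqrt hc.le, Real.sq_sqrt (by positivity)]
      have h2 : N * L * x * (m * x ^ 3) ≤ N * L * x * (c * P.B) := by
        rw [hx3]
        exact mul_le_mul_of_nonneg_left hmT (by positivity)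
      calc (x ^ 2) ^ 2 * (N * m * L) = N * L * x * (m * x ^ 3) := by ring
        _ ≤ N * L * x * (c * P.B) := h2
        _ = c * (x * (n * P.B / lam * L)) := by rw [hN_def]; ring
    have h3 : 0 ≤ (P.T : ℝ) ^ (1 / 6 : ℝ) * Real.sqrt (n * P.B / lam * L) := by positivity
    have h4 := mul_le_mul_of_nonneg_left h1 (show 0 ≤ k by linarith)
    rw [hr_def]
    linarith
  have hδT : 0 ≤ δ * P.T := by positivity
  have hCδ0 : 0 ≤ (Real.sqrt c * k + 3) * (δ * P.T) := by positivity
  have hxq : 0 ≤ x ^ 2 * q := by positivity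
  have h6Q : 6 * (x ^ 2 * q) ≤ r := (mul_le_mul_of_nonneg_right hk6 hxq).trans hr
  have htriv : (P.T : ℝ) ≤ r → 1 - (Real.sqrt c * k + 3) * (δ * P.T) ≤ P.probRegretLE r :=
    fun h => le_trans (by linarith) (Blotto.one_le_probRegretLE P hT hb hb1 hκ0 hκ1 h)
  rw [hx3] at b1 b4
  -- For `γ > 1 / 2`, the bound on `γ * T` makes `r` at least `T`.
  rcases lt_or_ge (1 / 2 : ℝ) P.γ with hγhalf | hγhalf
  · refine htriv (le_trans ?_ h6Q)
    have h1 : (1 / 2 : ℝ) * P.T ≤ P.γ * P.T := mul_le_mul_of_nonneg_right hγhalf.le hT0.le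
    linarith only [h1, b1]
  -- For `L > x ^ 2`, already `q ≥ √L ≥ x` and `r` is at least `x ^ 3 = T`. Otherwise `θ * Λ ≤ 4`,
  -- as the exponential moment requires.
  rcases lt_or_ge (x ^ 2) L with hLx | hLx
  · refine htriv ?_
    have hxq' : x ≤ q := by
      rw [← sq_le_sq₀ hx0.le hq0, hq2]
      exact hLx.le.trans (le_mul_of_one_le_left (by positivity) hNm)
    have h1 : (P.T : ℝ) ≤ x ^ 2 * q := by
      rw [← hx3, pow_succ]
      exact mul_le_mul_of_nonneg_left hxq' (by positivity)
    linarith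
  have hreg : Blotto.Regime P c lam :=
    { c_pos := hc, n_ne := hn, m_pos := hm, T_pos := hT, B_pos := hB, m_le := hmB, b_pos := hb
      b_sum := hb1, κ_nonneg := hκ0, κ_le := hκ1, spanning := hμ, least := hlam, γ_pos := hγ0
      γ_le := hγhalf, η_eq := hηγ, ε_pos := hε0 }
  have hQT : Real.sqrt P.T ≤ x ^ 2 * q := by
    refine Real.sqrt_le_iff.2 ⟨hxq, ?_⟩
    calc (P.T : ℝ) = x ^ 3 * 1 := by rw [hx3, mul_one]
      _ ≤ x ^ 4 * q ^ 2 := mul_le_mul (pow_le_pow_right₀ hx1 (by norm_num)) (one_le_pow₀ hq1)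
          zero_le_one (by positivity)
      _ = _ := by ring
  have hfinal := hreg.le_probRegretLE ha₁ ha₂ hε1 hε2 hδ0 hL hL1 hQT b1 b2 (b3 hLx) b4
    (r := r) (le_trans (mul_le_mul_of_nonneg_right (by linarith) hxq) hr)
  refine le_trans ?_ hfinal
  have h2 : δ ≤ δ * P.T := le_mul_of_one_le_right hδ0.le hT1
  have h3 : 0 ≤ Real.sqrt c * k * (δ * P.T) := by positivity
  linarith
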